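/- **Conventions.** A linear form $f$ on a finite-dimensional complex Lie algebra $\mathfrak q$ has stabilizer $\mathfrak q(f)=\{x\in\mathfrak q : f([x,y])=0\ \forall y\in\mathfrak q\}$. It is *regular* if $\dim\mathfrak q(f)$ is minimal, and of *reductive type* if $\mathfrak q(f)/\mathfrak z(\mathfrak q)$ is a reductive Lie algebra whose center consists of (classes of) semisimple elements of $\mathfrak q$, where $\mathfrak z(\mathfrak q)$ is the center of $\mathfrak q$. The Lie algebra $\mathfrak q$ is *quasi-reductive* if it has a linear form of reductive type. Let $\mathfrak g$ be a complex simple Lie algebra of exceptional type ($G_2,F_4,E_6,E_7,E_8$), $\mathfrak h$ a Cartan subalgebra, $\pi$ a set of simple roots, $h_\alpha$ the coroot of a root $\alpha$. For $S\subset\pi$ let $\mathfrak p_S^+$ be the standard parabolic subalgebra generated by $\mathfrak h$, the positive root spaces and the root spaces $\mathfrak g_{-\alpha}$, $\alpha\in S$. The *cascade* $\mathcal K_S$ is defined recursively: $\mathcal K_\emptyset=\emptyset$; $\mathcal K_S$ is the union of the cascades of the connected components of $S$; if $S$ is connected, then $\mathcal K_S=\{S\}\cup\mathcal K_T$ with $T=\{\alpha\in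 S : \alpha(h_{\varepsilon_S})=0\}$, where $\varepsilon_S$ is the highest root of the root subsystem generated by $S$. Let $E_\pi\subset\mathfrak h^*$ be the span of the roots $\varepsilon_K$, $K\in\mathcal K_\pi$. Let $\alpha_\pi$ be the simple root joined to the lowest root in the extended Dynkin diagram. Fix root vectors $x_\alpha$ of a Chevalley basis of $\mathfrak g$. For $u\in\mathfrak g$ let $\varphi_u$ be the linear form $\kappa(u,\cdot)$, $\kappa$ the Killing form. **Theorem 5.6.** Let $\pi'\subset\pi$ be a connected subset of rank $2$ containing $\alpha_\pi$. (1) The parabolic subalgebra $\mathfrak p_{\pi'}^+$ is quasi-reductive. (2) Suppose moreover that $\mathfrak g$ is of type $F_4$, $E_6$, $E_7$ or $E_8$, and write $\pi'=\{\alpha_{i_1},\alpha_{i_2}\}$ with $\alpha_{i_2}=\alpha_\pi$. There are roots $\varepsilon_{j_0},\varepsilon_{j_1},\varepsilon_{j_2},\varepsilon_{j_3}$ among the $\varepsilon_K$, $K\in\mathcal K_\pi$, such that $\alpha_{i_1}=\varepsilon_{j_1}$, $\alpha_{i_2}=\tfrac12(\varepsilon_{j_0}-\varepsilon_{j_1}-\varepsilon_{j_2}-\varepsilon_{j_3})$,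 and such that $\beta_2=\varepsilon_{j_0}-\varepsilon_{\pi'}-\varepsilon_{j_2}$ and $\beta_3=\varepsilon_{j_0}-\varepsilon_{\pi'}-\varepsilon_{j_3}$ are positive roots. For $a=(a_K)\in(\mathbb C^*)^{\mathcal K_\pi}$ and $b\in\mathbb C^*$ put $u(a,b)=\sum_{K\in\mathcal K_\pi}a_Kx_{-\varepsilon_K}+b\,x_{\varepsilon_{\pi'}}$, and for $\lambda=(\lambda_2,\lambda_3,\mu_0,\mu_1,\mu_2,\mu_3,\nu)\in(\mathbb C^*)^7$ put $$x(\lambda)=x_{-\varepsilon_{\pi'}}+\lambda_2x_{\beta_2}+\lambda_3x_{\beta_3}+\sum_{k=0}^3\mu_kx_{\varepsilon_{j_k}}+\nu x_{-\varepsilon_{j_1}}.$$ There exist $a\in(\mathbb C^*)^{\mathcal K_\pi}$ and $b\in\mathbb C^*$ such that $\varphi_{u(a,b)}|_{\mathfrak p_{\pi'}^+}$ is regular. For all such $(a,b)$, the form $\varphi_{u(a,b)}|_{\mathfrak p_{\pi'}^+}$ is of reductive type; there is a $\lambda\in(\mathbb C^*)^7$ such that $x(\lambda)$ lies in its stabilizer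 $\mathfrak p_{\pi'}^+(\varphi_{u(a,b)})$; and for every such $\lambda$ the element $x(\lambda)$ is semisimple and $$\mathfrak p_{\pi'}^+(\varphi_{u(a,b)})=\bigcap_{K\in\mathcal K_\pi}\ker\varepsilon_K\ \oplus\ \mathbb C\,x(\lambda),$$ where the first summand is the annihilator of $E_\pi$ in $\mathfrak h$. -/

import Mathlib

open LieAlgebra LieModule

namespace QuasiReductive

noncomputable section

/-! ### Coadjoint stabilizers, regular forms, forms of reductive type -/

section Coadjoint

/-- The stabilizer `q(f) = {x | (ad* x) f = 0} = {x | f [x, y] = 0 for all y}` of a linear form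
`f` on a Lie algebra `q`, for the coadjoint representation. -/
def coadjointStabilizer {q : Type*} [LieRing q] [LieAlgebra ℂ q] (f : Module.Dual ℂ q) :
    LieSubalgebra ℂ q where
  carrier := {x | ∀ y, f ⁅x, y⁆ = 0}
  add_mem' := by
    intro x x' hx hx' y
    rw [add_lie, map_add, hx y, hx' y, add_zero]
  zero_mem' := by
    intro y
    simp
  smul_mem' := by
    intro c x hx y
    rw [smul_lie, map_smul, hx y, smul_zero]
  lie_mem' := by
    intro x x' hx hx' y
    have h1 : f ⁅x, ⁅x', y⁆⁆ = 0 := hx _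
    have h2 : f ⁅x', ⁅x, y⁆⁆ = 0 := hx' _
    rw [lie_lie, map_sub, h1, h2, sub_zero]

/-- A linear form is regular if its stabilizer has the smallest possible dimension. -/
def IsRegularForm {q : Type*} [LieRing q] [LieAlgebra ℂ q] (f : Module.Dual ℂ q) : Prop :=
  ∀ g : Module.Dual ℂ q,
    Module.finrank ℂ (coadjointStabilizer f) ≤ Module.finrank ℂ (coadjointStabilizer g)

/-- The center of `q`, as an ideal of the stabilizer `q(f)` (which contains it). -/
def centerInStabilizer {q : Type*} [LieRing q] [LieAlgebra ℂ q] (f : Module.Dual ℂ q) :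
    LieIdeal ℂ (coadjointStabilizer f) :=
  LieIdeal.comap (coadjointStabilizer f).incl (LieAlgebra.center ℂ q)

/-- A linear form `f` on `q` is of reductive type if `q(f) / z(q)` is a reductive Lie algebra
(its radical is its center) whose center consists of (classes of) semisimple elements of `q`.
Modulo `z(q)`, the Lie algebra `q` is a Lie algebra of endomorphisms through `ad`, and
semisimplicity of an element is that of its adjoint action. -/
def IsReductiveType {q : Type*} [LieRing q] [LieAlgebra ℂ q] (f : Module.Dual ℂ q) : Prop :=
  LieAlgebra.HasCentralRadical ℂ (coadjointStabilizer f ⧸ centerInStabilizer f) ∧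
  ∀ x : coadjointStabilizer f,
    (LieSubmodule.Quotient.mk x : coadjointStabilizer f ⧸ centerInStabilizer f) ∈
      LieAlgebra.center ℂ (coadjointStabilizer f ⧸ centerInStabilizer f) →
    (LieAlgebra.ad ℂ q (x : q)).IsSemisimple

/-- A Lie algebra is quasi-reductive if it has a linear form of reductive type. -/
def IsQuasiReductive (q : Type*) [LieRing q] [LieAlgebra ℂ q] : Prop :=
  ∃ f : Module.Dual ℂ q, IsReductiveType f

/-- The restriction to a subalgebra `p` of the linear form `φ_u = κ(u, ·)`, where `κ` is the
Killing form of `L`. -/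
def killingFunctional {L : Type*} [LieRing L] [LieAlgebra ℂ L] (p : LieSubalgebra ℂ L) (u : L) :
    Module.Dual ℂ p :=
  (killingForm ℂ L u).comp p.toSubmodule.subtype

/-- The stabilizer in `p` of the restriction of `φ_u` to `p`, as a subspace of `L`. -/
def stabilizerIn {L : Type*} [LieRing L] [LieAlgebra ℂ L] (p : LieSubalgebra ℂ L) (u : L) :
    Submodule ℂ L :=
  (coadjointStabilizer (killingFunctional p u)).toSubmodule.map p.toSubmodule.subtype

end Coadjoint

/-! ### Roots, Kostant's cascade, standard parabolic subalgebras

A triangular decomposition of `L` is given by a Cartan subalgebra `H` and a base `b` of the root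
system of `(L, H)`; the simple roots are the elements of `b.support`. -/

section Roots

variable {L : Type*} [LieRing L] [LieAlgebra ℂ L] [FiniteDimensional ℂ L] [IsKilling ℂ L]
  {H : LieSubalgebra ℂ L} [H.IsCartanSubalgebra]

/-- Roots are joined if they are distinct and not orthogonal. On the set of simple roots this is
the (simple graph underlying the) Dynkin diagram. -/
def dynkinGraph (H : LieSubalgebra ℂ L) [H.IsCartanSubalgebra] : SimpleGraph H.root :=
  SimpleGraph.fromRel fun α β => (IsKilling.rootSystem H).pairing α β ≠ 0

/-- A set of simple roots is connected if it is non-empty and connected in the Dynkin diagram. -/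
def IsConnectedSet (K : Set H.root) : Prop := ((dynkinGraph H).induce K).Connected

/-- `K` is a connected component of the set `S` of simple roots. -/
def IsComponent (S K : Set H.root) : Prop :=
  K ⊆ S ∧ IsConnectedSet K ∧ ∀ α ∈ S, α ∉ K → ∀ β ∈ K, ¬ (dynkinGraph H).Adj α β

/-- `θ` is the highest root of the root subsystem `Δ_K` generated by a set `K` of simple roots
(the roots in the `ℤ`-span of `K`): it is a non-negative integral combination of elements of `K`
and so is `θ - β` for every root `β` of `Δ_K`. -/
def IsHighestRoot (K : Set H.root) (θ : H.root) : Prop :=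
  (IsKilling.rootSystem H).root θ ∈ AddSubmonoid.closure ((IsKilling.rootSystem H).root '' K) ∧
  ∀ β : H.root,
    (IsKilling.rootSystem H).root β ∈ AddSubgroup.closure ((IsKilling.rootSystem H).root '' K) →
    (IsKilling.rootSystem H).root θ - (IsKilling.rootSystem H).root β ∈
      AddSubmonoid.closure ((IsKilling.rootSystem H).root '' K)

/-- `InCascade S K`: the set `K` belongs to the cascade of `S`. The cascade of `S` is the union of
the cascades of the connected components of `S`, and the cascade of a connected `K` consists of `K`
and of the cascade of the set of those `α ∈ K` which are orthogonal to the highest root of `K`. -/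
inductive InCascade : Set H.root → Set H.root → Prop
  | component {S K : Set H.root} : IsComponent S K → InCascade S K
  | step {S K K' : Set H.root} {θ : H.root} : IsComponent S K → IsHighestRoot K θ →
      InCascade {α ∈ K | (IsKilling.rootSystem H).pairing α θ = 0} K' → InCascade S K'

/-- The set `ℰ_S` of the highest roots `ε_K`, for `K` in the cascade of `S`. -/
def cascadeRoots (S : Set H.root) : Set H.root :=
  {ε | ∃ K, InCascade S K ∧ IsHighestRoot K ε}

/-- The subspace `E_S` of the dual of `H` spanned by `ℰ_S`. -/
def cascadeSpan (S : Set H.root) : Submodule ℂ (Module.Dual ℂ H) :=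
  Submodule.span ℂ ((IsKilling.rootSystem H).root '' cascadeRoots S)

/-- The annihilator of `E_S` in `H`, as a subspace of `L`. -/
def cascadeAnnihilator (S : Set H.root) : Submodule ℂ L :=
  (cascadeSpan S).dualCoannihilator.map H.toSubmodule.subtype

/-- `α` is a simple root which is joined to the lowest root in the extended Dynkin diagram, that
is, which is not orthogonal to the highest root. -/
def IsJoinedToLowestRoot (b : (IsKilling.rootSystem H).Base) (α : H.root) : Prop :=
  α ∈ b.support ∧ ∃ θ : H.root, IsHighestRoot (↑b.support : Set H.root) θ ∧
    (IsKilling.rootSystem H).pairing α θ ≠ 0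

/-- The Cartan matrix of the base `b` is the matrix `A`, up to a numbering of the simple roots. -/
def HasCartanType (b : (IsKilling.rootSystem H).Base) {n : ℕ} (A : Matrix (Fin n) (Fin n) ℤ) :
    Prop :=
  ∃ e : b.support ≃ Fin n, ∀ i j, b.cartanMatrix i j = A (e i) (e j)

/-- Type `F₄`, `E₆`, `E₇` or `E₈`. -/
def IsTypeFOrE (b : (IsKilling.rootSystem H).Base) : Prop :=
  HasCartanType b CartanMatrix.F₄ ∨ HasCartanType b CartanMatrix.E₆ ∨
    HasCartanType b CartanMatrix.E₇ ∨ HasCartanType b CartanMatrix.E₈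

/-- Exceptional type. -/
def IsExceptionalType (b : (IsKilling.rootSystem H).Base) : Prop :=
  HasCartanType b CartanMatrix.G₂ ∨ IsTypeFOrE b

/-- The standard parabolic subalgebra `p_S⁺`, generated by `H`, by the root spaces of the positive
roots and by the root spaces of the opposites of the elements of `S`. -/
def parabolic (b : (IsKilling.rootSystem H).Base) (S : Set H.root) : LieSubalgebra ℂ L :=
  LieSubalgebra.lieSpan ℂ L
    ((H : Set L) ∪ {y | ∃ α : H.root, b.IsPos α ∧ y ∈ rootSpace H α.1} ∪
      {y | ∃ α ∈ S, y ∈ rootSpace H (-α.1)})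

/-- The family `x_α`, `α` a root, is the family of root vectors of a Chevalley basis:
`x_α ∈ L_α`, `[x_α, x_{-α}] = h_α`, and `[x_α, x_β] = ±(p + 1) x_{α + β}` if `α`, `β` and `α + β`
are roots and `β - p α` is the source of the `α`-string through `β`. (The value of the family at
the weight zero is irrelevant.) -/
structure IsChevalleySystem (x : Weight ℂ H L → L) : Prop where
  mem_rootSpace : ∀ α : Weight ℂ H L, α.IsNonZero → x α ∈ rootSpace H α
  lie_neg : ∀ α : Weight ℂ H L, α.IsNonZero → ⁅x α, x (-α)⁆ = (IsKilling.coroot α : L)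
  lie_add : ∀ α β γ : Weight ℂ H L, α.IsNonZero → β.IsNonZero → γ.IsNonZero →
    (γ : H → ℂ) = α + β →
    ⁅x α, x β⁆ = ((chainBotCoeff α β : ℂ) + 1) • x γ ∨
      ⁅x α, x β⁆ = -((chainBotCoeff α β : ℂ) + 1) • x γ

open Classical in
/-- `u(a, c) = ∑ a_K x_{-ε_K} + ∑ c_K x_{ε_K}`, where the first sum is over the cascade of `S₂` and
the second over the cascade of `S₁`. The coefficients are indexed by the roots `ε_K`. -/
def cascadeVector (x : Weight ℂ H L → L) (S₂ S₁ : Set H.root) (a c : H.root → ℂ) : L :=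
  ∑ ε : H.root with ε ∈ cascadeRoots S₂, a ε • x (-ε.1) +
    ∑ ε : H.root with ε ∈ cascadeRoots S₁, c ε • x ε.1

/-- `x(λ) = x_{-θ} + λ₂ x_{β₂} + λ₃ x_{β₃} + ∑ₖ μₖ x_{εₖ} + ν x_{-ε₁}` for
`λ = (λ₂, λ₃, μ₀, μ₁, μ₂, μ₃, ν)`. -/
def stabilizerVector (x : Weight ℂ H L → L) (θ β₂ β₃ : H.root) (ε : Fin 4 → H.root)
    (l₂ l₃ : ℂ) (m : Fin 4 → ℂ) (n : ℂ) : L :=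
  x (-θ.1) + l₂ • x β₂.1 + l₃ • x β₃.1 + ∑ k, m k • x (ε k).1 + n • x (-(ε 1).1)

end Roots

end

end QuasiReductive

/-!
**The roots.** In types `F₄`, `E₆`, `E₇`, `E₈` the simple root `α₂` joined to the lowest root and
its neighbour `α₁` are long, and exactly four elements `ε₀`, `ε₁ = α₁`, `ε₂`, `ε₃` of Kostant's
cascade are not orthogonal to `α₂`. Together with `α₂` they span a subsystem of type `D₄` with
simple roots `α₂`, `ε₁`, `ε₂`, `ε₃` and highest root `ε₀`, which gives `2 α₂ = ε₀ - ε₁ - ε₂ - ε₃`.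
All of this is read off the Cartan matrix: `IsCascadeData` lists what has to be checked, by
`decide`, for each of the four matrices, and `IsTypeFOrE.exists_quadruple` is the outcome. Two
facts about the cascade are needed in general: its elements are strongly orthogonal
(`cascadeRoots_strongly_orthogonal`), and every positive root which is not in the cascade is a
summand of exactly one of its elements (`mem_cascadeRoots_or_exists_summand`,
`cascadeRoots_summand_unique`).

**The stabilizer.** Let `p` be the parabolic subalgebra, `θ = α₁ + α₂` and `u = ∑ w_ε + v` with `0
≠ w_ε ∈ L_{-ε}` for `ε` in the cascade and `0 ≠ v ∈ L_θ`. Let `k ⊆ H` be the annihilator of the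
cascade; it stabilizes the form `κ(u, ·)` on `p`, because `θ` is a linear combination of the `εₖ`.
Conversely, if an element of the stabilizer has no component in `L_{-θ}`, then one weight after
the other is seen to be absent from it, until it lies in `k`
(`IsCascadePair.mem_cascadeAnnihilator`). So the stabilizer is at most one dimension larger than
`k`. It is in fact larger: `IsCascadeConfiguration.exists_isTransversal` builds an element `x = t
+ y₂ + y₃ + ∑ zₖ + n` of it from any `0 ≠ t ∈ L_{-θ}`, by solving for the components successively
so that all terms of `[x, u]` cancel except some in the nilradical of `p`, to which `p` is
orthogonal. Hence the stabilizer is `k ⊕ ℂ x`, and it is commutative.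

**Semisimplicity.** For every `x` of this shape `κ(x, x) ≠ 0` and `κ(H, x) = 0`. The nilpotent
part `y` of `x` satisfies `ad y ∈ ℂ[ad x]`, and by this it stabilizes the form as well, so that `y
= h + c x` with `h ∈ k`. Since `κ(y, x) = 0`, we get `c = 0`; then `y = h` is in `H`, and being
nilpotent it is zero (`IsCascadeConfiguration.isSemisimple_ad`). The stabilizer is therefore a
commutative algebra of semisimple elements, and the form is of reductive type.

**Regularity.** The Killing form is nondegenerate on the stabilizer `r = k ⊕ ℂ x`. Since `r` is
commutative, `κ(r, [r, p]) = 0`, hence `r ∩ [r, p] = 0`. This condition makes a form `f` regular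
(`isRegularForm_of_disjoint`): by the inverse function theorem every form close to `f` is, up to
an automorphism `exp (ad y)`, the sum of `f` and of a form which vanishes on `[r, p]`, so its
stabilizer is not smaller than `r`; and stabilizers on the line through `f` and any `g` are, close
to `f` but away from it, not larger than the one of `g`. In particular all choices of the nonzero
coefficients in `u` give regular forms.

In type `G₂` the parabolic subalgebra is the whole algebra, and a regular element of `H` gives a
form of reductive type (`isQuasiReductive_of_support_subset`).
-/

namespace QuasiReductive

/-! ### Coordinates of roots, long roots, highest roots -/

section RootCoordinates

set_option linter.unusedSectionVars false

open Set

variable {ι k M N : Type*} [Finite ι] [Field k] [CharZero k] [AddCommGroup M] [Module k M]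
  [AddCommGroup N] [Module k N] {P : RootPairing ι k M N} (b : P.Base)

/-- The (integral) coordinates of the root `α` with respect to the simple roots. -/
noncomputable def coeff (α : ι) : b.support → ℤ := b.toWeightBasisInt.repr (P.rootSpanMem ℤ α)

lemma root_eq_sum_coeff (α : ι) : P.root α = ∑ i, coeff b α i • P.root i := by
  have h := congrArg (fun v : P.rootSpan ℤ => (v : M))
    (b.toWeightBasisInt.sum_repr (P.rootSpanMem ℤ α))
  simpa [coeff] using h.symm

lemma sum_smul_root_injective {c d : b.support → ℤ}
    (h : ∑ i, c i • P.root i = ∑ i, d i • P.root i) : c = d :=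
  funext <| Fintype.linearIndependent_iffₛ.mp (b.linearIndepOn_root.restrict_scalars' ℤ) c d h

lemma coeff_eq_of_root_eq {α : ι} {c : b.support → ℤ} (h : P.root α = ∑ i, c i • P.root i) :
    coeff b α = c :=
  sum_smul_root_injective b (by rw [← h, ← root_eq_sum_coeff])

lemma coeff_injective : Function.Injective (coeff b) := fun α β h =>
  P.root.injective (by rw [root_eq_sum_coeff b α, h, ← root_eq_sum_coeff])

lemma coeff_of_root_eq_zsmul_add {α β γ : ι} {m n : ℤ}
    (h : P.root γ = m • P.root α + n • P.root β) : coeff b γ = m • coeff b α + n • coeff b β := by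
  refine coeff_eq_of_root_eq b ?_
  rw [h, root_eq_sum_coeff b α, root_eq_sum_coeff b β, Finset.smul_sum, Finset.smul_sum,
    ← Finset.sum_add_distrib]
  refine Finset.sum_congr rfl fun i _ => ?_
  simp only [Pi.add_apply, Pi.smul_apply]
  module

lemma coeff_add {α β γ : ι} (h : P.root γ = P.root α + P.root β) :
    coeff b γ = coeff b α + coeff b β := by
  simpa using coeff_of_root_eq_zsmul_add b (m := 1) (n := 1) (by simpa using h)

lemma coeff_sub {α β γ : ι} (h : P.root γ = P.root α - P.root β) :
    coeff b γ = coeff b α - coeff b β := by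
  simpa [sub_eq_add_neg] using
    coeff_of_root_eq_zsmul_add b (m := 1) (n := -1) (by simpa [sub_eq_add_neg] using h)

lemma coeff_neg {α γ : ι} (h : P.root γ = -P.root α) : coeff b γ = -coeff b α := by
  simpa using coeff_of_root_eq_zsmul_add b (m := -1) (n := 0) (β := α) (by simpa using h)

open Classical in
lemma coeff_simple (i : b.support) : coeff b (i : ι) = Pi.single i 1 := by
  refine coeff_eq_of_root_eq b ?_
  rw [Finset.sum_eq_single i] <;> simp +contextual

lemma coeff_simple_apply {κ : Type*} [DecidableEq κ] (e : b.support ≃ κ) (i j : b.support) :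
    coeff b (i : ι) j = if e j = e i then 1 else 0 := by
  classical
  rw [coeff_simple, Pi.single_apply]
  simp only [e.injective.eq_iff]

lemma coeff_simple_self (i : b.support) : coeff b (i : ι) i = 1 := by simp [coeff_simple]

lemma coeff_simple_nonneg (i : b.support) : 0 ≤ coeff b (i : ι) := by
  classical
  rw [coeff_simple, Pi.single_nonneg]
  exact zero_le_one

lemma coeff_ne_zero (α : ι) : coeff b α ≠ 0 := fun h =>
  P.ne_zero α (by simp [root_eq_sum_coeff b α, h])

lemma height_eq_sum_coeff (α : ι) : b.height α = ∑ i, coeff b α i := by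
  classical
  let f : ι → ℤ := fun j => if h : j ∈ b.support then coeff b α ⟨j, h⟩ else 0
  have hf : P.root α = ∑ j ∈ b.support, f j • P.root j := by
    rw [← Finset.sum_coe_sort, root_eq_sum_coeff b α]
    exact Finset.sum_congr rfl fun i _ => by simp [f]
  rw [RootPairing.Base.height_eq_sum hf, ← Finset.sum_coe_sort]
  exact Finset.sum_congr rfl fun i _ => by simp [f]

lemma coeff_nonneg_or_nonpos (α : ι) : 0 ≤ coeff b α ∨ coeff b α ≤ 0 := by
  classical
  obtain ⟨f, hf, h⟩ := b.exists_root_eq_sum_nat_or_neg α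
  rcases h with h | h
  · left
    have : coeff b α = fun i : b.support => (f i : ℤ) := coeff_eq_of_root_eq b (by
      rw [h, ← Finset.sum_coe_sort]; simp)
    rw [this]; intro i; simp
  · right
    have : coeff b α = fun i : b.support => -(f i : ℤ) := coeff_eq_of_root_eq b (by
      rw [h, ← Finset.sum_coe_sort]; simp)
    rw [this]; intro i; simp

lemma isPos_iff_coeff_nonneg {α : ι} : b.IsPos α ↔ 0 ≤ coeff b α := by
  rw [RootPairing.Base.isPos_iff', height_eq_sum_coeff]
  refine ⟨fun h => (coeff_nonneg_or_nonpos b α).resolve_right fun h' => ?_,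
    fun h => Finset.sum_nonneg fun i _ => h i⟩
  have h0 : ∑ i, coeff b α i = 0 := le_antisymm (Finset.sum_nonpos fun i _ => h' i) h
  exact coeff_ne_zero b α (funext fun i => by
    simpa using (Finset.sum_eq_zero_iff_of_nonpos fun i _ => h' i).mp h0 i (Finset.mem_univ i))

lemma not_isPos_iff_coeff_nonpos {α : ι} : ¬ b.IsPos α ↔ coeff b α ≤ 0 := by
  rw [isPos_iff_coeff_nonneg]
  refine ⟨fun h => (coeff_nonneg_or_nonpos b α).resolve_left h, fun h h' => ?_⟩
  exact coeff_ne_zero b α (le_antisymm h h')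

lemma isPos_of_coeff_pos {α : ι} {i : b.support} (h : 0 < coeff b α i) : b.IsPos α := by
  by_contra h'
  exact absurd ((not_isPos_iff_coeff_nonpos b).mp h' i) (by simpa using h)

lemma IsPos.not_of_root_eq_neg {α β : ι} (h : P.root β = -P.root α) (hα : b.IsPos α) :
    ¬ b.IsPos β := by
  rw [not_isPos_iff_coeff_nonpos, coeff_neg b h]
  simpa using (isPos_iff_coeff_nonneg b).mp hα

section Pairing

variable [P.IsCrystallographic]

lemma pairingIn_eq_sum_coeff (α β : ι) :
    P.pairingIn ℤ α β = ∑ i : b.support, coeff b α i * P.pairingIn ℤ i β := by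
  refine FaithfulSMul.algebraMap_injective ℤ k ?_
  simp only [RootPairing.algebraMap_pairingIn, map_sum, map_mul]
  rw [← RootPairing.root_coroot_eq_pairing, root_eq_sum_coeff b α]
  simp [LinearMap.sum_apply]

omit [Finite ι] in
lemma pairingIn_add_left {α β γ : ι} (h : P.root γ = P.root α + P.root β) (δ : ι) :
    P.pairingIn ℤ γ δ = P.pairingIn ℤ α δ + P.pairingIn ℤ β δ := by
  refine FaithfulSMul.algebraMap_injective ℤ k ?_
  simp only [RootPairing.algebraMap_pairingIn, map_add, ← RootPairing.root_coroot_eq_pairing, h,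
    LinearMap.add_apply]

omit [Finite ι] in
lemma pairingIn_sub_left {α β γ : ι} (h : P.root γ = P.root α - P.root β) (δ : ι) :
    P.pairingIn ℤ γ δ = P.pairingIn ℤ α δ - P.pairingIn ℤ β δ := by
  refine FaithfulSMul.algebraMap_injective ℤ k ?_
  simp only [RootPairing.algebraMap_pairingIn, map_sub, ← RootPairing.root_coroot_eq_pairing, h,
    LinearMap.sub_apply]

omit [Finite ι] in
lemma pairingIn_neg_left {α β : ι} (h : P.root β = -P.root α) (δ : ι) :
    P.pairingIn ℤ β δ = -P.pairingIn ℤ α δ := by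
  refine FaithfulSMul.algebraMap_injective ℤ k ?_
  simp only [RootPairing.algebraMap_pairingIn, map_neg, ← RootPairing.root_coroot_eq_pairing, h,
    LinearMap.neg_apply]

omit [Finite ι] in
lemma root_reflectionPerm_eq (α β : ι) :
    P.root (P.reflectionPerm β α) = P.root α - P.pairingIn ℤ α β • P.root β := by
  rw [RootPairing.root_reflectionPerm, RootPairing.reflection_apply_root' ℤ]

lemma pairingIn_pos_iff_swap {α β : ι} : 0 < P.pairingIn ℤ α β ↔ 0 < P.pairingIn ℤ β α :=
  P.zero_lt_pairingIn_iff' ℤ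

lemma pairingIn_eq_zero_swap {α β : ι} : P.pairingIn ℤ α β = 0 ↔ P.pairingIn ℤ β α = 0 :=
  P.pairingIn_eq_zero_iff

lemma pairingIn_nonneg_swap {α β : ι} (h : 0 ≤ P.pairingIn ℤ α β) : 0 ≤ P.pairingIn ℤ β α := by
  rcases h.lt_or_eq with h | h
  · exact (pairingIn_pos_iff_swap.mp h).le
  · exact (pairingIn_eq_zero_swap.mp h.symm).ge

/-- A root `α` is long if `⟨β, α^∨⟩ ≤ 1` for all roots `β ≠ α`. In an irreducible root system of
rank at least two this says that `α` has maximal length. -/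
def IsLong (P : RootPairing ι k M N) [P.IsCrystallographic] (α : ι) : Prop :=
  ∀ β, β ≠ α → P.pairingIn ℤ β α ≤ 1

omit [Finite ι] in
lemma IsLong.reflectionPerm {α : ι} (h : IsLong P α) (β : ι) :
    IsLong P (P.reflectionPerm β α) := by
  intro γ hγ
  have h1 : P.pairingIn ℤ γ (P.reflectionPerm β α) = P.pairingIn ℤ (P.reflectionPerm β γ) α := by
    refine FaithfulSMul.algebraMap_injective ℤ k ?_
    simp only [RootPairing.algebraMap_pairingIn]
    rw [RootPairing.pairing_reflectionPerm]
  rw [h1]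
  refine h _ fun h' => hγ ?_
  rw [← h', RootPairing.reflectionPerm_self]

omit [Finite ι] in
lemma IsLong.eq_of_two_le {α β : ι} (h : IsLong P α) (hβ : 2 ≤ P.pairingIn ℤ β α) : β = α := by
  by_contra h'
  have := h β h'
  omega

/-- For a long root `α` and a root `β` with `⟨β, α^∨⟩ ≥ 0`, the sum `α + β` is not a root. -/
lemma IsLong.add_notMem {α β : ι} (h : IsLong P α) (hβ : 0 ≤ P.pairingIn ℤ β α) :
    P.root α + P.root β ∉ range P.root := by
  rintro ⟨γ, hγ⟩
  have h1 := pairingIn_add_left hγ α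
  rw [RootPairing.pairingIn_same] at h1
  have h2 := h.eq_of_two_le (β := γ) (by omega)
  subst h2
  exact P.ne_zero β (by simpa using hγ)

omit [Finite ι] in
lemma IsLong.of_add {α β γ : ι} (h : IsLong P α) (h1 : P.pairingIn ℤ α β = -1)
    (hγ : P.root γ = P.root α + P.root β) : IsLong P γ := by
  have : γ = P.reflectionPerm β α := P.root.injective (by
    rw [hγ, root_reflectionPerm_eq, h1]; module)
  exact this ▸ h.reflectionPerm β

/-- A root joined to a long root by a simple bond is long. -/
lemma IsLong.of_pairingIn {α β : ι} (h : IsLong P α) (h1 : P.pairingIn ℤ α β = -1)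
    (h2 : P.pairingIn ℤ β α = -1) : IsLong P β := by
  have h3 : P.reflectionPerm α (P.reflectionPerm β α) = β := P.root.injective (by
    have h4 : P.root (P.reflectionPerm β α) = P.root α + P.root β := by
      rw [root_reflectionPerm_eq, h1]; module
    have h5 := pairingIn_add_left h4 α
    rw [RootPairing.pairingIn_same, h2] at h5
    rw [root_reflectionPerm_eq, h5, h4]; module)
  exact h3 ▸ (h.reflectionPerm β).reflectionPerm α

end Pairing

/-- The root `α` is a linear combination of the simple roots in `K`. -/
def SupportedIn (K : Set ι) (α : ι) : Prop := ∀ i : b.support, (i : ι) ∉ K → coeff b α i = 0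

variable {b}

lemma SupportedIn.mono {K K' : Set ι} {α : ι} (h : SupportedIn b K α) (hK : K ⊆ K') :
    SupportedIn b K' α := fun i hi => h i fun h' => hi (hK h')

lemma SupportedIn.add {K : Set ι} {α β γ : ι} (hα : SupportedIn b K α) (hβ : SupportedIn b K β)
    (h : P.root γ = P.root α + P.root β) : SupportedIn b K γ := fun i hi => by
  rw [coeff_add b h, Pi.add_apply, hα i hi, hβ i hi, add_zero]

lemma supportedIn_simple {K : Set ι} {i : b.support} (hi : (i : ι) ∈ K) : SupportedIn b K i := by
  classical
  intro j hj
  rw [coeff_simple, Pi.single_eq_of_ne]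
  rintro rfl
  exact hj hi

lemma supportedIn_simple_iff {K : Set ι} {i : b.support} : SupportedIn b K i ↔ (i : ι) ∈ K := by
  refine ⟨fun h => ?_, supportedIn_simple⟩
  by_contra hi
  simpa [coeff_simple_self] using h i hi

/-- `θ` is the largest element of the set of roots that are combinations of elements of `K`. -/
structure IsHighest (b : P.Base) (K : Set ι) (θ : ι) : Prop where
  isPos : b.IsPos θ
  supportedIn : SupportedIn b K θ
  coeff_le : ∀ β, SupportedIn b K β → coeff b β ≤ coeff b θ

lemma IsHighest.unique {K : Set ι} {θ θ' : ι} (h : IsHighest b K θ) (h' : IsHighest b K θ') :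
    θ = θ' :=
  coeff_injective b (le_antisymm (h'.coeff_le _ h.supportedIn) (h.coeff_le _ h'.supportedIn))

variable [P.IsCrystallographic]

lemma pairingIn_eq_zero_of_supportedIn {K : Set ι} {α β : ι} (hα : SupportedIn b K α)
    (h : ∀ i ∈ K, P.pairingIn ℤ i β = 0) : P.pairingIn ℤ α β = 0 := by
  rw [pairingIn_eq_sum_coeff b]
  refine Finset.sum_eq_zero fun i _ => ?_
  by_cases hi : (i : ι) ∈ K
  · rw [h i hi, mul_zero]
  · rw [hα i hi, zero_mul]

lemma pairingIn_nonneg_of_supportedIn {K : Set ι} {α β : ι} (hpos : b.IsPos α)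
    (hα : SupportedIn b K α) (h : ∀ i : b.support, (i : ι) ∈ K → 0 ≤ P.pairingIn ℤ i β) :
    0 ≤ P.pairingIn ℤ α β := by
  rw [pairingIn_eq_sum_coeff b]
  refine Finset.sum_nonneg fun i _ => ?_
  by_cases hi : (i : ι) ∈ K
  · exact mul_nonneg ((isPos_iff_coeff_nonneg b).mp hpos i) (h i hi)
  · rw [hα i hi, zero_mul]

lemma IsHighest.pairingIn_simple_nonneg {K : Set ι} {θ : ι} (h : IsHighest b K θ)
    {i : b.support} (hi : (i : ι) ∈ K) : 0 ≤ P.pairingIn ℤ i θ := by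
  refine pairingIn_nonneg_swap ?_
  by_contra! hlt
  obtain ⟨γ, hγ⟩ := P.root_add_root_mem_of_pairingIn_neg hlt fun h' =>
    IsPos.not_of_root_eq_neg b h' (RootPairing.Base.isPos_of_mem_support i.2) h.isPos
  have h1 : coeff b γ i ≤ coeff b θ i :=
    h.coeff_le γ (h.supportedIn.add (supportedIn_simple hi) hγ) i
  rw [coeff_add b hγ, Pi.add_apply, coeff_simple_self] at h1
  omega

lemma IsHighest.pairingIn_nonneg {K : Set ι} {θ α : ι} (h : IsHighest b K θ)
    (hpos : b.IsPos α) (hα : SupportedIn b K α) : 0 ≤ P.pairingIn ℤ α θ :=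
  pairingIn_nonneg_of_supportedIn hpos hα fun _ hi => h.pairingIn_simple_nonneg hi

/-- The highest root is long within its root subsystem: if `p = ⟨α, θ^∨⟩ ≥ 2`, then `pθ - α` is a
root below `θ`, which forces `α = θ`. -/
lemma IsHighest.eq_of_two_le {K : Set ι} {θ α : ι} (h : IsHighest b K θ)
    (hα : SupportedIn b K α) (h2 : 2 ≤ P.pairingIn ℤ α θ) : α = θ := by
  let := P.indexNeg
  obtain ⟨γ, hγ⟩ : ∃ γ, P.root γ = P.pairingIn ℤ α θ • P.root θ + (-1 : ℤ) • P.root α := by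
    refine ⟨-(P.reflectionPerm θ α), ?_⟩
    rw [RootPairing.indexNeg_neg, RootPairing.root_reflectionPerm,
      RootPairing.reflection_apply_self, root_reflectionPerm_eq]; module
  have hc := coeff_of_root_eq_zsmul_add b hγ
  have hle := h.coeff_le γ fun i hi => by simp [hc, h.supportedIn i hi, hα i hi]
  refine coeff_injective b (le_antisymm (h.coeff_le α hα) fun i => ?_)
  have h3 := hle i
  have h4 := (isPos_iff_coeff_nonneg b).mp h.isPos i
  simp only [hc, Pi.add_apply, Pi.smul_apply, smul_eq_mul, Pi.zero_apply] at h3 h4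
  nlinarith

lemma IsHighest.isLong {θ : ι} (h : IsHighest b b.support θ) : IsLong P θ := by
  intro β hβ
  by_contra! h'
  exact hβ (h.eq_of_two_le (fun i hi => absurd i.2 hi) (by omega))

/-- If `⟨α, θ^∨⟩ = 1` for a root `α` below the highest root `θ`, then `θ - α` is a positive root. -/
lemma IsHighest.exists_sub {K : Set ι} {θ α : ι} (h : IsHighest b K θ)
    (hα : SupportedIn b K α) (h1 : P.pairingIn ℤ α θ = 1) :
    ∃ β, b.IsPos β ∧ P.root β = P.root θ - P.root α := by
  let := P.indexNeg
  have hβ : P.root (-(P.reflectionPerm θ α)) = P.root θ - P.root α := by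
    rw [RootPairing.indexNeg_neg, RootPairing.root_reflectionPerm,
      RootPairing.reflection_apply_self, root_reflectionPerm_eq, h1]; module
  refine ⟨_, ?_, hβ⟩
  rw [isPos_iff_coeff_nonneg, coeff_sub b hβ, sub_nonneg]
  exact h.coeff_le α hα

variable (P) in
/-- A non-empty set of roots which is not a union of two non-empty orthogonal subsets. -/
def IsIndecomposable (K : Set ι) : Prop :=
  K.Nonempty ∧ ∀ A ⊆ K, A.Nonempty → (∀ i ∈ K, i ∉ A → ∀ j ∈ A, P.pairingIn ℤ i j = 0) → A = K

/-- Otherwise `⟨θ, θ^∨⟩ ≤ 0`. -/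
lemma exists_pairingIn_simple_pos {K : Set ι} {θ : ι} (hpos : b.IsPos θ)
    (hθ : SupportedIn b K θ) : ∃ i : b.support, (i : ι) ∈ K ∧ 0 < P.pairingIn ℤ i θ := by
  by_contra! h
  have : P.pairingIn ℤ θ θ ≤ 0 := by
    rw [pairingIn_eq_sum_coeff b]
    refine Finset.sum_nonpos fun i _ => ?_
    by_cases hi : (i : ι) ∈ K
    · exact mul_nonpos_of_nonneg_of_nonpos ((isPos_iff_coeff_nonneg b).mp hpos i) (h i hi)
    · rw [hθ i hi, zero_mul]
  simp at this

/-- Two roots with positive coordinates, dominant on an indecomposable set, are not orthogonal. -/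
lemma pairingIn_pos_of_dominant {K : Set ι} {θ θ' : ι} (hθ : SupportedIn b K θ)
    (hθ' : SupportedIn b K θ')
    (hfull : ∀ i : b.support, (i : ι) ∈ K → 0 < coeff b θ i) (hpos' : b.IsPos θ')
    (hdom' : ∀ i : b.support, (i : ι) ∈ K → 0 ≤ P.pairingIn ℤ i θ') :
    0 < P.pairingIn ℤ θ θ' := by
  obtain ⟨i, hiK, hi⟩ := exists_pairingIn_simple_pos hpos' hθ'
  rw [pairingIn_eq_sum_coeff b]
  refine Finset.sum_pos' (fun j _ => ?_) ⟨i, Finset.mem_univ i, mul_pos (hfull i hiK) hi⟩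
  by_cases hj : (j : ι) ∈ K
  · exact mul_nonneg (hfull j hj).le (hdom' j hj)
  · rw [hθ j hj, zero_mul]

/-- A positive root which is dominant on an indecomposable set `K` has full support: `K` does not
split into the support and its complement. -/
lemma coeff_pos_of_dominant {K : Set ι} (hK : IsIndecomposable P K) (hKb : K ⊆ b.support) {θ : ι}
    (hpos : b.IsPos θ) (hθ : SupportedIn b K θ)
    (hdom : ∀ i : b.support, (i : ι) ∈ K → 0 ≤ P.pairingIn ℤ θ i)
    {i : b.support} (hi : (i : ι) ∈ K) : 0 < coeff b θ i := by
  have hnn := (isPos_iff_coeff_nonneg b).mp hpos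
  set A : Set ι := {j | ∃ hj : j ∈ b.support, 0 < coeff b θ ⟨j, hj⟩}
  have hAK : A ⊆ K := by
    rintro j ⟨hj, hj'⟩
    by_contra h
    rw [hθ ⟨j, hj⟩ h] at hj'
    exact lt_irrefl _ hj'
  have hA : A = K := by
    refine hK.2 A hAK ?_ ?_
    · by_contra! hemp
      refine coeff_ne_zero b θ (le_antisymm (fun j => ?_) hnn)
      by_contra! h
      have : (j : ι) ∈ A := ⟨j.2, h⟩
      rw [hemp] at this
      exact this
    · intro j hjK hjA l hlA
      lift j to b.support using hKb hjK
      lift l to b.support using hlA.1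
      have h0 : coeff b θ j = 0 := le_antisymm (not_lt.mp fun h => hjA ⟨j.2, h⟩) (hnn j)
      have hterm : ∀ m : b.support, coeff b θ m * P.pairingIn ℤ m j ≤ 0 := by
        intro m
        rcases eq_or_ne m j with rfl | hmj
        · rw [h0, zero_mul]
        · exact mul_nonpos_of_nonneg_of_nonpos (hnn m)
            (b.pairingIn_le_zero_of_ne (fun h => hmj (Subtype.ext h)) m.2 j.2)
      have hsum := hdom j hjK
      rw [pairingIn_eq_sum_coeff b] at hsum
      have hz := (Finset.sum_eq_zero_iff_of_nonpos fun m _ => hterm m).mp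
        (le_antisymm (Finset.sum_nonpos fun m _ => hterm m) hsum) l (Finset.mem_univ l)
      obtain ⟨_, hl⟩ := hlA
      exact pairingIn_eq_zero_swap.mp ((mul_eq_zero.mp hz).resolve_left hl.ne')
  obtain ⟨_, h⟩ : (i : ι) ∈ A := hA ▸ hi
  exact h

/-- An indecomposable set of simple roots has a highest root. -/
theorem exists_isHighest {K : Set ι} (hK : IsIndecomposable P K) (hKb : K ⊆ b.support) :
    ∃ θ, IsHighest b K θ := by
  -- maximal roots supported in `K` are positive and dominant on `K`, so any two of them coincide
  set s : Set (b.support → ℤ) := coeff b '' {γ | SupportedIn b K γ}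
  have hs : s.Finite := Set.toFinite _
  have key : ∀ {θ}, SupportedIn b K θ → Maximal (· ∈ s) (coeff b θ) →
      b.IsPos θ ∧ ∀ i : b.support, (i : ι) ∈ K → 0 ≤ P.pairingIn ℤ θ i := by
    intro θ hθ hmax
    have hpos : b.IsPos θ := by
      by_contra hneg
      rw [not_isPos_iff_coeff_nonpos] at hneg
      obtain ⟨i, hi⟩ := hK.1
      lift i to b.support using hKb hi
      have h1 := hmax.2 ⟨i, supportedIn_simple hi, rfl⟩ (hneg.trans (coeff_simple_nonneg b i)) i
      rw [coeff_simple_self] at h1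
      exact absurd (h1.trans (hneg i)) (by simp)
    refine ⟨hpos, fun i hi => ?_⟩
    by_contra! hlt
    obtain ⟨γ, hγ⟩ := P.root_add_root_mem_of_pairingIn_neg hlt fun h' =>
      IsPos.not_of_root_eq_neg b h' (RootPairing.Base.isPos_of_mem_support i.2) hpos
    have h1 : coeff b γ i ≤ coeff b θ i := hmax.2 ⟨γ, hθ.add (supportedIn_simple hi) hγ, rfl⟩
      (by rw [coeff_add b hγ]; exact le_add_of_nonneg_right (coeff_simple_nonneg b i)) i
    rw [coeff_add b hγ, Pi.add_apply, coeff_simple_self] at h1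
    omega
  have uniq : ∀ {θ θ'}, SupportedIn b K θ → SupportedIn b K θ' → Maximal (· ∈ s) (coeff b θ) →
      Maximal (· ∈ s) (coeff b θ') → θ = θ' := by
    intro θ θ' hθ hθ' hm hm'
    obtain ⟨hp, hd⟩ := key hθ hm
    obtain ⟨hp', hd'⟩ := key hθ' hm'
    by_contra hne
    obtain ⟨γ, hγ⟩ := P.root_sub_root_mem_of_pairingIn_pos (pairingIn_pos_of_dominant hθ hθ'
      (fun i hi => coeff_pos_of_dominant hK hKb hp hθ hd hi) hp'
      fun i hi => pairingIn_nonneg_swap (hd' i hi)) hne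
    have hc := coeff_sub b hγ
    rcases coeff_nonneg_or_nonpos b γ with h | h
    · rw [hc, sub_nonneg] at h
      exact hne (coeff_injective b (le_antisymm (hm'.2 ⟨θ, hθ, rfl⟩ h) h))
    · rw [hc, sub_nonpos] at h
      exact hne (coeff_injective b (le_antisymm h (hm.2 ⟨θ', hθ', rfl⟩ h)))
  obtain ⟨i, hi⟩ := hK.1
  lift i to b.support using hKb hi
  obtain ⟨_, -, ⟨θ, hθ, rfl⟩, hmax⟩ := hs.exists_le_maximal
    (show coeff b i ∈ s from ⟨i, supportedIn_simple hi, rfl⟩)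
  have hm : Maximal (· ∈ s) (coeff b θ) := ⟨⟨θ, hθ, rfl⟩, hmax⟩
  refine ⟨θ, (key hθ hm).1, hθ, fun β hβ => ?_⟩
  obtain ⟨_, hle, ⟨θ', hθ', rfl⟩, hmax'⟩ := hs.exists_le_maximal
    (show coeff b β ∈ s from ⟨β, hβ, rfl⟩)
  rwa [uniq hθ hθ' hm ⟨⟨θ', hθ', rfl⟩, hmax'⟩]

/-- A long positive root whose support is `K` and which is dominant on `K` is the highest root. -/
lemma IsHighest.eq_of_dominant {K : Set ι} {θ v : ι} (h : IsHighest b K θ) (hlong : IsLong P v)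
    (hv : SupportedIn b K v) (hfull : ∀ i : b.support, (i : ι) ∈ K → 0 < coeff b v i)
    (hdom : ∀ i : b.support, (i : ι) ∈ K → 0 ≤ P.pairingIn ℤ v i) : θ = v := by
  by_contra hne
  obtain ⟨γ, hγ⟩ := P.root_sub_root_mem_of_pairingIn_pos (pairingIn_pos_iff_swap.mp
    (pairingIn_pos_of_dominant hv h.supportedIn hfull h.isPos
      fun i hi => h.pairingIn_simple_nonneg hi)) hne
  have hc := coeff_sub b hγ
  have hγpos : b.IsPos γ := by
    rw [isPos_iff_coeff_nonneg, hc, sub_nonneg]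
    exact h.coeff_le v hv
  have h1 : 0 ≤ P.pairingIn ℤ γ v := pairingIn_nonneg_of_supportedIn (K := K) hγpos
    (fun i hi => by rw [hc, Pi.sub_apply, h.supportedIn i hi, hv i hi, sub_zero])
    fun i hi => pairingIn_nonneg_swap (hdom i hi)
  have h2 := pairingIn_sub_left hγ v
  rw [RootPairing.pairingIn_same] at h2
  exact hne (hlong.eq_of_two_le (by omega))

/-- Some simple root is long if some root is: every root is conjugate to a simple root under the
Weyl group. -/
lemma exists_isLong_simple [P.IsReduced] {θ : ι} (h : IsLong P θ) :
    ∃ i ∈ b.support, IsLong P i := by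
  by_contra! hno
  have : ∀ i, ¬ IsLong P i := fun i => by
    induction i using b.induction_reflect with
    | h₀ i hi => exact fun h' => hi (by simpa using h'.reflectionPerm i)
    | h₁ i hi => exact hno i hi
    | h₂ i j hi hj => exact fun h' => hi (by simpa using h'.reflectionPerm j)
  exact this θ h

end RootCoordinates

/-! ### Kostant's cascade -/

section Closures

set_option linter.unusedSectionVars false

open Set

variable {ι k M N : Type*} [Finite ι] [Field k] [CharZero k] [AddCommGroup M] [Module k M]
  [AddCommGroup N] [Module k N] {P : RootPairing ι k M N} (b : P.Base)

lemma sum_smul_root_mem_closure_iff {K : Set ι} (hK : K ⊆ b.support) (c : b.support → ℤ) :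
    ∑ i, c i • P.root i ∈ AddSubmonoid.closure (P.root '' K) ↔
      0 ≤ c ∧ ∀ i : b.support, (i : ι) ∉ K → c i = 0 := by
  classical
  constructor
  · suffices ∀ v ∈ AddSubmonoid.closure (P.root '' K), ∃ d : b.support → ℤ,
        v = ∑ i, d i • P.root i ∧ 0 ≤ d ∧ ∀ i : b.support, (i : ι) ∉ K → d i = 0 by
      intro h
      obtain ⟨d, hd, h1⟩ := this _ h
      rwa [sum_smul_root_injective b hd]
    intro v hv
    induction hv using AddSubmonoid.closure_induction with
    | mem v hv =>
      obtain ⟨i, hi, rfl⟩ := hv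
      refine ⟨Pi.single ⟨i, hK hi⟩ 1, ?_, by rw [Pi.single_nonneg]; exact zero_le_one, ?_⟩
      · rw [Finset.sum_eq_single ⟨i, hK hi⟩] <;> simp +contextual
      · intro j hj
        rw [Pi.single_eq_of_ne]
        rintro rfl
        exact hj hi
    | zero => exact ⟨0, by simp, le_rfl, fun _ _ => rfl⟩
    | add v w _ _ hv hw =>
      obtain ⟨d, rfl, h0, h1⟩ := hv
      obtain ⟨e, rfl, h0', h1'⟩ := hw
      exact ⟨d + e, by simp [add_smul, Finset.sum_add_distrib], add_nonneg h0 h0',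
        fun i hi => by simp [h1 i hi, h1' i hi]⟩
  · rintro ⟨h0, h1⟩
    refine sum_mem fun i _ => ?_
    by_cases hi : (i : ι) ∈ K
    · obtain ⟨n, hn⟩ := Int.eq_ofNat_of_zero_le (h0 i)
      rw [hn, natCast_zsmul]
      exact nsmul_mem (AddSubmonoid.subset_closure (mem_image_of_mem P.root hi)) n
    · rw [h1 i hi, zero_smul]
      exact zero_mem _

lemma sum_smul_root_mem_addSubgroup_closure {K : Set ι} {c : b.support → ℤ}
    (hc : ∀ i : b.support, (i : ι) ∉ K → c i = 0) :
    ∑ i, c i • P.root i ∈ AddSubgroup.closure (P.root '' K) := by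
  refine sum_mem fun i _ => ?_
  by_cases hi : (i : ι) ∈ K
  · exact zsmul_mem (AddSubgroup.subset_closure (mem_image_of_mem P.root hi)) _
  · rw [hc i hi, zero_smul]
    exact zero_mem _

lemma eq_sum_smul_root_of_mem_addSubgroup_closure {K : Set ι} (hK : K ⊆ b.support) {v : M}
    (hv : v ∈ AddSubgroup.closure (P.root '' K)) : ∃ d : b.support → ℤ,
      v = ∑ i, d i • P.root i ∧ ∀ i : b.support, (i : ι) ∉ K → d i = 0 := by
  classical
  induction hv using AddSubgroup.closure_induction with
  | mem v hv =>
    obtain ⟨i, hi, rfl⟩ := hv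
    refine ⟨Pi.single ⟨i, hK hi⟩ 1, ?_, ?_⟩
    · rw [Finset.sum_eq_single ⟨i, hK hi⟩] <;> simp +contextual
    · intro j hj
      rw [Pi.single_eq_of_ne]
      rintro rfl
      exact hj hi
  | zero => exact ⟨0, by simp, fun _ _ => rfl⟩
  | add v w _ _ hv hw =>
    obtain ⟨d, rfl, h1⟩ := hv
    obtain ⟨e, rfl, h1'⟩ := hw
    exact ⟨d + e, by simp [add_smul, Finset.sum_add_distrib],
      fun i hi => by simp [h1 i hi, h1' i hi]⟩
  | neg v _ hv =>
    obtain ⟨d, rfl, h1⟩ := hv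
    exact ⟨-d, by simp, fun i hi => by simp [h1 i hi]⟩

end Closures

section Orthogonality

open Set

variable {ι k M N : Type*} [Field k] [CharZero k] [AddCommGroup M] [Module k M]
  [AddCommGroup N] [Module k N] {P : RootPairing ι k M N} [P.IsCrystallographic]

lemma pairing_eq_zero_iff_pairingIn {α β : ι} : P.pairing α β = 0 ↔ P.pairingIn ℤ α β = 0 := by
  rw [← P.algebraMap_pairingIn ℤ]
  simp

lemma add_mem_range_iff_sub_mem_range {α β : ι} (h : P.pairingIn ℤ α β = 0) :
    P.root α + P.root β ∈ range P.root ↔ P.root α - P.root β ∈ range P.root := by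
  constructor
  · rintro ⟨γ, hγ⟩
    refine ⟨P.reflectionPerm β γ, ?_⟩
    have := pairingIn_add_left hγ β
    rw [RootPairing.pairingIn_same, h] at this
    rw [root_reflectionPerm_eq, this, hγ]
    module
  · rintro ⟨γ, hγ⟩
    refine ⟨P.reflectionPerm β γ, ?_⟩
    have := pairingIn_sub_left hγ β
    rw [RootPairing.pairingIn_same, h] at this
    rw [root_reflectionPerm_eq, this, hγ]
    module

end Orthogonality

section Cascade

open Set

variable {L : Type*} [LieRing L] [LieAlgebra ℂ L] [FiniteDimensional ℂ L] [IsKilling ℂ L]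
  {H : LieSubalgebra ℂ L} [H.IsCartanSubalgebra]

/-- The highest root in terms of sums of roots agrees with the one in terms of coordinates. -/
lemma isHighestRoot_iff (b : (IsKilling.rootSystem H).Base) {K : Set H.root}
    (hK : K ⊆ b.support) (θ : H.root) : IsHighestRoot K θ ↔ IsHighest b K θ := by
  have hsub : ∀ β, (IsKilling.rootSystem H).root θ - (IsKilling.rootSystem H).root β =
      ∑ i, (coeff b θ - coeff b β) i • (IsKilling.rootSystem H).root i := fun β => by
    rw [root_eq_sum_coeff b θ, root_eq_sum_coeff b β, ← Finset.sum_sub_distrib]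
    exact Finset.sum_congr rfl fun i _ => by rw [Pi.sub_apply, sub_smul]
  constructor
  · rintro ⟨h1, h2⟩
    rw [root_eq_sum_coeff b θ, sum_smul_root_mem_closure_iff b hK] at h1
    refine ⟨(isPos_iff_coeff_nonneg b).mpr h1.1, h1.2, fun β hβ => ?_⟩
    have h3 := h2 β (by
      rw [root_eq_sum_coeff b β]; exact sum_smul_root_mem_addSubgroup_closure b hβ)
    rw [hsub, sum_smul_root_mem_closure_iff b hK] at h3
    exact sub_nonneg.mp h3.1
  · intro h
    refine ⟨?_, fun β hβ => ?_⟩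
    · rw [root_eq_sum_coeff b θ, sum_smul_root_mem_closure_iff b hK]
      exact ⟨(isPos_iff_coeff_nonneg b).mp h.isPos, h.supportedIn⟩
    · obtain ⟨d, hd, hd'⟩ := eq_sum_smul_root_of_mem_addSubgroup_closure b hK hβ
      have hβ' : SupportedIn b K β := by rwa [SupportedIn, coeff_eq_of_root_eq b hd]
      rw [hsub, sum_smul_root_mem_closure_iff b hK]
      refine ⟨sub_nonneg.mpr (h.coeff_le β hβ'), fun i hi => ?_⟩
      rw [Pi.sub_apply, h.supportedIn i hi, hβ' i hi, sub_zero]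

lemma dynkinGraph_adj {α β : H.root} : (dynkinGraph H).Adj α β ↔
    α ≠ β ∧ (IsKilling.rootSystem H).pairingIn ℤ α β ≠ 0 := by
  rw [dynkinGraph, SimpleGraph.fromRel_adj, ne_eq, ne_eq, ne_eq, pairing_eq_zero_iff_pairingIn,
    pairing_eq_zero_iff_pairingIn, pairingIn_eq_zero_swap (α := β), or_self, ne_eq]

lemma IsConnectedSet.isIndecomposable {K : Set H.root} (h : IsConnectedSet K) :
    IsIndecomposable (IsKilling.rootSystem H) K := by
  obtain ⟨x, hx⟩ := h.nonempty
  have hpre := h.preconnected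
  refine ⟨⟨x, hx⟩, fun A hAK ⟨a, ha⟩ horth => hAK.antisymm fun y hy => ?_⟩
  have hr := (SimpleGraph.reachable_iff_reflTransGen _ _).mp (hpre ⟨a, hAK ha⟩ ⟨y, hy⟩)
  suffices ∀ z : K, Relation.ReflTransGen ((dynkinGraph H).induce K).Adj ⟨a, hAK ha⟩ z →
      (z : H.root) ∈ A from this _ hr
  intro z hz
  induction hz with
  | refl => exact ha
  | tail _ hadj ih =>
    rename_i c d _
    by_contra hd
    exact (dynkinGraph_adj.mp hadj).2
      (pairingIn_eq_zero_swap.mp (horth d d.2 hd c ih))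

lemma isConnectedSet_singleton (α : H.root) : IsConnectedSet ({α} : Set H.root) := by
  have : Nonempty ({α} : Set H.root) := ⟨⟨α, rfl⟩⟩
  refine ⟨fun x y => ?_⟩
  rw [Subsingleton.elim x y]

lemma IsConnectedSet.insert {K : Set H.root} (hK : IsConnectedSet K) {α β : H.root} (hβ : β ∈ K)
    (hadj : (dynkinGraph H).Adj α β) : IsConnectedSet (insert α K) := by
  have hpair : ((dynkinGraph H).induce {α, β}).Connected :=
    SimpleGraph.connected_induce_iff.mpr
      (SimpleGraph.Subgraph.top_induce_pair_connected_of_adj hadj)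
  have := SimpleGraph.induce_union_connected hpair.preconnected hK.preconnected
    ⟨β, by simp, hβ⟩
  have h2 : ({α, β} ∪ K : Set H.root) = Insert.insert α K := by
    ext x; simp only [mem_union, mem_insert_iff, mem_singleton_iff]
    constructor
    · rintro ((h | rfl) | h) <;> tauto
    · tauto
  rwa [h2] at this

lemma IsComponent.pairingIn_eq_zero {S K : Set H.root} (h : IsComponent S K) {α β : H.root}
    (hα : α ∈ S) (hαK : α ∉ K) (hβ : β ∈ K) :
    (IsKilling.rootSystem H).pairingIn ℤ α β = 0 := by
  by_contra h'
  exact h.2.2 α hα hαK β hβ (dynkinGraph_adj.mpr ⟨fun h => hαK (h ▸ hβ), h'⟩)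

/-- The component is a maximal connected subset containing `α`. -/
lemma exists_isComponent_mem {S : Set H.root} {α : H.root} (hα : α ∈ S) :
    ∃ K, IsComponent S K ∧ α ∈ K := by
  obtain ⟨K, -, ⟨hKS, hK, hαK⟩, hmax⟩ :=
    (Set.toFinite {K : Set H.root | K ⊆ S ∧ IsConnectedSet K ∧ α ∈ K}).exists_le_maximal
      (show ({α} : Set H.root) ∈ _ from
        ⟨by simpa using hα, isConnectedSet_singleton α, rfl⟩)
  refine ⟨K, ⟨hKS, hK, fun β hβ hβK γ hγ hadj => hβK ?_⟩, hαK⟩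
  exact hmax ⟨insert_subset hβ hKS, hK.insert hγ hadj, mem_insert_of_mem _ hαK⟩
    (subset_insert β K) (mem_insert β K)

lemma IsComponent.eq_or_orthogonal {S K K' : Set H.root} (h : IsComponent S K)
    (h' : IsComponent S K') :
    K = K' ∨ ∀ α ∈ K, ∀ β ∈ K', (IsKilling.rootSystem H).pairingIn ℤ α β = 0 := by
  by_cases hne : (K ∩ K').Nonempty
  · left
    have h1 := h.2.1.isIndecomposable.2 (K ∩ K') inter_subset_left hne fun i hi hi' j hj =>
      h'.pairingIn_eq_zero (h.1 hi) (fun h => hi' ⟨hi, h⟩) hj.2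
    have h2 := h'.2.1.isIndecomposable.2 (K ∩ K') inter_subset_right hne fun i hi hi' j hj =>
      h.pairingIn_eq_zero (h'.1 hi) (fun h => hi' ⟨h, hi⟩) hj.1
    exact h1.symm.trans h2
  · right
    exact fun α hα β hβ => h'.pairingIn_eq_zero (h.1 hα) (fun h => hne ⟨α, hα, h⟩) hβ

lemma InCascade.subset {S K : Set H.root} (h : InCascade S K) : K ⊆ S := by
  induction h with
  | component h => exact h.1
  | step h _ _ ih => exact fun α hα => h.1 (ih hα).1

lemma InCascade.isConnectedSet {S K : Set H.root} (h : InCascade S K) : IsConnectedSet K := by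
  induction h with
  | component h => exact h.2.1
  | step _ _ _ ih => exact ih

/-- The highest root is unique. -/
lemma IsHighestRoot.unique {b : (IsKilling.rootSystem H).Base} {K : Set H.root}
    (hK : K ⊆ b.support) {θ θ' : H.root} (h : IsHighestRoot K θ) (h' : IsHighestRoot K θ') :
    θ = θ' :=
  ((isHighestRoot_iff b hK θ).mp h).unique ((isHighestRoot_iff b hK θ').mp h')

/-- `K'` consists of elements of `K` which are orthogonal to the highest root of `K`. -/
def IsNested (K K' : Set H.root) : Prop :=
  ∀ θ, IsHighestRoot K θ → ∀ α ∈ K', α ∈ K ∧ (IsKilling.rootSystem H).pairingIn ℤ α θ = 0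

/-- Two members of the cascade are equal, orthogonal or nested. -/
theorem InCascade.trichotomy {b : (IsKilling.rootSystem H).Base} {S K K' : Set H.root}
    (hS : S ⊆ b.support) (h : InCascade S K) (h' : InCascade S K') :
    K = K' ∨ (∀ α ∈ K, ∀ β ∈ K', (IsKilling.rootSystem H).pairingIn ℤ α β = 0) ∨
      IsNested K K' ∨ IsNested K' K := by
  induction h generalizing K' with
  | @component S K hK =>
    cases h' with
    | component hK' =>
      rcases hK.eq_or_orthogonal hK' with h | h
      exacts [.inl h, .inr (.inl h)]
    | @step _ K₁ _ θ hK₁ hθ hK' =>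
      rcases hK.eq_or_orthogonal hK₁ with rfl | h
      · refine .inr (.inr (.inl fun θ' hθ' α hα => ?_))
        rw [hθ'.unique (hK.1.trans hS) hθ]
        exact ⟨(hK'.subset hα).1, pairing_eq_zero_iff_pairingIn.mp (hK'.subset hα).2⟩
      · exact .inr (.inl fun α hα β hβ => h α hα β (hK'.subset hβ).1)
  | @step S K K₁ θ hK hθ hK₁ ih =>
    cases h' with
    | component hK' =>
      rcases hK.eq_or_orthogonal hK' with rfl | h
      · refine .inr (.inr (.inr fun θ' hθ' α hα => ?_))
        rw [hθ'.unique (hK.1.trans hS) hθ]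
        exact ⟨(hK₁.subset hα).1, pairing_eq_zero_iff_pairingIn.mp (hK₁.subset hα).2⟩
      · exact .inr (.inl fun α hα β hβ => h α (hK₁.subset hα).1 β hβ)
    | @step _ K₂ _ θ₂ hK₂ hθ₂ hK' =>
      rcases hK.eq_or_orthogonal hK₂ with rfl | h
      · obtain rfl := hθ.unique (hK.1.trans hS) hθ₂
        exact ih (fun α hα => hS (hK.1 hα.1)) hK'
      · exact .inr (.inl fun α hα β hβ => h α (hK₁.subset hα).1 β (hK'.subset hβ).1)

variable {b : (IsKilling.rootSystem H).Base} {S : Set H.root}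

lemma pairingIn_eq_zero_of_orthogonal {K K' : Set H.root}
    (h : ∀ α ∈ K, ∀ β ∈ K', (IsKilling.rootSystem H).pairingIn ℤ α β = 0) {α β : H.root}
    (hα : SupportedIn b K α) (hβ : SupportedIn b K' β) :
    (IsKilling.rootSystem H).pairingIn ℤ α β = 0 :=
  pairingIn_eq_zero_of_supportedIn hα fun i hi => pairingIn_eq_zero_swap.mp
    (pairingIn_eq_zero_of_supportedIn hβ fun j hj => pairingIn_eq_zero_swap.mp (h i hi j hj))

lemma sub_notMem_of_orthogonal {K K' : Set H.root}
    (h : ∀ α ∈ K, ∀ β ∈ K', (IsKilling.rootSystem H).pairingIn ℤ α β = 0) {α β : H.root}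
    (hα : SupportedIn b K α) (hβ : SupportedIn b K' β) (hαpos : b.IsPos α) (hβpos : b.IsPos β) :
    (IsKilling.rootSystem H).root α - (IsKilling.rootSystem H).root β ∉
      range (IsKilling.rootSystem H).root := by
  have hdisj : ∀ i ∈ K, i ∉ K' := fun i hi hi' => by simpa using h i hi i hi'
  have key : ∀ {A : Set H.root} {γ : H.root}, SupportedIn b A γ → b.IsPos γ →
      ∃ i : b.support, (i : H.root) ∈ A ∧ 0 < coeff b γ i := fun {A γ} hγ hpos => by
    have hnn := (isPos_iff_coeff_nonneg b).mp hpos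
    by_contra! hno
    refine coeff_ne_zero b γ (le_antisymm (fun i => ?_) hnn)
    by_cases hi : (i : H.root) ∈ A
    exacts [hno i hi, (hγ i hi).le]
  rintro ⟨γ, hγ⟩
  have hc := coeff_sub b hγ
  obtain ⟨i, hiK, hi⟩ := key hα hαpos
  obtain ⟨j, hjK, hj⟩ := key hβ hβpos
  have hi' : 0 < coeff b γ i := by
    rw [hc, Pi.sub_apply, hβ i (hdisj i hiK), sub_zero]; exact hi
  have hj' : coeff b γ j < 0 := by
    rw [hc, Pi.sub_apply, hα j fun h => hdisj j h hjK, zero_sub]; omega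
  exact absurd ((isPos_iff_coeff_nonneg b).mp (isPos_of_coeff_pos b hi') j) (by simpa using hj')

lemma IsHighest.sub_notMem_of_isNested {K K' : Set H.root} {ε ε' : H.root}
    (hK : K ⊆ b.support) (hε : IsHighest b K ε) (hε' : IsHighest b K' ε') (hn : IsNested K K') :
    (IsKilling.rootSystem H).pairingIn ℤ ε ε' = 0 ∧
    (IsKilling.rootSystem H).root ε - (IsKilling.rootSystem H).root ε' ∉
      range (IsKilling.rootSystem H).root := by
  have h1 := hn ε ((isHighestRoot_iff b hK ε).mpr hε)
  have h0 : (IsKilling.rootSystem H).pairingIn ℤ ε ε' = 0 := pairingIn_eq_zero_swap.mp <|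
    pairingIn_eq_zero_of_supportedIn hε'.supportedIn fun i hi => (h1 i hi).2
  refine ⟨h0, fun h => ?_⟩
  obtain ⟨γ, hγ⟩ := (add_mem_range_iff_sub_mem_range h0).mpr h
  have h2 := hε.coeff_le γ (hε.supportedIn.add (hε'.supportedIn.mono fun i hi => (h1 i hi).1) hγ)
  rw [coeff_add b hγ, add_le_iff_nonpos_right] at h2
  exact coeff_ne_zero b ε' (le_antisymm h2 ((isPos_iff_coeff_nonneg b).mp hε'.isPos))

lemma exists_isHighest_of_mem_cascadeRoots (hS : S ⊆ b.support) {ε : H.root}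
    (hε : ε ∈ cascadeRoots S) : ∃ K, InCascade S K ∧ K ⊆ b.support ∧ IsHighest b K ε := by
  obtain ⟨K, hK, h⟩ := hε
  have hKb := hK.subset.trans hS
  exact ⟨K, hK, hKb, (isHighestRoot_iff b hKb ε).mp h⟩

/-- Distinct elements of the cascade are strongly orthogonal. -/
theorem cascadeRoots_strongly_orthogonal (hS : S ⊆ b.support) {ε ε' : H.root}
    (hε : ε ∈ cascadeRoots S) (hε' : ε' ∈ cascadeRoots S) (hne : ε ≠ ε') :
    (IsKilling.rootSystem H).pairingIn ℤ ε ε' = 0 ∧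
    (IsKilling.rootSystem H).root ε - (IsKilling.rootSystem H).root ε' ∉
      range (IsKilling.rootSystem H).root ∧
    (IsKilling.rootSystem H).root ε + (IsKilling.rootSystem H).root ε' ∉
      range (IsKilling.rootSystem H).root := by
  suffices (IsKilling.rootSystem H).pairingIn ℤ ε ε' = 0 ∧
      (IsKilling.rootSystem H).root ε - (IsKilling.rootSystem H).root ε' ∉
      range (IsKilling.rootSystem H).root from
    ⟨this.1, this.2, fun h => this.2 ((add_mem_range_iff_sub_mem_range this.1).mp h)⟩
  obtain ⟨K, hK, hKb, h⟩ := exists_isHighest_of_mem_cascadeRoots hS hε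
  obtain ⟨K', hK', hKb', h'⟩ := exists_isHighest_of_mem_cascadeRoots hS hε'
  rcases hK.trichotomy hS hK' with rfl | ho | hn | hn
  · exact absurd (h.unique h') hne
  · exact ⟨pairingIn_eq_zero_of_orthogonal ho h.supportedIn h'.supportedIn,
      sub_notMem_of_orthogonal ho h.supportedIn h'.supportedIn h.isPos h'.isPos⟩
  · exact h.sub_notMem_of_isNested hKb h' hn
  · obtain ⟨h1, h2⟩ := h'.sub_notMem_of_isNested hKb' h hn
    refine ⟨pairingIn_eq_zero_swap.mp h1, fun h3 => h2 ?_⟩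
    rwa [← neg_sub, RootPairing.neg_mem_range_root_iff]

lemma IsHighest.supportedIn_of_sub {K : Set H.root} {ε β δ : H.root} (h : IsHighest b K ε)
    (hβ : b.IsPos β) (hδ : b.IsPos δ) (hsub : (IsKilling.rootSystem H).root δ =
      (IsKilling.rootSystem H).root ε - (IsKilling.rootSystem H).root β) :
    SupportedIn b K β ∧ SupportedIn b K δ := by
  have hc := coeff_sub b hsub
  have h1 := (isPos_iff_coeff_nonneg b).mp hβ
  have h2 := (isPos_iff_coeff_nonneg b).mp hδ
  have h3 : ∀ i : b.support, (i : H.root) ∉ K → coeff b β i = 0 ∧ coeff b δ i = 0 := by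
    intro i hi
    have h4 := congrFun hc i
    rw [Pi.sub_apply, h.supportedIn i hi] at h4
    have h5 : 0 ≤ coeff b β i := h1 i
    have h6 : 0 ≤ coeff b δ i := h2 i
    omega
  exact ⟨fun i hi => (h3 i hi).1, fun i hi => (h3 i hi).2⟩

/-- A positive root `β` is a summand of at most one element of the cascade: if `K'` is nested in
`K`, then the support of `β` lies in `K'` and `β` is orthogonal to `ε`, so that `⟨ε - β, ε^∨⟩ = 2`
for the highest root `ε` of `K`. -/
theorem cascadeRoots_summand_unique (hS : S ⊆ b.support) {ε ε' β δ δ' : H.root}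
    (hε : ε ∈ cascadeRoots S) (hε' : ε' ∈ cascadeRoots S) (hβ : b.IsPos β) (hδ : b.IsPos δ)
    (hδ' : b.IsPos δ') (h : (IsKilling.rootSystem H).root δ =
      (IsKilling.rootSystem H).root ε - (IsKilling.rootSystem H).root β)
    (h' : (IsKilling.rootSystem H).root δ' =
      (IsKilling.rootSystem H).root ε' - (IsKilling.rootSystem H).root β) : ε = ε' := by
  have nested : ∀ {K K' : Set H.root} {ε ε' δ δ' : H.root}, K ⊆ b.support → IsHighest b K ε →
      IsHighest b K' ε' → b.IsPos δ → b.IsPos δ' → (IsKilling.rootSystem H).root δ =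
      (IsKilling.rootSystem H).root ε - (IsKilling.rootSystem H).root β →
      (IsKilling.rootSystem H).root δ' =
      (IsKilling.rootSystem H).root ε' - (IsKilling.rootSystem H).root β → ¬ IsNested K K' := by
    intro K K' ε ε' δ δ' hKb hK hK' hδ hδ' h h' hn
    obtain ⟨hβK, hδK⟩ := hK.supportedIn_of_sub hβ hδ h
    obtain ⟨hβK', -⟩ := hK'.supportedIn_of_sub hβ hδ' h'
    have h0 := pairingIn_eq_zero_of_supportedIn hβK' fun i hi =>
      (hn ε ((isHighestRoot_iff b hKb ε).mpr hK) i hi).2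
    have h1 := pairingIn_sub_left h ε
    rw [RootPairing.pairingIn_same, h0] at h1
    have h2 := hK.eq_of_two_le hδK (by omega)
    rw [h2] at h
    exact (IsKilling.rootSystem H).ne_zero β (sub_eq_self.mp h.symm)
  obtain ⟨K, hK, hKb, hh⟩ := exists_isHighest_of_mem_cascadeRoots hS hε
  obtain ⟨K', hK', hKb', hh'⟩ := exists_isHighest_of_mem_cascadeRoots hS hε'
  rcases hK.trichotomy hS hK' with rfl | ho | hn | hn
  · exact hh.unique hh'
  · have := pairingIn_eq_zero_of_orthogonal ho (hh.supportedIn_of_sub hβ hδ h).1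
      (hh'.supportedIn_of_sub hβ hδ' h').1
    simp at this
  · exact absurd hn (nested hKb hh hh' hδ hδ' h h')
  · exact absurd hn (nested hKb' hh' hh hδ' hδ h' h)

/-- The support of a positive root is contained in a connected component. -/
lemma exists_isComponent_supportedIn {α : H.root} (hα : b.IsPos α) :
    ∀ {S : Set H.root}, SupportedIn b S α → ∃ K, IsComponent S K ∧ SupportedIn b K α := by
  suffices b.IsPos α ∧ ∀ S : Set H.root, SupportedIn b S α →
      ∃ K, IsComponent S K ∧ SupportedIn b K α from fun {S} hS => this.2 S hS
  refine hα.induction_on_add (p := fun α => b.IsPos α ∧ ∀ S : Set H.root, SupportedIn b S α →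
    ∃ K, IsComponent S K ∧ SupportedIn b K α) (fun i hi => ?_) (fun i j k hk hi hj => ?_)
  · refine ⟨RootPairing.Base.isPos_of_mem_support hi, fun S hS => ?_⟩
    lift i to b.support using hi
    obtain ⟨K, hK, hiK⟩ := exists_isComponent_mem (supportedIn_simple_iff.mp hS)
    exact ⟨K, hK, supportedIn_simple hiK⟩
  · have hjpos := RootPairing.Base.isPos_of_mem_support hj
    refine ⟨hi.1.add hjpos hk, fun S hS => ?_⟩
    have hc := coeff_add b hk
    lift j to b.support using hj
    have hi0 := (isPos_iff_coeff_nonneg b).mp hi.1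
    have hj0 := (isPos_iff_coeff_nonneg b).mp hjpos
    have h3 : ∀ l : b.support, (l : H.root) ∉ S → coeff b i l = 0 ∧ coeff b (j : H.root) l = 0 := by
      intro l hl
      have h4 := hS l hl
      rw [hc, Pi.add_apply] at h4
      have h5 : 0 ≤ coeff b i l := hi0 l
      have h6 : 0 ≤ coeff b (j : H.root) l := hj0 l
      omega
    obtain ⟨K, hK, hiK⟩ := hi.2 S fun l hl => (h3 l hl).1
    have hjS : (j : H.root) ∈ S := supportedIn_simple_iff.mp fun l hl => (h3 l hl).2
    by_cases hjK : (j : H.root) ∈ K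
    · exact ⟨K, hK, hiK.add (supportedIn_simple hjK) hk⟩
    · have h0 : (IsKilling.rootSystem H).pairingIn ℤ i j = 0 :=
        pairingIn_eq_zero_of_supportedIn hiK fun l hl =>
          pairingIn_eq_zero_swap.mp (hK.pairingIn_eq_zero hjS hjK hl)
      refine absurd ((add_mem_range_iff_sub_mem_range h0).mp ⟨k, hk⟩) ?_
      refine sub_notMem_of_orthogonal (b := b) (K := K) (K' := {(j : H.root)}) ?_ hiK
        (supportedIn_simple rfl) hi.1 hjpos
      rintro α hα _ rfl
      exact pairingIn_eq_zero_swap.mp (hK.pairingIn_eq_zero hjS hjK hα)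

/-- Every positive root is an element of the cascade or a summand of one. -/
theorem mem_cascadeRoots_or_exists_summand {α : H.root} (hα : b.IsPos α) :
    ∀ {S : Set H.root}, S ⊆ b.support → SupportedIn b S α → α ∉ cascadeRoots S →
      ∃ ε ∈ cascadeRoots S, ∃ β, b.IsPos β ∧ (IsKilling.rootSystem H).root β =
        (IsKilling.rootSystem H).root ε - (IsKilling.rootSystem H).root α := by
  intro S
  induction hn : S.ncard using Nat.strong_induction_on generalizing S with
  | _ n ih =>
    subst hn
    intro hSb hSα hαS
    obtain ⟨K, hK, hKα⟩ := exists_isComponent_supportedIn hα hSα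
    have hKb := hK.1.trans hSb
    obtain ⟨θ, hθ⟩ := exists_isHighest hK.2.1.isIndecomposable hKb
    have hθ' := (isHighestRoot_iff b hKb θ).mpr hθ
    have hmem : θ ∈ cascadeRoots S := ⟨K, .component hK, hθ'⟩
    have hne : α ≠ θ := fun h => hαS (h ▸ hmem)
    have h0 := hθ.pairingIn_nonneg hα hKα
    have h1 : (IsKilling.rootSystem H).pairingIn ℤ α θ < 2 := by
      by_contra! h
      exact hne (hθ.eq_of_two_le hKα h)
    obtain h2 | h2 : (IsKilling.rootSystem H).pairingIn ℤ α θ = 1 ∨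
        (IsKilling.rootSystem H).pairingIn ℤ α θ = 0 := by omega
    · exact ⟨θ, hmem, hθ.exists_sub hKα h2⟩
    -- a root orthogonal to the highest root `θ` is supported on simple roots orthogonal to `θ`
    set T := {α ∈ K | (IsKilling.rootSystem H).pairing α θ = 0} with hT
    have hTK : T ⊆ K := fun i hi => hi.1
    have hTS : T ⊂ S := by
      refine (hTK.trans hK.1).ssubset_of_ne fun h => ?_
      have h3 := pairingIn_eq_zero_of_supportedIn (hθ.supportedIn.mono hK.1) fun i hi =>
        pairing_eq_zero_iff_pairingIn.mp (show i ∈ T from h ▸ hi).2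
      simp at h3
    have hTα : SupportedIn b T α := by
      intro i hi
      by_cases hiK : (i : H.root) ∈ K
      · rw [pairingIn_eq_sum_coeff b] at h2
        have hnn : ∀ j : b.support, 0 ≤ coeff b α j *
            (IsKilling.rootSystem H).pairingIn ℤ j θ := by
          intro j
          by_cases hj : (j : H.root) ∈ K
          · exact mul_nonneg ((isPos_iff_coeff_nonneg b).mp hα j) (hθ.pairingIn_simple_nonneg hj)
          · rw [hKα j hj, zero_mul]
        have h3 := (Finset.sum_eq_zero_iff_of_nonneg fun j _ => hnn j).mp h2 i (Finset.mem_univ i)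
        exact (mul_eq_zero.mp h3).resolve_right fun h4 =>
          hi ⟨hiK, pairing_eq_zero_iff_pairingIn.mpr h4⟩
      · exact hKα i hiK
    have hlift : cascadeRoots T ⊆ cascadeRoots S := by
      rintro ε ⟨K', hK', hε⟩
      exact ⟨K', .step hK hθ' hK', hε⟩
    obtain ⟨ε, hε, h3⟩ := ih T.ncard (Set.ncard_lt_ncard hTS) rfl
      (hTK.trans hKb) hTα fun h => hαS (hlift h)
    exact ⟨ε, hlift hε, h3⟩

end Cascade

/-! ### The beginning of the cascade in types `F₄`, `E₆`, `E₇`, `E₈` -/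

section ChainModel

variable {n : ℕ} (A : Matrix (Fin n) (Fin n) ℤ)

/-- The `k`-th coordinate of the vector `∑ m αⱼ`, where `(j, m)` runs over the list `l`. -/
def chainCoeff (l : List (Fin n × ℤ)) (k : Fin n) : ℤ :=
  (l.map fun p => if p.1 = k then p.2 else 0).sum

/-- The pairing of the vector `∑ m αᵢ`, where `(i, m)` runs over the list `l`, with the `j`-th
simple coroot. -/
def chainPairing (l : List (Fin n × ℤ)) (j : Fin n) : ℤ := (l.map fun p => p.2 * A p.1 j).sum

/-- The list `l`, read from its end, encodes a sequence of roots which starts with the simple root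
`αₛ`, and in which each root is the image of the previous root `β` under a simple reflection
`β ↦ β + m αⱼ` with `m > 0`; the entries of `l` are the pairs `(j, m)`. -/
def IsReflectionChain (s : Fin n) : List (Fin n × ℤ) → Prop
  | [] => False
  | [p] => p = (s, 1)
  | p :: q :: l => chainPairing A (q :: l) p.1 = -p.2 ∧ 0 < p.2 ∧ IsReflectionChain s (q :: l)

instance IsReflectionChain.decidable (s : Fin n) :
    ∀ l, Decidable (IsReflectionChain A s l)
  | [] => inferInstanceAs (Decidable False)
  | [p] => inferInstanceAs (Decidable (p = (s, 1)))
  | p :: q :: l => by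
    have := IsReflectionChain.decidable s (q :: l)
    unfold IsReflectionChain
    infer_instance

lemma sum_chainCoeff_mul (l : List (Fin n × ℤ)) (j : Fin n) :
    ∑ k, chainCoeff l k * A k j = chainPairing A l j := by
  induction l with
  | nil => simp [chainCoeff, chainPairing]
  | cons p l ih =>
    simp only [chainCoeff, chainPairing, List.map_cons, List.sum_cons] at ih ⊢
    simp [add_mul, Finset.sum_add_distrib, ih]

variable {A}

lemma IsReflectionChain.pos {s : Fin n} {l : List (Fin n × ℤ)} (h : IsReflectionChain A s l) :
    ∀ p ∈ l, 0 < p.2 := by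
  induction l with
  | nil => simp
  | cons p l ih =>
    cases l with
    | nil =>
      have h' : p = (s, 1) := h
      simp [h']
    | cons q l =>
      obtain ⟨-, h2, h3⟩ := h
      simpa [h2] using ih h3

lemma chainCoeff_eq_zero {l : List (Fin n × ℤ)} {k : Fin n} (hk : k ∉ l.map Prod.fst) :
    chainCoeff l k = 0 := by
  refine List.sum_eq_zero fun x hx => ?_
  obtain ⟨p, hp, rfl⟩ := List.mem_map.mp hx
  rw [if_neg]
  rintro rfl
  exact hk (List.mem_map_of_mem hp)

lemma chainCoeff_pos {l : List (Fin n × ℤ)} (hl : ∀ p ∈ l, 0 < p.2) {k : Fin n}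
    (hk : k ∈ l.map Prod.fst) : 0 < chainCoeff l k := by
  induction l with
  | nil => simp at hk
  | cons p l ih =>
    have hl' : ∀ p ∈ l, 0 < p.2 := fun q hq => hl q (List.mem_cons_of_mem p hq)
    have h0 : 0 ≤ chainCoeff l k := List.sum_nonneg fun x hx => by
      obtain ⟨q, hq, rfl⟩ := List.mem_map.mp hx
      split_ifs
      exacts [(hl' q hq).le, le_rfl]
    have hp := hl p List.mem_cons_self
    simp only [chainCoeff, List.map_cons, List.sum_cons, List.mem_cons] at hk h0 ih ⊢
    rcases hk with rfl | hk
    · simp only [if_true]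
      omega
    · have := ih hl' hk
      split_ifs <;> omega

end ChainModel

/-- The simple root with index `i` is not long, or it is joined by a simple bond to a simple root
with a smaller value of the function `dist`. -/
def IsShortOrLinked {n : ℕ} (A : Matrix (Fin n) (Fin n) ℤ) (dist : Fin n → ℕ) (i : Fin n) : Prop :=
  (∃ j, A j i ≤ -2) ∨ ∃ j, A i j = -1 ∧ A j i = -1 ∧ dist j < dist i

instance {n : ℕ} (A : Matrix (Fin n) (Fin n) ℤ) (dist : Fin n → ℕ) :
    DecidablePred (IsShortOrLinked A dist) := fun _ =>
  inferInstanceAs (Decidable (_ ∨ _))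

/-- The indices occurring in `l'` form a connected component of the set of the indices in `l` whose
simple root is orthogonal to the root encoded by `l`, provided that they are connected. -/
def IsChainComponent {n : ℕ} (A : Matrix (Fin n) (Fin n) ℤ) (l l' : List (Fin n × ℤ)) : Prop :=
  (∀ j ∈ l'.map Prod.fst, j ∈ l.map Prod.fst ∧ chainPairing A l j = 0) ∧
    ∀ j i, j ∈ l.map Prod.fst ∧ chainPairing A l j = 0 ∧ j ∉ l'.map Prod.fst ∧
      i ∈ l'.map Prod.fst → A j i = 0

instance {n : ℕ} (A : Matrix (Fin n) (Fin n) ℤ) (l l' : List (Fin n × ℤ)) :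
    Decidable (IsChainComponent A l l') :=
  @instDecidableAnd _ _ inferInstance
    (@Nat.decidableForallFin _ _ fun _ => @Nat.decidableForallFin _ _ fun _ => inferInstance)

/-- Combinatorial data for a Cartan matrix from which the elements `ε₀, ε₁, ε₂, ε₃` of the cascade
which are not orthogonal to the simple root `α₂` joined to the lowest root can be read off.
The chains `l k` describe the roots `εₖ`, and the indices occurring in `l k` are the member of the
cascade with highest root `εₖ`; these sets decrease in the order `0, 2, 3, 1`. -/
structure IsCascadeData {n : ℕ} (A : Matrix (Fin n) (Fin n) ℤ) (l : Fin 4 → List (Fin n × ℤ))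
    (i₁ i₂ : Fin n) (dist : Fin n → ℕ) : Prop where
  /-- All simple roots are connected with `α₁` by simple bonds, unless they are short. -/
  dist_lt : ∀ i, i = i₁ ∨ IsShortOrLinked A dist i
  chain : ∀ k, IsReflectionChain A i₁ (l k)
  dominant : ∀ k, ∀ j ∈ (l k).map Prod.fst, 0 ≤ chainPairing A (l k) j
  full : ∀ j, j ∈ (l 0).map Prod.fst
  component₀₂ : IsChainComponent A (l 0) (l 2)
  component₂₃ : IsChainComponent A (l 2) (l 3)
  component₃₁ : IsChainComponent A (l 3) (l 1)
  chain_one : l 1 = [(i₁, 1)]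
  distinct : ∀ k k' : Fin 4, k ≠ k' → ∃ j, chainCoeff (l k) j ≠ chainCoeff (l k') j
  joined : ∀ j, chainPairing A (l 0) j ≠ 0 → j = i₂
  adjacent : ∀ j, A j i₂ ≠ 0 → j = i₂ ∨ j = i₁
  bond : A i₁ i₂ = -1 ∧ A i₂ i₁ = -1
  relation : ∀ j, (if j = i₂ then 2 else 0) = chainCoeff (l 0) j - chainCoeff (l 1) j -
    chainCoeff (l 2) j - chainCoeff (l 3) j

/-- Indices follow the Bourbaki labelling, shifted by one: here `α₁` and `α₂` are the second and
the first simple root. -/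
lemma isCascadeData_F₄ : IsCascadeData CartanMatrix.F₄
    ![[(0, 1), (1, 1), (2, 2), (3, 2), (1, 1), (2, 2), (0, 1), (1, 1)], [(1, 1)],
      [(3, 2), (2, 2), (1, 1)], [(2, 2), (1, 1)]] 1 0 ![1, 0, 1, 2] := by
  constructor <;> decide

lemma isCascadeData_E₆ : IsCascadeData CartanMatrix.E₆
    ![[(1, 1), (3, 1), (4, 1), (5, 1), (2, 1), (3, 1), (4, 1), (0, 1), (2, 1), (1, 1), (3, 1)],
      [(3, 1)], [(5, 1), (4, 1), (0, 1), (2, 1), (3, 1)], [(4, 1), (2, 1), (3, 1)]]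
    3 1 ![2, 1, 1, 0, 1, 2] := by
  constructor <;> decide

lemma isCascadeData_E₇ : IsCascadeData CartanMatrix.E₇
    ![[(0, 1), (2, 1), (3, 1), (4, 1), (5, 1), (6, 1), (1, 1), (3, 1), (4, 1), (5, 1), (2, 1),
        (3, 1), (4, 1), (1, 1), (3, 1), (0, 1), (2, 1)], [(2, 1)],
      [(5, 1), (6, 1), (4, 1), (5, 1), (3, 1), (4, 1), (1, 1), (3, 1), (2, 1)],
      [(3, 1), (4, 1), (1, 1), (3, 1), (2, 1)]] 2 0 ![1, 2, 0, 1, 2, 3, 4] := by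
  constructor <;> decide

set_option maxRecDepth 2000 in
lemma isCascadeData_E₈ : IsCascadeData CartanMatrix.E₈
    ![[(7, 1), (6, 1), (5, 1), (4, 1), (3, 1), (2, 1), (1, 1), (3, 1), (4, 1), (5, 1), (6, 1),
        (7, 1), (0, 1), (2, 1), (3, 1), (4, 1), (5, 1), (1, 1), (3, 1), (4, 1), (2, 1), (3, 1),
        (0, 1), (2, 1), (1, 1), (3, 1), (4, 1), (5, 1), (6, 1)], [(6, 1)],
      [(0, 1), (2, 1), (3, 1), (4, 1), (5, 1), (1, 1), (3, 1), (4, 1), (2, 1), (3, 1), (0, 1),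
        (2, 1), (1, 1), (3, 1), (4, 1), (5, 1), (6, 1)],
      [(5, 1), (4, 1), (3, 1), (2, 1), (1, 1), (3, 1), (4, 1), (5, 1), (6, 1)]]
    6 7 ![5, 4, 4, 3, 2, 1, 0, 1] := by
  constructor <;> decide

section ChainRoots

open Set

variable {L : Type*} [LieRing L] [LieAlgebra ℂ L] [FiniteDimensional ℂ L] [IsKilling ℂ L]
  {H : LieSubalgebra ℂ L} [H.IsCartanSubalgebra] {b : (IsKilling.rootSystem H).Base}
  {n : ℕ} {A : Matrix (Fin n) (Fin n) ℤ} {e : b.support ≃ Fin n}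
  (hA : ∀ i j, b.cartanMatrix i j = A (e i) (e j))

/-- The set of simple roots whose indices occur in the list `l`. -/
def chainSet (e : b.support ≃ Fin n) (l : List (Fin n × ℤ)) : Set H.root :=
  {α | ∃ h : α ∈ b.support, e ⟨α, h⟩ ∈ l.map Prod.fst}

lemma mem_chainSet {l : List (Fin n × ℤ)} {i : b.support} :
    (i : H.root) ∈ chainSet e l ↔ e i ∈ l.map Prod.fst :=
  ⟨fun ⟨_, h⟩ => h, fun h => ⟨i.2, h⟩⟩

lemma chainSet_subset (l : List (Fin n × ℤ)) : chainSet e l ⊆ b.support := fun _ h => h.1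

include hA

lemma pairingIn_simple (i j : b.support) :
    (IsKilling.rootSystem H).pairingIn ℤ i j = A (e i) (e j) := hA i j

lemma pairingIn_eq_chainPairing {l : List (Fin n × ℤ)} {ρ : H.root}
    (hρ : ∀ i, coeff b ρ i = chainCoeff l (e i)) (j : b.support) :
    (IsKilling.rootSystem H).pairingIn ℤ ρ j = chainPairing A l (e j) := by
  rw [pairingIn_eq_sum_coeff b, ← sum_chainCoeff_mul, ← e.sum_comp]
  exact Finset.sum_congr rfl fun i _ => by rw [hρ, pairingIn_simple hA]

lemma IsReflectionChain.exists_root {s : Fin n} {l : List (Fin n × ℤ)}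
    (h : IsReflectionChain A s l) (hs : IsLong (IsKilling.rootSystem H) (e.symm s : H.root)) :
    ∃ ρ, IsLong (IsKilling.rootSystem H) ρ ∧ ∀ i, coeff b ρ i = chainCoeff l (e i) := by
  classical
  induction l with
  | nil => exact h.elim
  | cons p l ih =>
    cases l with
    | nil =>
      obtain rfl : p = (s, 1) := h
      refine ⟨e.symm s, hs, fun i => ?_⟩
      rw [coeff_simple]
      simp [chainCoeff, Pi.single_apply, Equiv.eq_symm_apply, eq_comm]
    | cons q l =>
      obtain ⟨h1, -, h3⟩ := h
      obtain ⟨ρ, hρ, hc⟩ := ih h3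
      set j := e.symm p.1
      refine ⟨(IsKilling.rootSystem H).reflectionPerm j ρ, hρ.reflectionPerm _, fun i => ?_⟩
      have hp := pairingIn_eq_chainPairing hA hc j
      rw [show e j = p.1 from e.apply_symm_apply _, h1] at hp
      have hroot : (IsKilling.rootSystem H).root ((IsKilling.rootSystem H).reflectionPerm j ρ) =
          (1 : ℤ) • (IsKilling.rootSystem H).root ρ +
            p.2 • (IsKilling.rootSystem H).root (j : H.root) := by
        rw [root_reflectionPerm_eq, hp]; module
      rw [coeff_of_root_eq_zsmul_add b hroot, Pi.add_apply, Pi.smul_apply, Pi.smul_apply, hc,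
        coeff_simple]
      simp [chainCoeff, Pi.single_apply, j, Equiv.eq_symm_apply, eq_comm, add_comm]

lemma IsReflectionChain.isConnectedSet {s : Fin n} {l : List (Fin n × ℤ)}
    (h : IsReflectionChain A s l) : IsConnectedSet (chainSet e l) := by
  induction l with
  | nil => exact h.elim
  | cons p l ih =>
    have hset : chainSet e (p :: l) = insert (e.symm p.1 : H.root) (chainSet e l) := by
      ext α
      constructor
      · rintro ⟨hα, h'⟩
        rw [List.map_cons, List.mem_cons] at h'
        rcases h' with h' | h'
        · left; rw [← h', e.symm_apply_apply]
        · right; exact ⟨hα, h'⟩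
      · rintro (rfl | ⟨hα, h'⟩)
        · exact mem_chainSet.mpr (by simp)
        · exact ⟨hα, by simp only [List.map_cons, List.mem_cons, h', or_true]⟩
    cases l with
    | nil =>
      have : chainSet e ([] : List (Fin n × ℤ)) = ∅ := by
        ext α; simp [chainSet]
      rw [hset, this, insert_empty_eq]
      exact isConnectedSet_singleton _
    | cons q l =>
      obtain ⟨h1, h2, h3⟩ := h
      rw [hset]
      by_cases hmem : (e.symm p.1 : H.root) ∈ chainSet e (q :: l)
      · rw [insert_eq_of_mem hmem]
        exact ih h3
      obtain ⟨r, hr, hr0⟩ : ∃ r ∈ q :: l, A r.1 p.1 ≠ 0 := by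
        by_contra! hno
        have : chainPairing A (q :: l) p.1 = 0 := List.sum_eq_zero fun x hx => by
          obtain ⟨r, hr, rfl⟩ := List.mem_map.mp hx
          rw [hno r hr, mul_zero]
        omega
      have hrmem : (e.symm r.1 : H.root) ∈ chainSet e (q :: l) :=
        mem_chainSet.mpr (by rw [e.apply_symm_apply]; exact List.mem_map_of_mem hr)
      refine (ih h3).insert hrmem (dynkinGraph_adj.mpr ⟨fun h => hmem (h ▸ hrmem), fun h0 => ?_⟩)
      rw [pairingIn_eq_zero_swap, pairingIn_simple hA, e.apply_symm_apply, e.apply_symm_apply] at h0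
      exact hr0 h0

/-- A chain which is dominant on its support describes the highest root of its support. -/
lemma IsReflectionChain.isHighest {s : Fin n} {l : List (Fin n × ℤ)}
    (h : IsReflectionChain A s l) {ρ : H.root} (hlong : IsLong (IsKilling.rootSystem H) ρ)
    (hρ : ∀ i, coeff b ρ i = chainCoeff l (e i))
    (hdom : ∀ j ∈ l.map Prod.fst, 0 ≤ chainPairing A l j) :
    IsHighest b (chainSet e l) ρ := by
  obtain ⟨θ, hθ⟩ := exists_isHighest (b := b) (h.isConnectedSet hA (e := e)).isIndecomposable
    (chainSet_subset l)
  have : θ = ρ := hθ.eq_of_dominant hlong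
    (fun i hi => by rw [hρ]; exact chainCoeff_eq_zero fun h' => hi (mem_chainSet.mpr h'))
    (fun i hi => by rw [hρ]; exact chainCoeff_pos h.pos (mem_chainSet.mp hi))
    (fun i hi => by rw [pairingIn_eq_chainPairing hA hρ]; exact hdom _ (mem_chainSet.mp hi))
  exact this ▸ hθ

lemma isComponent_chainSet {s : Fin n} {l l' : List (Fin n × ℤ)} {ρ : H.root}
    (hρ : ∀ i, coeff b ρ i = chainCoeff l (e i)) (h' : IsReflectionChain A s l')
    (h : IsChainComponent A l l') :
    IsComponent {α ∈ chainSet e l | (IsKilling.rootSystem H).pairing α ρ = 0} (chainSet e l') := by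
  obtain ⟨h1, h2⟩ := h
  have key : ∀ j : b.support, (IsKilling.rootSystem H).pairing j ρ = 0 ↔
      chainPairing A l (e j) = 0 := fun j => by
    rw [pairing_eq_zero_iff_pairingIn, pairingIn_eq_zero_swap, pairingIn_eq_chainPairing hA hρ]
  refine ⟨?_, h'.isConnectedSet hA, ?_⟩
  · rintro α ⟨hα, hα'⟩
    exact ⟨⟨hα, (h1 _ hα').1⟩, (key ⟨α, hα⟩).mpr (h1 _ hα').2⟩
  · rintro α ⟨⟨hα, hαl⟩, hα0⟩ hαl' β ⟨hβ, hβl⟩ hadj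
    refine (dynkinGraph_adj.mp hadj).2 ?_
    have := h2 _ _ ⟨hαl, (key ⟨α, hα⟩).mp hα0, fun h => hαl' ⟨hα, h⟩, hβl⟩
    rwa [← pairingIn_simple hA] at this

/-- The simple root with index `i₁` is long: some simple root is long, and one moves on from it
along simple bonds. -/
lemma IsCascadeData.isLong {l : Fin 4 → List (Fin n × ℤ)} {i₁ i₂ : Fin n} {dist : Fin n → ℕ}
    (hd : IsCascadeData A l i₁ i₂ dist) {θ : H.root} (hθ : IsHighest b b.support θ) :
    IsLong (IsKilling.rootSystem H) (e.symm i₁ : H.root) := by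
  obtain ⟨i, hib, hi⟩ := exists_isLong_simple (b := b) hθ.isLong
  lift i to b.support using hib
  have key : ∀ (m : ℕ) (i : b.support), dist (e i) = m →
      IsLong (IsKilling.rootSystem H) (i : H.root) →
      IsLong (IsKilling.rootSystem H) (e.symm i₁ : H.root) := by
    intro m
    induction m using Nat.strong_induction_on with
    | _ m ih =>
      rintro i rfl hi
      rcases hd.dist_lt (e i) with h | ⟨j, hj⟩ | ⟨j, hj, hj', hlt⟩
      · rwa [← h, e.symm_apply_apply]
      · -- the negative of the simple root with index `j` shows that `αᵢ` is not long
        let := (IsKilling.rootSystem H).indexNeg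
        have h1 : (IsKilling.rootSystem H).pairingIn ℤ (e.symm j : H.root) i = A j (e i) := by
          rw [pairingIn_simple hA, e.apply_symm_apply]
        have hneg : (IsKilling.rootSystem H).root (-(e.symm j : H.root)) =
            -(IsKilling.rootSystem H).root (e.symm j : H.root) := by
          rw [RootPairing.indexNeg_neg, RootPairing.root_reflectionPerm,
            RootPairing.reflection_apply_self]
        have h2 := pairingIn_neg_left hneg (i : H.root)
        have h3 := hi.eq_of_two_le (β := -(e.symm j : H.root)) (by omega)
        refine absurd (RootPairing.Base.isPos_of_mem_support (b := b) i.2) ?_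
        rw [← h3]
        exact IsPos.not_of_root_eq_neg b hneg
          (RootPairing.Base.isPos_of_mem_support (b := b) (e.symm j).2)
      · refine ih (dist j) hlt (e.symm j) (by rw [e.apply_symm_apply]) (hi.of_pairingIn ?_ ?_)
        · rw [pairingIn_simple hA, e.apply_symm_apply, hj]
        · rw [pairingIn_simple hA, e.apply_symm_apply, hj']
  exact key _ i rfl hi

end ChainRoots

section Quadruple

open Set

variable {L : Type*} [LieRing L] [LieAlgebra ℂ L] [FiniteDimensional ℂ L] [IsKilling ℂ L]
  {H : LieSubalgebra ℂ L} [H.IsCartanSubalgebra] {b : (IsKilling.rootSystem H).Base}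

/-- The configuration `ε₀, ε₁ = α₁, ε₂, ε₃` of cascade roots attached to the simple roots `α₁`
and `α₂`; together with `α₂` they span a root system of type `D₄` with simple roots `α₂`, `ε₁`,
`ε₂`, `ε₃` and highest root `ε₀`. -/
structure IsCascadeQuadruple (b : (IsKilling.rootSystem H).Base) (α₁ α₂ : H.root)
    (ε : Fin 4 → H.root) : Prop where
  mem : ∀ k, ε k ∈ cascadeRoots (b.support : Set H.root)
  injective : Function.Injective ε
  isHighest : IsHighest b b.support (ε 0)
  eq_one : α₁ = ε 1
  isLong : IsLong (IsKilling.rootSystem H) α₂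
  pairing₁₂ : (IsKilling.rootSystem H).pairingIn ℤ α₁ α₂ = -1
  pairing₂₁ : (IsKilling.rootSystem H).pairingIn ℤ α₂ α₁ = -1
  relation : (2 : ℤ) • (IsKilling.rootSystem H).root α₂ = (IsKilling.rootSystem H).root (ε 0) -
    (IsKilling.rootSystem H).root (ε 1) - (IsKilling.rootSystem H).root (ε 2) -
    (IsKilling.rootSystem H).root (ε 3)

lemma IsCascadeData.exists_quadruple {n : ℕ} {A : Matrix (Fin n) (Fin n) ℤ}
    {l : Fin 4 → List (Fin n × ℤ)} {i₁ i₂ : Fin n} {dist : Fin n → ℕ}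
    (hd : IsCascadeData A l i₁ i₂ dist) (hA : HasCartanType b A)
    {α₁ α₂ : H.root} (hα₁ : α₁ ∈ b.support) (hα₂ : IsJoinedToLowestRoot b α₂) (hne : α₁ ≠ α₂)
    (hadj : (IsKilling.rootSystem H).pairingIn ℤ α₁ α₂ ≠ 0) :
    ∃ ε, IsCascadeQuadruple b α₁ α₂ ε := by
  obtain ⟨e, hA⟩ := hA
  obtain ⟨hα₂b, θ, hθ, hθ2⟩ := hα₂
  have hθ' := (isHighestRoot_iff b subset_rfl θ).mp hθ
  have hlong := hd.isLong hA hθ'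
  choose ε hεlong hε using fun k => (hd.chain k).exists_root hA hlong
  have hh : ∀ k, IsHighest b (chainSet e (l k)) (ε k) := fun k =>
    (hd.chain k).isHighest hA (hεlong k) (hε k) (hd.dominant k)
  have hset : chainSet e (l 0) = b.support := by
    refine (chainSet_subset _).antisymm fun α hα => ⟨hα, hd.full _⟩
  have h0 : IsHighest b b.support (ε 0) := hset ▸ hh 0
  obtain rfl : θ = ε 0 := hθ'.unique h0
  have hsub : ∀ k, (chainSet e (l k) : Set H.root) ⊆ b.support := fun k => chainSet_subset _
  have hhr : ∀ k, IsHighestRoot (chainSet e (l k)) (ε k) := fun k =>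
    (isHighestRoot_iff b (hsub k) _).mpr (hh k)
  -- the members of the cascade which correspond to the four chains
  have hcomp0 : IsComponent (b.support : Set H.root) (chainSet e (l 0)) :=
    ⟨hset.le, (hd.chain 0).isConnectedSet hA, fun α hα hα' => absurd (hset ▸ hα) hα'⟩
  have hcomp : ∀ k k', IsChainComponent A (l k) (l k') →
      IsComponent {α ∈ chainSet e (l k) | (IsKilling.rootSystem H).pairing α (ε k) = 0}
        (chainSet e (l k')) := fun k k' =>
    isComponent_chainSet hA (hε k) (hd.chain k')
  have hmem : ∀ k, InCascade (b.support : Set H.root) (chainSet e (l k)) := by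
    have h02 := hcomp 0 2 hd.component₀₂
    have h23 := hcomp 2 3 hd.component₂₃
    have h31 := hcomp 3 1 hd.component₃₁
    intro k
    fin_cases k
    · exact .component hcomp0
    · exact .step hcomp0 (hhr 0) (.step h02 (hhr 2) (.step h23 (hhr 3) (.component h31)))
    · exact .step hcomp0 (hhr 0) (.component h02)
    · exact .step hcomp0 (hhr 0) (.step h02 (hhr 2) (.component h23))
  -- the simple roots `α₁` and `α₂` have the indices `i₁` and `i₂`
  lift α₂ to b.support using hα₂b
  lift α₁ to b.support using hα₁
  have hi₂ : e α₂ = i₂ := by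
    refine hd.joined _ fun h => hθ2 ?_
    rw [pairing_eq_zero_iff_pairingIn, pairingIn_eq_zero_swap,
      pairingIn_eq_chainPairing hA (hε 0), h]
  have hi₁ : e α₁ = i₁ := by
    rw [pairingIn_simple hA, hi₂] at hadj
    exact (hd.adjacent _ hadj).resolve_left fun h => hne
      (congrArg Subtype.val (e.injective (h.trans hi₂.symm)))
  have hp₁₂ : (IsKilling.rootSystem H).pairingIn ℤ (α₁ : H.root) α₂ = -1 := by
    rw [pairingIn_simple hA, hi₁, hi₂, hd.bond.1]
  have hp₂₁ : (IsKilling.rootSystem H).pairingIn ℤ (α₂ : H.root) α₁ = -1 := by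
    rw [pairingIn_simple hA, hi₁, hi₂, hd.bond.2]
  have hlong₁ : IsLong (IsKilling.rootSystem H) (α₁ : H.root) := by
    rwa [← hi₁, e.symm_apply_apply] at hlong
  have hsimple := coeff_simple_apply b e
  refine ⟨ε, fun k => ⟨_, hmem k, hhr k⟩, fun k k' h => ?_, h0, ?_, hlong₁.of_pairingIn hp₁₂ hp₂₁,
    hp₁₂, hp₂₁, ?_⟩
  · by_contra hkk
    obtain ⟨j, hj⟩ := hd.distinct k k' hkk
    apply hj
    rw [← e.apply_symm_apply j, ← hε, ← hε, h]
  · refine coeff_injective b (funext fun i => ?_)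
    rw [hε, hd.chain_one, hsimple, hi₁]
    simp only [chainCoeff, List.map_cons, List.map_nil, List.sum_cons, List.sum_nil, add_zero,
      eq_comm (a := i₁)]
  · have hrel : ∀ i : b.support, (2 : ℤ) * coeff b (α₂ : H.root) i = coeff b (ε 0) i -
        coeff b (ε 1) i - coeff b (ε 2) i - coeff b (ε 3) i := fun i => by
      rw [hε, hε, hε, hε, ← hd.relation, hsimple, hi₂]
      split_ifs <;> rfl
    rw [root_eq_sum_coeff b (α₂ : H.root), root_eq_sum_coeff b (ε 0), root_eq_sum_coeff b (ε 1),
      root_eq_sum_coeff b (ε 2), root_eq_sum_coeff b (ε 3), Finset.smul_sum,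
      ← Finset.sum_sub_distrib, ← Finset.sum_sub_distrib, ← Finset.sum_sub_distrib]
    refine Finset.sum_congr rfl fun i _ => ?_
    rw [smul_smul, hrel, sub_smul, sub_smul, sub_smul]

/-- The cascade roots which are not orthogonal to `α₂`, in types `F₄`, `E₆`, `E₇`, `E₈`. -/
theorem IsTypeFOrE.exists_quadruple (hb : IsTypeFOrE b) {α₁ α₂ : H.root} (hα₁ : α₁ ∈ b.support)
    (hα₂ : IsJoinedToLowestRoot b α₂) (hne : α₁ ≠ α₂)
    (hadj : (IsKilling.rootSystem H).pairingIn ℤ α₁ α₂ ≠ 0) :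
    ∃ ε, IsCascadeQuadruple b α₁ α₂ ε := by
  rcases hb with h | h | h | h
  · exact isCascadeData_F₄.exists_quadruple h hα₁ hα₂ hne hadj
  · exact isCascadeData_E₆.exists_quadruple h hα₁ hα₂ hne hadj
  · exact isCascadeData_E₇.exists_quadruple h hα₁ hα₂ hne hadj
  · exact isCascadeData_E₈.exists_quadruple h hα₁ hα₂ hne hadj

end Quadruple

/-! ### Root spaces -/

section RootSpaces

set_option linter.unusedSectionVars false

open Set

variable {L : Type*} [LieRing L] [LieAlgebra ℂ L] [FiniteDimensional ℂ L] [IsKilling ℂ L]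
  {H : LieSubalgebra ℂ L} [H.IsCartanSubalgebra]

local notation "Φ" => IsKilling.rootSystem H

/-- The weight space of `H` in `L` of weight `f`, a linear form on `H`, as a subspace of `L`. -/
abbrev rootSubspace (f : Module.Dual ℂ H) : Submodule ℂ L := (rootSpace H f).toSubmodule

variable {f g : Module.Dual ℂ H} {x y : L}

lemma lie_mem_rootSubspace (hx : x ∈ rootSubspace f) (hy : y ∈ rootSubspace g) :
    ⁅x, y⁆ ∈ rootSubspace (f + g) :=
  lie_mem_genWeightSpace_of_mem_genWeightSpace hx hy

lemma mem_rootSubspace_zero : x ∈ rootSubspace (0 : Module.Dual ℂ H) ↔ x ∈ H := by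
  have h : x ∈ rootSpace H (0 : H → ℂ) ↔ x ∈ H := by
    rw [rootSpace_zero_eq, LieSubalgebra.mem_toLieSubmodule]
  exact h

lemma lie_eq_smul_of_mem_rootSubspace (h : H) (hx : x ∈ rootSubspace f) :
    ⁅(h : L), x⁆ = f h • x :=
  IsKilling.lie_eq_smul_of_mem_rootSpace hx h

lemma killingForm_eq_zero_of_mem_rootSubspace (hx : x ∈ rootSubspace f) (hy : y ∈ rootSubspace g)
    (hfg : f + g ≠ 0) : killingForm ℂ L x y = 0 :=
  killingForm_apply_eq_zero_of_mem_rootSpace_of_add_ne_zero ℂ L H hx hy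
    fun h => hfg (LinearMap.ext fun z => congrFun h z)

lemma eq_zero_of_mem_rootSubspace (hf : f ≠ 0) (hf' : f ∉ range (Φ).root)
    (hx : x ∈ rootSubspace f) : x = 0 := by
  by_contra hx0
  have hbot : rootSpace H (f : H → ℂ) ≠ ⊥ := fun h => hx0 (by
    have : x ∈ rootSpace H (f : H → ℂ) := hx
    rwa [h, LieSubmodule.mem_bot] at this)
  let χ : Weight ℂ H L := ⟨f, hbot⟩
  have hχ : χ.IsNonZero := fun h => hf (LinearMap.ext fun z => congrFun h z)
  exact hf' ⟨⟨χ, by simpa [LieSubalgebra.root] using hχ⟩, LinearMap.ext fun z => rfl⟩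

lemma exists_mem_rootSubspace_ne_zero (hf : f ∈ range (Φ).root) :
    ∃ x ∈ rootSubspace f, x ≠ 0 := by
  obtain ⟨α, rfl⟩ := hf
  exact α.1.exists_ne_zero

lemma exists_eq_smul_of_mem_rootSubspace (hf : f ∈ range (Φ).root) (hx : x ∈ rootSubspace f)
    (hx0 : x ≠ 0) (hy : y ∈ rootSubspace f) : ∃ c : ℂ, y = c • x := by
  obtain ⟨α, rfl⟩ := hf
  obtain ⟨c, hc⟩ := (finrank_eq_one_iff_of_nonzero' (⟨x, hx⟩ : rootSpace H α.1)
    fun h => hx0 (congrArg Subtype.val h)).mp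
      (IsKilling.finrank_rootSpace_eq_one α.1 (LieSubalgebra.isNonZero_coe_root α)) ⟨y, hy⟩
  exact ⟨c, (congrArg Subtype.val hc).symm⟩

lemma root_ne_zero_of_mem_range (hf : f ∈ range (Φ).root) : f ≠ 0 := by
  obtain ⟨α, rfl⟩ := hf
  exact (Φ).ne_zero α

lemma neg_mem_range_root (hf : f ∈ range (Φ).root) : -f ∈ range (Φ).root := by
  obtain ⟨α, rfl⟩ := hf
  exact ⟨(Φ).reflectionPerm α α, by rw [RootPairing.root_reflectionPerm,
      RootPairing.reflection_apply_self]⟩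

lemma eq_zero_of_forall_killingForm (hx : x ∈ rootSubspace f)
    (h : ∀ z ∈ rootSubspace (-f), killingForm ℂ L x z = 0) : x = 0 := by
  have := mem_ker_killingForm_of_mem_rootSpace_of_forall_rootSpace_neg ℂ L H (α := f) hx h
  rwa [IsKilling.ker_killingForm_eq_bot, Submodule.mem_bot] at this

lemma killingForm_ne_zero_of_mem_rootSubspace (hf : f ∈ range (Φ).root) (hx : x ∈ rootSubspace f)
    (hx0 : x ≠ 0) (hy : y ∈ rootSubspace (-f)) (hy0 : y ≠ 0) : killingForm ℂ L x y ≠ 0 := by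
  refine fun h0 => hx0 (eq_zero_of_forall_killingForm hx fun z hz => ?_)
  obtain ⟨c, rfl⟩ := exists_eq_smul_of_mem_rootSubspace (neg_mem_range_root hf) hy hy0 hz
  rw [map_smul, h0, smul_zero]

/-- If `f`, `g` and `f + g` are roots, then `[L_f, L_g] ≠ 0`: move down along the `f`-string
through `g` from its top. -/
lemma lie_ne_zero_of_mem_rootSubspace (hf : f ∈ range (Φ).root) (hg : g ∈ range (Φ).root)
    (hfg : f + g ∈ range (Φ).root) (hx : x ∈ rootSubspace f) (hx0 : x ≠ 0)
    (hy : y ∈ rootSubspace g) (hy0 : y ≠ 0) : ⁅x, y⁆ ≠ 0 := by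
  obtain ⟨α, rfl⟩ := id hf
  obtain ⟨β, rfl⟩ := id hg
  have hα := LieSubalgebra.isNonZero_coe_root α
  obtain ⟨z, hz, hz0⟩ := (chainTop α.1 β.1).exists_ne_zero
  obtain ⟨h, e, e', hsl, he, he'⟩ := IsKilling.exists_isSl2Triple_of_weight_isNonZero hα
  obtain rfl := hsl.h_eq_coroot hα he he'
  have prim : hsl.HasPrimitiveVectorWith z (IsKilling.chainLength α.1 β.1 : ℂ) :=
    have := lie_mem_genWeightSpace_of_mem_genWeightSpace he hz
    ⟨hz0, (IsKilling.chainLength_smul _ _ hz).symm,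
      by rwa [genWeightSpace_add_chainTop _ _ hα] at this⟩
  set r := chainTopCoeff α.1 β.1 with hr
  have hr1 : 1 ≤ r := by
    obtain ⟨γ, hγ⟩ := hfg
    have h1 : rootSpace H ((1 : ℤ) • (α.1 : H → ℂ) + β.1) ≠ ⊥ := by
      rw [one_smul]
      have : ((γ.1 : Weight ℂ H L) : H → ℂ) = (α.1 : H → ℂ) + β.1 :=
        congrArg (fun l : Module.Dual ℂ H => (l : H → ℂ)) hγ
      rw [← this]
      exact γ.1.genWeightSpace_ne_bot
    have := ((IsKilling.rootSpace_zsmul_add_ne_bot_iff α.1 β.1 hα 1).mp h1).1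
    exact_mod_cast this
  have hrl : r ≤ IsKilling.chainLength α.1 β.1 :=
    IsKilling.chainTopCoeff_le_chainLength α.1 β.1
  obtain ⟨s, hs⟩ : ∃ s, r = s + 1 := ⟨r - 1, by omega⟩
  set ψ : ℕ → L := fun i => ((toEnd ℂ L L e') ^ i) z
  have hψr : ψ r ∈ rootSubspace ((Φ).root β) := by
    have h1 : ψ r ∈ rootSpace H (r • (-α.1 : H → ℂ) + chainTop α.1 β.1) :=
      toEnd_pow_apply_mem he' hz r
    have h2 : (r • (-α.1 : H → ℂ) + chainTop α.1 β.1) = ((Φ).root β : H → ℂ) := by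
      rw [coe_chainTop]
      ext t
      simp [← hr]
    rwa [h2] at h1
  have hψ0 : ∀ i ≤ r, ψ i ≠ 0 := fun i hi =>
    prim.pow_toEnd_f_ne_zero_of_eq_nat rfl (hi.trans hrl)
  have hlie : ⁅e, ψ r⁆ ≠ 0 := by
    have h1 := prim.lie_e_pow_succ_toEnd_f s
    rw [← hs] at h1
    change ⁅e, ψ r⁆ = _ at h1
    rw [h1]
    refine smul_ne_zero (mul_ne_zero (by exact_mod_cast (Nat.succ_ne_zero s)) ?_)
      (hψ0 s (by omega))
    rw [sub_ne_zero]
    exact_mod_cast (by omega : IsKilling.chainLength α.1 β.1 ≠ s)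
  obtain ⟨c, rfl⟩ := exists_eq_smul_of_mem_rootSubspace hf hx hx0
    (y := e) he
  obtain ⟨d, hd⟩ := exists_eq_smul_of_mem_rootSubspace hg hy hy0 hψr
  intro h0
  rw [hd, smul_lie, lie_smul, h0, smul_zero, smul_zero] at hlie
  exact hlie rfl

/-- Every element of a root space `L_{f + g}` is of the form `[x, y]`, for a given nonzero `x` in
`L_f` and a suitable `y` in `L_g`. -/
lemma exists_lie_eq_of_mem_rootSubspace (hf : f ∈ range (Φ).root) (hg : g ∈ range (Φ).root)
    (hfg : f + g ∈ range (Φ).root) (hx : x ∈ rootSubspace f) (hx0 : x ≠ 0) {z : L}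
    (hz : z ∈ rootSubspace (f + g)) : ∃ y ∈ rootSubspace g, ⁅x, y⁆ = z := by
  obtain ⟨y, hy, hy0⟩ := exists_mem_rootSubspace_ne_zero hg
  obtain ⟨c, rfl⟩ := exists_eq_smul_of_mem_rootSubspace hfg (lie_mem_rootSubspace hx hy)
    (lie_ne_zero_of_mem_rootSubspace hf hg hfg hx hx0 hy hy0) hz
  exact ⟨c • y, Submodule.smul_mem _ c hy, by rw [lie_smul]⟩

/-- An element of `L` belongs to a subspace `A` containing `H` if all of its components outside
of `A` with respect to the root space decomposition vanish. -/
lemma mem_of_forall_killingForm {A : Submodule ℂ L} (hA : H.toSubmodule ≤ A)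
    (h : ∀ f ∈ range (Φ).root, rootSubspace f ≤ A ∨
      ∀ z ∈ rootSubspace (-f), killingForm ℂ L x z = 0) : x ∈ A := by
  have hx : x ∈ ⨆ χ : Weight ℂ H L, (rootSpace H χ).toSubmodule := by
    rw [← LieSubmodule.iSup_toSubmodule, iSup_genWeightSpace_eq_top' ℂ H L]
    trivial
  obtain ⟨v, hv, hsum⟩ := (Submodule.mem_iSup_iff_exists_finsupp _ _).mp hx
  rw [← hsum]
  refine Submodule.sum_mem _ fun χ _ => ?_
  by_cases hχ : χ.IsZero
  · refine hA (mem_rootSubspace_zero.mp ?_)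
    have := hv χ
    rw [show (χ : H → ℂ) = ((0 : Module.Dual ℂ H) : H → ℂ) from hχ] at this
    exact this
  · let α : H.root := ⟨χ, by simpa [LieSubalgebra.root] using hχ⟩
    rcases h _ ⟨α, rfl⟩ with h | h
    · exact h (hv χ)
    · rw [eq_zero_of_forall_killingForm (f := (Φ).root α) (hv χ) fun z hz => ?_]
      · exact A.zero_mem
      rw [← h z hz, ← hsum, Finsupp.sum, map_sum, LinearMap.sum_apply]
      symm
      refine Finset.sum_eq_single χ (fun χ' _ hne => ?_) fun h0 => ?_
      · refine killingForm_apply_eq_zero_of_mem_rootSpace_of_add_ne_zero ℂ L H (hv χ') hz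
          fun h0 => hne (Weight.ext fun t => ?_)
        have h1 : χ' t + -(χ t) = 0 := congrFun h0 t
        exact add_neg_eq_zero.mp h1
      · rw [Finsupp.notMem_support_iff.mp h0, map_zero, LinearMap.zero_apply]

end RootSpaces

/-! ### Standard parabolic subalgebras -/

section Parabolic

set_option linter.unusedSectionVars false

open Set

variable {L : Type*} [LieRing L] [LieAlgebra ℂ L] [FiniteDimensional ℂ L] [IsKilling ℂ L]
  {H : LieSubalgebra ℂ L} [H.IsCartanSubalgebra]

local notation "Φ" => IsKilling.rootSystem H

variable {b : (IsKilling.rootSystem H).Base} {S : Set H.root} {x z : L}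

lemma mem_parabolic_of_mem_cartan (hx : x ∈ H) : x ∈ parabolic b S :=
  LieSubalgebra.subset_lieSpan (Or.inl (Or.inl hx))

lemma mem_parabolic_of_isPos {α : H.root} (hα : b.IsPos α) (hx : x ∈ rootSubspace ((Φ).root α)) :
    x ∈ parabolic b S :=
  LieSubalgebra.subset_lieSpan (Or.inl (Or.inr ⟨α, hα, hx⟩))

lemma mem_parabolic_of_mem_neg {α : H.root} (hα : α ∈ S) (hx : x ∈ rootSubspace (-(Φ).root α)) :
    x ∈ parabolic b S :=
  LieSubalgebra.subset_lieSpan (Or.inr ⟨α, hα, hx⟩)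

lemma isPos_simple {i : H.root} (hi : i ∈ b.support) : b.IsPos i :=
  RootPairing.Base.isPos_of_mem_support hi

lemma isPos_add {α β γ : H.root} (hα : b.IsPos α) (hβ : b.IsPos β)
    (h : (Φ).root γ = (Φ).root α + (Φ).root β) : b.IsPos γ := by
  rw [isPos_iff_coeff_nonneg] at *
  rw [coeff_add b h]
  exact add_nonneg hα hβ

lemma SupportedIn.of_add {K : Set H.root} {α β γ : H.root} (hα : b.IsPos α) (hβ : b.IsPos β)
    (h : (Φ).root γ = (Φ).root α + (Φ).root β) (hγ : SupportedIn b K γ) :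
    SupportedIn b K α ∧ SupportedIn b K β := by
  rw [isPos_iff_coeff_nonneg] at hα hβ
  have key : ∀ i : b.support, (i : H.root) ∉ K → coeff b α i = 0 ∧ coeff b β i = 0 := by
    intro i hi
    have h1 := congrFun (coeff_add b h) i
    rw [Pi.add_apply, hγ i hi] at h1
    have h2 := hα i
    have h3 := hβ i
    simp only [Pi.zero_apply] at h2 h3
    omega
  exact ⟨fun i hi => (key i hi).1, fun i hi => (key i hi).2⟩

/-- The parabolic subalgebra contains the root spaces of all roots of the Levi factor. -/
lemma mem_parabolic_of_supportedIn {α : H.root} (hα : b.IsPos α) (hS : SupportedIn b S α)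
    (hx : x ∈ rootSubspace (-(Φ).root α)) : x ∈ parabolic b S := by
  suffices b.IsPos α ∧ (SupportedIn b S α → ∀ x ∈ rootSubspace (-(Φ).root α), x ∈ parabolic b S)
    from this.2 hS x hx
  refine hα.induction_on_add (p := fun α => b.IsPos α ∧ (SupportedIn b S α →
    ∀ x ∈ rootSubspace (-(Φ).root α), x ∈ parabolic b S)) (fun i hi => ⟨isPos_simple hi,
      fun hS x hx => mem_parabolic_of_mem_neg
        (supportedIn_simple_iff (i := (⟨i, hi⟩ : b.support)).mp hS) hx⟩) ?_
  rintro i j k hk ⟨hi, ih⟩ hj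
  have hj' := isPos_simple hj
  refine ⟨isPos_add hi hj' hk, fun hS x hx => ?_⟩
  obtain ⟨hSi, hSj⟩ := hS.of_add hi hj' hk
  have hroot : -(Φ).root k = -(Φ).root j + -(Φ).root i := by rw [hk]; abel
  obtain ⟨y, hy, hy0⟩ := exists_mem_rootSubspace_ne_zero (neg_mem_range_root ⟨j, rfl⟩)
  obtain ⟨y', hy', rfl⟩ := exists_lie_eq_of_mem_rootSubspace (neg_mem_range_root ⟨j, rfl⟩)
    (neg_mem_range_root ⟨i, rfl⟩) (hroot ▸ neg_mem_range_root ⟨k, rfl⟩) hy hy0 (hroot ▸ hx)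
  exact (parabolic b S).lie_mem (mem_parabolic_of_mem_neg
    (supportedIn_simple_iff (i := (⟨j, hj⟩ : b.support)).mp hSj) hy) (ih hSi y' hy')

/-- The root `γ` has a positive coefficient outside of `S`: its root space lies in the nilradical
of the parabolic subalgebra attached to `S`. -/
def IsNilradicalRoot (b : (IsKilling.rootSystem H).Base) (S : Set H.root) (γ : H.root) : Prop :=
  ∃ i : b.support, (i : H.root) ∉ S ∧ 0 < coeff b γ i

lemma IsNilradicalRoot.isPos {γ : H.root} (h : IsNilradicalRoot b S γ) : b.IsPos γ := by
  obtain ⟨i, -, hi⟩ := h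
  exact isPos_of_coeff_pos b hi

lemma isNilradicalRoot_or_supportedIn {γ : H.root} (h : b.IsPos γ) :
    IsNilradicalRoot b S γ ∨ SupportedIn b S γ := by
  by_contra! hno
  refine hno.2 fun i hi => le_antisymm ?_ ((isPos_iff_coeff_nonneg b).mp h i)
  by_contra! hlt
  exact hno.1 ⟨i, hi, hlt⟩

/-- The normalizer of a subspace of a Lie algebra. -/
def submoduleNormalizer {L : Type*} [LieRing L] [LieAlgebra ℂ L] (N : Submodule ℂ L) :
    LieSubalgebra ℂ L where
  carrier := {x | ∀ z ∈ N, ⁅x, z⁆ ∈ N}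
  add_mem' hx hy z hz := by
    rw [add_lie]
    exact N.add_mem (hx z hz) (hy z hz)
  zero_mem' z _ := by
    rw [zero_lie]
    exact N.zero_mem
  smul_mem' c x hx z hz := by
    rw [smul_lie]
    exact N.smul_mem c (hx z hz)
  lie_mem' {x y} hx hy z hz := by
    rw [lie_lie]
    exact N.sub_mem (hx _ (hy z hz)) (hy _ (hx z hz))

/-- The parabolic subalgebra is orthogonal to its nilradical: it normalizes the nilradical `N`,
and `κ(x, [h, z]) = κ([z, x], h) = 0` for `z` in `N` and `h` in `H`. -/
lemma killingForm_eq_zero_of_mem_parabolic (hS : S ⊆ b.support) (hx : x ∈ parabolic b S)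
    {γ : H.root} (hγ : IsNilradicalRoot b S γ) (hz : z ∈ rootSubspace ((Φ).root γ)) :
    killingForm ℂ L x z = 0 := by
  classical
  set N : Submodule ℂ L := ⨆ δ ∈ {δ | IsNilradicalRoot b S δ}, rootSubspace ((Φ).root δ) with hN
  have hmemN : ∀ δ, IsNilradicalRoot b S δ → rootSubspace ((Φ).root δ) ≤ N :=
    fun δ hδ => le_biSup (fun δ => rootSubspace ((Φ).root δ)) hδ
  have hle : ∀ {p : L → Prop},
      (∀ δ, IsNilradicalRoot b S δ → ∀ z ∈ rootSubspace ((Φ).root δ), p z) →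
      p 0 → (∀ x y, p x → p y → p (x + y)) → ∀ z ∈ N, p z := by
    intro p h1 h2 h3 z hz
    refine Submodule.iSup_induction _ (motive := p) hz (fun δ y hy => ?_) h2 h3
    refine Submodule.iSup_induction _ (motive := p) hy (fun hδ y hy => h1 δ hδ y hy) h2 h3
  -- bracketing with the root space of a root whose coefficients outside of `S` are nonnegative
  have hroot : ∀ α : H.root, (∀ i : b.support, (i : H.root) ∉ S → 0 ≤ coeff b α i) →
      ∀ x ∈ rootSubspace ((Φ).root α), x ∈ submoduleNormalizer N := by
    intro α hα x hx
    refine hle (fun δ hδ z hz => ?_) (by simp) fun y y' h h' => by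
      rw [lie_add]; exact N.add_mem h h'
    have hxz := lie_mem_rootSubspace hx hz
    obtain ⟨i, hi, hpos⟩ := hδ
    by_cases hmem : (Φ).root α + (Φ).root δ ∈ range (Φ).root
    · obtain ⟨γ, hγ⟩ := hmem
      rw [← hγ] at hxz
      refine hmemN γ ⟨i, hi, ?_⟩ hxz
      rw [coeff_add b hγ, Pi.add_apply]
      have := hα i hi
      omega
    · rw [eq_zero_of_mem_rootSubspace (fun h0 => ?_) hmem hxz]
      · exact N.zero_mem
      have h1 := coeff_neg b (eq_neg_of_add_eq_zero_left h0)
      have h2 := hα i hi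
      rw [h1, Pi.neg_apply] at h2
      omega
  have hp : parabolic b S ≤ submoduleNormalizer N := by
    refine LieSubalgebra.lieSpan_le.mpr ?_
    rintro x ((hx | ⟨α, hα, hx⟩) | ⟨α, hα, hx⟩)
    · refine hle (fun δ hδ z hz => ?_) (by simp) fun y y' h h' => by
        rw [lie_add]; exact N.add_mem h h'
      have := lie_eq_smul_of_mem_rootSubspace ⟨x, hx⟩ hz
      rw [this]
      exact N.smul_mem _ (hmemN δ hδ hz)
    · exact hroot α (fun i _ => (isPos_iff_coeff_nonneg b).mp hα i) x hx
    · obtain ⟨β, hβ⟩ := neg_mem_range_root (H := H) ⟨α, rfl⟩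
      refine hroot β (fun i hi => ?_) x (hβ ▸ hx)
      rw [coeff_neg b hβ, Pi.neg_apply,
        supportedIn_simple (i := (⟨α, hS hα⟩ : b.support)) hα i hi, neg_zero]
  have hzx : ⁅z, x⁆ ∈ N := by
    rw [← lie_skew]
    exact N.neg_mem (hp hx z (hmemN γ hγ hz))
  obtain ⟨h, hh⟩ : ∃ h : H, (Φ).root γ h ≠ 0 := by
    by_contra! hno
    exact (Φ).ne_zero γ (LinearMap.ext hno)
  have horth : killingForm ℂ L ⁅z, x⁆ h = 0 := by
    refine hle (p := fun w => killingForm ℂ L w h = 0) (fun δ hδ w hw => ?_) (by simp)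
      (fun y y' h h' => by rw [map_add, LinearMap.add_apply, h, h', add_zero]) _ hzx
    refine killingForm_eq_zero_of_mem_rootSubspace hw (mem_rootSubspace_zero.mpr h.2) ?_
    rw [add_zero]
    exact (Φ).ne_zero δ
  have h1 : killingForm ℂ L ⁅z, x⁆ h = (Φ).root γ h * killingForm ℂ L x z := by
    rw [← lie_skew, map_neg, LinearMap.neg_apply, LieModule.traceForm_apply_lie_apply,
      ← lie_skew, map_neg, lie_eq_smul_of_mem_rootSubspace h hz, map_smul, smul_eq_mul, neg_neg]
  exact (mul_eq_zero.mp (h1.symm.trans horth)).resolve_left hh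

lemma mem_parabolic_of_forall_killingForm
    (h : ∀ γ, IsNilradicalRoot b S γ → ∀ z ∈ rootSubspace ((Φ).root γ), killingForm ℂ L x z = 0) :
    x ∈ parabolic b S := by
  refine mem_of_forall_killingForm (H := H) (A := (parabolic b S).toSubmodule)
    (fun x hx => mem_parabolic_of_mem_cartan hx) ?_
  rintro _ ⟨α, rfl⟩
  by_cases hα : b.IsPos α
  · exact Or.inl fun x hx => mem_parabolic_of_isPos hα hx
  obtain ⟨β, hβ⟩ := neg_mem_range_root (H := H) ⟨α, rfl⟩
  have hβpos : b.IsPos β := by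
    rw [isPos_iff_coeff_nonneg, coeff_neg b hβ]
    simpa using (not_isPos_iff_coeff_nonpos b).mp hα
  rcases isNilradicalRoot_or_supportedIn (S := S) hβpos with h' | h'
  · exact Or.inr fun z hz => h β h' z (hβ ▸ hz)
  · refine Or.inl fun x hx => mem_parabolic_of_supportedIn hβpos h' ?_
    rwa [hβ, neg_neg]

end Parabolic

/-! ### The roots attached to two simple roots -/

section QuadrupleRoots

set_option linter.unusedSectionVars false

open Set

variable {L : Type*} [LieRing L] [LieAlgebra ℂ L] [FiniteDimensional ℂ L] [IsKilling ℂ L]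
  {H : LieSubalgebra ℂ L} [H.IsCartanSubalgebra]

local notation "Φ" => IsKilling.rootSystem H

variable {b : (IsKilling.rootSystem H).Base} {α₁ α₂ θ : H.root} {ε : Fin 4 → H.root}

lemma two_zsmul_root_notMem_range (α : H.root) : (Φ).root α + (Φ).root α ∉ range (Φ).root := by
  have := IsAddTorsionFree.of_isTorsionFree ℂ (Module.Dual ℂ H)
  rw [← two_nsmul]
  exact (Φ).nsmul_notMem_range_root

lemma root_add_root_ne_zero {α β : H.root} (hα : b.IsPos α) (hβ : b.IsPos β) :
    (Φ).root α + (Φ).root β ≠ 0 := fun h =>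
  IsPos.not_of_root_eq_neg b (eq_neg_of_add_eq_zero_right h) hα hβ

lemma isPos_of_mem_cascadeRoots {S : Set H.root} (hS : S ⊆ b.support) {ε : H.root}
    (hε : ε ∈ cascadeRoots S) : b.IsPos ε := by
  obtain ⟨K, -, -, h⟩ := exists_isHighest_of_mem_cascadeRoots hS hε
  exact h.isPos

lemma add_notMem_range_of_mem_cascadeRoots {S : Set H.root} (hS : S ⊆ b.support) {ε ε' : H.root}
    (hε : ε ∈ cascadeRoots S) (hε' : ε' ∈ cascadeRoots S) :
    (Φ).root ε + (Φ).root ε' ∉ range (Φ).root := by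
  rcases eq_or_ne ε ε' with rfl | hne
  · exact two_zsmul_root_notMem_range ε
  · exact (cascadeRoots_strongly_orthogonal hS hε hε' hne).2.2

lemma coeff_simple_of_ne {i j : b.support} (h : j ≠ i) : coeff b (i : H.root) j = 0 :=
  supportedIn_simple (K := {(i : H.root)}) rfl j fun h' => h (Subtype.ext h')

/-- If `⟨α₁, α₂^∨⟩ = ⟨α₂, α₁^∨⟩ = -1`, with `α₁` and `α₂` simple and long, then `α₁ + α₂` is the
highest root of the subsystem spanned by `α₁` and `α₂`. -/
lemma isHighest_pair (h₁ : α₁ ∈ b.support) (h₂ : α₂ ∈ b.support)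
    (hconn : IsConnectedSet ({α₁, α₂} : Set H.root)) (hlong : IsLong (Φ) α₂)
    (h₁₂ : (Φ).pairingIn ℤ α₁ α₂ = -1) (h₂₁ : (Φ).pairingIn ℤ α₂ α₁ = -1)
    (hθ : (Φ).root θ = (Φ).root α₁ + (Φ).root α₂) : IsHighest b {α₁, α₂} θ := by
  lift α₁ to b.support using h₁
  lift α₂ to b.support using h₂
  obtain ⟨θ', hθ'⟩ := exists_isHighest (b := b) hconn.isIndecomposable (by
    rintro _ (rfl | rfl)
    exacts [α₁.2, α₂.2])
  have hc := coeff_add b hθ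
  have hlongθ : IsLong (Φ) θ := hlong.of_add h₂₁ (by rw [hθ, add_comm])
  have : θ' = θ := by
    refine hθ'.eq_of_dominant hlongθ ((supportedIn_simple (by simp)).add
      (supportedIn_simple (by simp)) hθ) (fun i hi => ?_) fun i hi => ?_
    · have h1 := coeff_simple_nonneg b α₁ i
      have h2 := coeff_simple_nonneg b α₂ i
      rw [hc, Pi.add_apply]
      simp only [Pi.zero_apply] at h1 h2
      rcases hi with hi | hi
      · obtain rfl := Subtype.ext hi
        rw [coeff_simple_self]
        omega
      · obtain rfl : i = α₂ := Subtype.ext hi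
        rw [coeff_simple_self]
        omega
    · rw [pairingIn_add_left hθ]
      rcases hi with hi | hi <;> rw [hi]
      · rw [RootPairing.pairingIn_same, h₂₁]; norm_num
      · rw [RootPairing.pairingIn_same, h₁₂]; norm_num
  exact this ▸ hθ'

/-- The positive roots of the subsystem spanned by `α₁` and `α₂` are `α₁`, `α₂` and `α₁ + α₂`. -/
lemma IsHighest.eq_of_supportedIn_pair (h₁ : α₁ ∈ b.support) (h₂ : α₂ ∈ b.support)
    (hh : IsHighest b {α₁, α₂} θ) (hne : α₁ ≠ α₂)
    (hθ : (Φ).root θ = (Φ).root α₁ + (Φ).root α₂) {γ : H.root}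
    (hγ : b.IsPos γ) (hS : SupportedIn b {α₁, α₂} γ) : γ = α₁ ∨ γ = α₂ ∨ γ = θ := by
  lift α₁ to b.support using h₁
  lift α₂ to b.support using h₂
  have hne' : α₁ ≠ α₂ := fun h => hne (congrArg _ h)
  have hnn := (isPos_iff_coeff_nonneg b).mp hγ
  have hle := hh.coeff_le γ hS
  have hc := coeff_add b hθ
  have hcoef : ∀ i, (i = α₁ ∨ i = α₂ → coeff b θ i = 1) ∧
      (i ≠ α₁ → i ≠ α₂ → coeff b γ i = 0) := fun i => by
    refine ⟨?_, fun hi₁ hi₂ => hS i ?_⟩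
    · rintro (rfl | rfl)
      · rw [hc, Pi.add_apply, coeff_simple_self, coeff_simple_of_ne hne', add_zero]
      · rw [hc, Pi.add_apply, coeff_simple_self, coeff_simple_of_ne hne'.symm, zero_add]
    · rintro (h | h)
      exacts [hi₁ (Subtype.ext h), hi₂ (Subtype.ext h)]
  have key : ∀ δ : H.root, SupportedIn b {(α₁ : H.root), (α₂ : H.root)} δ →
      coeff b γ α₁ = coeff b δ α₁ → coeff b γ α₂ = coeff b δ α₂ → γ = δ := by
    intro δ hδ h1 h2
    refine coeff_injective b (funext fun i => ?_)
    by_cases hi₁ : i = α₁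
    · rwa [hi₁]
    by_cases hi₂ : i = α₂
    · rwa [hi₂]
    rw [(hcoef i).2 hi₁ hi₂, hδ]
    rintro (h | h)
    exacts [hi₁ (Subtype.ext h), hi₂ (Subtype.ext h)]
  have hs₁ : SupportedIn b {(α₁ : H.root), (α₂ : H.root)} (α₁ : H.root) :=
    supportedIn_simple (by simp)
  have hs₂ : SupportedIn b {(α₁ : H.root), (α₂ : H.root)} (α₂ : H.root) :=
    supportedIn_simple (by simp)
  have h1 := hnn α₁
  have h2 := hnn α₂
  have h3 : coeff b γ α₁ ≤ 1 := (hle α₁).trans_eq ((hcoef α₁).1 (Or.inl rfl))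
  have h4 : coeff b γ α₂ ≤ 1 := (hle α₂).trans_eq ((hcoef α₂).1 (Or.inr rfl))
  simp only [Pi.zero_apply] at h1 h2
  rcases (by omega : coeff b γ α₁ = 0 ∨ coeff b γ α₁ = 1) with h5 | h5 <;>
  rcases (by omega : coeff b γ α₂ = 0 ∨ coeff b γ α₂ = 1) with h6 | h6
  · refine absurd (funext fun i => ?_) (coeff_ne_zero b γ)
    by_cases hi₁ : i = α₁
    · rw [hi₁, h5, Pi.zero_apply]
    by_cases hi₂ : i = α₂
    · rw [hi₂, h6, Pi.zero_apply]
    exact (hcoef i).2 hi₁ hi₂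
  · right; left
    exact key _ hs₂ (by rw [h5, coeff_simple_of_ne hne']) (by rw [h6, coeff_simple_self])
  · left
    exact key _ hs₁ (by rw [h5, coeff_simple_self]) (by rw [h6, coeff_simple_of_ne hne'.symm])
  · right; right
    exact key _ hh.supportedIn (by rw [h5, (hcoef _).1 (Or.inl rfl)])
      (by rw [h6, (hcoef _).1 (Or.inr rfl)])

namespace IsCascadeQuadruple

variable (hq : IsCascadeQuadruple b α₁ α₂ ε)

include hq

lemma swap : IsCascadeQuadruple b α₁ α₂ ![ε 0, ε 1, ε 3, ε 2] where
  mem k := by fin_cases k <;> exact hq.mem _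
  injective := by
    have : ![ε 0, ε 1, ε 3, ε 2] = ε ∘ Equiv.swap 2 3 := by
      ext k; fin_cases k <;> rfl
    rw [this]
    exact hq.injective.comp (Equiv.injective _)
  isHighest := hq.isHighest
  eq_one := hq.eq_one
  isLong := hq.isLong
  pairing₁₂ := hq.pairing₁₂
  pairing₂₁ := hq.pairing₂₁
  relation := by
    rw [hq.relation]
    exact sub_right_comm _ _ _

lemma mem_root_one : α₁ ∈ cascadeRoots (b.support : Set H.root) := hq.eq_one ▸ hq.mem 1

lemma isPos (k : Fin 4) : b.IsPos (ε k) := isPos_of_mem_cascadeRoots subset_rfl (hq.mem k)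

lemma pairingIn_of_ne {k : Fin 4} {δ : H.root}
    (hδ : δ ∈ cascadeRoots (b.support : Set H.root)) (h : ε k ≠ δ) :
    (Φ).pairingIn ℤ (ε k) δ = 0 :=
  (cascadeRoots_strongly_orthogonal subset_rfl (hq.mem k) hδ h).1

lemma pairingIn_self (k : Fin 4) : (Φ).pairingIn ℤ (ε k) (ε k) = 2 :=
  RootPairing.pairingIn_same ..

lemma pairingIn_ne {k l : Fin 4} (h : k ≠ l) : (Φ).pairingIn ℤ (ε k) (ε l) = 0 :=
  hq.pairingIn_of_ne (hq.mem l) (hq.injective.ne h)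

lemma two_mul_pairingIn (δ : H.root) : 2 * (Φ).pairingIn ℤ α₂ δ = (Φ).pairingIn ℤ (ε 0) δ -
    (Φ).pairingIn ℤ (ε 1) δ - (Φ).pairingIn ℤ (ε 2) δ - (Φ).pairingIn ℤ (ε 3) δ := by
  have h := congrArg (fun f : Module.Dual ℂ H => f ((Φ).coroot δ)) hq.relation
  refine FaithfulSMul.algebraMap_injective ℤ ℂ ?_
  simp only [LinearMap.sub_apply, LinearMap.smul_apply] at h
  simp only [map_sub, map_mul, RootPairing.algebraMap_pairingIn]
  simpa using h

variable (hθ : (IsKilling.rootSystem H).root θ =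
  (IsKilling.rootSystem H).root α₁ + (IsKilling.rootSystem H).root α₂)

include hθ

lemma two_mul_pairingIn_sum (δ : H.root) : 2 * (Φ).pairingIn ℤ θ δ = (Φ).pairingIn ℤ (ε 0) δ +
    (Φ).pairingIn ℤ (ε 1) δ - (Φ).pairingIn ℤ (ε 2) δ - (Φ).pairingIn ℤ (ε 3) δ := by
  have h1 := hq.two_mul_pairingIn δ
  have h2 := pairingIn_add_left hθ δ
  rw [hq.eq_one] at h2
  omega

lemma pairingIn_sum : (Φ).pairingIn ℤ θ (ε 0) = 1 ∧ (Φ).pairingIn ℤ θ (ε 1) = 1 ∧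
    (Φ).pairingIn ℤ θ (ε 2) = -1 ∧ (Φ).pairingIn ℤ θ (ε 3) = -1 := by
  have h := fun k => hq.two_mul_pairingIn_sum hθ (ε k)
  have h0 := h 0
  have h1 := h 1
  have h2 := h 2
  have h3 := h 3
  rw [hq.pairingIn_self, hq.pairingIn_ne (by decide), hq.pairingIn_ne (by decide),
    hq.pairingIn_ne (by decide)] at h0 h1 h2 h3
  omega

lemma isLong_sum : IsLong (Φ) θ := hq.isLong.of_add hq.pairing₂₁ (by rw [hθ, add_comm])

/-- The root `β₂ = ε₀ - θ - ε₂`, where `θ = α₁ + α₂`. -/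
lemma exists_beta (hpos : b.IsPos θ) : ∃ β γ, b.IsPos β ∧ b.IsPos γ ∧ IsLong (Φ) β ∧
    (Φ).root γ = (Φ).root θ + (Φ).root (ε 2) ∧
    (Φ).root β = (Φ).root (ε 0) - (Φ).root θ - (Φ).root (ε 2) := by
  obtain ⟨h0, -, h2, -⟩ := hq.pairingIn_sum hθ
  have hγ : (Φ).root ((Φ).reflectionPerm (ε 2) θ) = (Φ).root θ + (Φ).root (ε 2) := by
    rw [root_reflectionPerm_eq, h2]; module
  set γ := (Φ).reflectionPerm (ε 2) θ
  have hγ0 : (Φ).pairingIn ℤ γ (ε 0) = 1 := by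
    rw [pairingIn_add_left hγ, h0, hq.pairingIn_ne (by decide)]; norm_num
  obtain ⟨β, hβ, hβ'⟩ := hq.isHighest.exists_sub (α := γ) (fun i hi => absurd i.2 hi) hγ0
  refine ⟨β, γ, hβ, isPos_add hpos (hq.isPos 2) hγ, ?_, hγ, by rw [hβ', hγ]; abel⟩
  have hneg : (Φ).root ((Φ).reflectionPerm γ γ) = -(Φ).root γ := by
    rw [RootPairing.root_reflectionPerm, RootPairing.reflection_apply_self]
  refine (((hq.isLong_sum hθ).reflectionPerm (ε 2)).reflectionPerm γ).of_add (β := ε 0) ?_ ?_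
  · rw [pairingIn_neg_left hneg, hγ0]
  · rw [hneg, hβ']; abel

/-- The only cascade roots `δ` for which `θ + δ` is a root are `ε₂` and `ε₃`. -/
lemma sum_add_notMem {δ : H.root} (hδ : δ ∈ cascadeRoots (b.support : Set H.root))
    (h2 : δ ≠ ε 2) (h3 : δ ≠ ε 3) : (Φ).root θ + (Φ).root δ ∉ range (Φ).root := by
  refine (hq.isLong_sum hθ).add_notMem (pairingIn_nonneg_swap ?_)
  have h := hq.two_mul_pairingIn_sum hθ δ
  rw [hq.pairingIn_of_ne hδ h2.symm, hq.pairingIn_of_ne hδ h3.symm] at h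
  have hnn : ∀ k, 0 ≤ (Φ).pairingIn ℤ (ε k) δ := fun k => by
    by_cases hk : ε k = δ
    · rw [hk, RootPairing.pairingIn_same]; norm_num
    · rw [hq.pairingIn_of_ne hδ hk]
  have := hnn 0
  have := hnn 1
  omega

/-- The only cascade roots `δ` for which `β₂ - δ` is a root or zero are `ε₀` and `ε₃`. -/
lemma beta_sub_notMem {β : H.root} (hlong : IsLong (Φ) β)
    (hβ : (Φ).root β = (Φ).root (ε 0) - (Φ).root θ - (Φ).root (ε 2)) {δ : H.root}
    (hδ : δ ∈ cascadeRoots (b.support : Set H.root)) (h0 : δ ≠ ε 0) (h3 : δ ≠ ε 3) :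
    (Φ).root β - (Φ).root δ ≠ 0 ∧ (Φ).root β - (Φ).root δ ∉ range (Φ).root := by
  have h := hq.two_mul_pairingIn_sum hθ δ
  have hp : (Φ).pairingIn ℤ β δ = (Φ).pairingIn ℤ (ε 0) δ - (Φ).pairingIn ℤ θ δ -
      (Φ).pairingIn ℤ (ε 2) δ := by
    have h := congrArg (fun f : Module.Dual ℂ H => f ((Φ).coroot δ)) hβ
    refine FaithfulSMul.algebraMap_injective ℤ ℂ ?_
    simp only [LinearMap.sub_apply] at h
    simp only [map_sub, RootPairing.algebraMap_pairingIn]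
    simpa using h
  have hnn : ∀ k, 0 ≤ (Φ).pairingIn ℤ (ε k) δ := fun k => by
    by_cases hk : ε k = δ
    · rw [hk, RootPairing.pairingIn_same]; norm_num
    · rw [hq.pairingIn_of_ne hδ hk]
  rw [hq.pairingIn_of_ne hδ h0.symm, hq.pairingIn_of_ne hδ h3.symm] at h
  rw [hq.pairingIn_of_ne hδ h0.symm] at hp
  have h1 := hnn 1
  have h2 := hnn 2
  obtain ⟨δ', hδ'⟩ := neg_mem_range_root (H := H) ⟨δ, rfl⟩
  constructor
  · intro h0
    have := (Φ).root.injective (sub_eq_zero.mp h0)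
    rw [this, RootPairing.pairingIn_same] at hp
    omega
  · rw [sub_eq_add_neg, ← hδ']
    refine hlong.add_notMem ?_
    rw [pairingIn_neg_left hδ']
    by_contra! hlt
    have := pairingIn_pos_iff_swap.mp (by omega : 0 < (Φ).pairingIn ℤ δ β)
    omega

end IsCascadeQuadruple

end QuadrupleRoots

/-! ### The stabilizer of the cascade form -/

section Stabilizer

set_option linter.unusedSectionVars false

open Set

variable {L : Type*} [LieRing L] [LieAlgebra ℂ L] [FiniteDimensional ℂ L] [IsKilling ℂ L]
  {H : LieSubalgebra ℂ L} [H.IsCartanSubalgebra]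

local notation "Φ" => IsKilling.rootSystem H

variable {b : (IsKilling.rootSystem H).Base} {α₁ α₂ θ : H.root} {w : H.root → L} {v x y u : L}
  {f g : Module.Dual ℂ H}

/-- Invariance of `κ` turns `κ(u, [x, y]) = 0` into the orthogonality of `x` and `[y, u]`. -/
lemma mem_stabilizerIn_iff {p : LieSubalgebra ℂ L} :
    x ∈ stabilizerIn p u ↔ x ∈ p ∧ ∀ y ∈ p, killingForm ℂ L x ⁅y, u⁆ = 0 := by
  have key : ∀ x y, killingForm ℂ L u ⁅x, y⁆ = killingForm ℂ L x ⁅y, u⁆ := fun x y => by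
    rw [LieModule.traceForm_comm, LieModule.traceForm_apply_lie_apply]
  constructor
  · rintro ⟨z, hz, rfl⟩
    exact ⟨z.2, fun y hy => (key _ _).symm.trans (hz ⟨y, hy⟩)⟩
  · rintro ⟨hx, h⟩
    exact ⟨⟨x, hx⟩, fun y => (key _ _).trans (h y y.2), rfl⟩

lemma root_apply_coroot_eq_pairing (α β : H.root) :
    (Φ).root α ((Φ).coroot β) = (Φ).pairing α β :=
  (Φ).root_coroot_eq_pairing α β

lemma lie_eq_zero_of_notMem_range (hx : x ∈ rootSubspace f) (hy : y ∈ rootSubspace g)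
    (h0 : f + g ≠ 0) (h : f + g ∉ range (Φ).root) : ⁅x, y⁆ = 0 :=
  eq_zero_of_mem_rootSubspace h0 h (lie_mem_rootSubspace hx hy)

lemma mem_cascadeAnnihilator_iff {S : Set H.root} : x ∈ cascadeAnnihilator S ↔
    ∃ h : H, (h : L) = x ∧ ∀ ε ∈ cascadeRoots S, (Φ).root ε h = 0 := by
  constructor
  · rintro ⟨h, hh, rfl⟩
    refine ⟨h, rfl, fun ε hε => ?_⟩
    exact (Submodule.mem_dualCoannihilator _).mp hh _ (Submodule.subset_span ⟨ε, hε, rfl⟩)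
  · rintro ⟨h, rfl, hh⟩
    refine ⟨h, (Submodule.mem_dualCoannihilator _).mpr fun φ hφ => ?_, rfl⟩
    induction hφ using Submodule.span_induction with
    | mem φ hφ =>
      obtain ⟨ε, hε, rfl⟩ := hφ
      exact hh ε hε
    | zero => rfl
    | add φ ψ _ _ h1 h2 => rw [LinearMap.add_apply, h1, h2, add_zero]
    | smul c φ _ h1 => rw [LinearMap.smul_apply, h1, smul_zero]

/-- The vectors `w ε ∈ L_{-ε}`, for `ε` in the cascade, and `v ∈ L_θ` are nonzero. -/
structure IsCascadeFamily (b : (IsKilling.rootSystem H).Base) (θ : H.root) (w : H.root → L)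
    (v : L) : Prop where
  mem : ∀ ε ∈ cascadeRoots (b.support : Set H.root), w ε ∈ rootSubspace (-(Φ).root ε)
  ne_zero : ∀ ε ∈ cascadeRoots (b.support : Set H.root), w ε ≠ 0
  mem_theta : v ∈ rootSubspace ((Φ).root θ)
  theta_ne_zero : v ≠ 0

open Classical in
/-- The sum of the vectors `w ε`, for `ε` in the cascade, and of `v`. -/
noncomputable def cascadeSum (b : (IsKilling.rootSystem H).Base) (w : H.root → L) (v : L) : L :=
  ∑ ε : H.root with ε ∈ cascadeRoots (b.support : Set H.root), w ε + v

open Classical in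
lemma lie_cascadeSum : ⁅y, cascadeSum b w v⁆ =
    ∑ ε : H.root with ε ∈ cascadeRoots (b.support : Set H.root), ⁅y, w ε⁆ + ⁅y, v⁆ := by
  rw [cascadeSum, lie_add, lie_sum]

/-- Two simple roots `α₁`, `α₂` which span a subsystem with positive roots `α₁`, `α₂`,
`θ = α₁ + α₂`, and such that `α₁` belongs to the cascade. -/
structure IsCascadePair (b : (IsKilling.rootSystem H).Base) (α₁ α₂ θ : H.root) : Prop where
  mem₁ : α₁ ∈ b.support
  mem₂ : α₂ ∈ b.support
  mem_cascade : α₁ ∈ cascadeRoots (b.support : Set H.root)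
  root_sum : (Φ).root θ = (Φ).root α₁ + (Φ).root α₂
  eq_of_supportedIn : ∀ γ, b.IsPos γ → SupportedIn b {α₁, α₂} γ → γ = α₁ ∨ γ = α₂ ∨ γ = θ

namespace IsCascadePair

variable (hp : IsCascadePair b α₁ α₂ θ) (hw : IsCascadeFamily b θ w v)

include hp

lemma isPos₁ : b.IsPos α₁ := isPos_simple hp.mem₁

lemma isPos₂ : b.IsPos α₂ := isPos_simple hp.mem₂

lemma isPos_sum : b.IsPos θ := isPos_add hp.isPos₁ hp.isPos₂ hp.root_sum

lemma subset : ({α₁, α₂} : Set H.root) ⊆ b.support := by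
  rintro _ (rfl | rfl)
  exacts [hp.mem₁, hp.mem₂]

/-- A simple root is not the sum of two positive roots. -/
lemma ne_of_root_eq_add {γ β δ : H.root} (hγ : b.IsPos γ) (hβ : b.IsPos β)
    (hδ : (Φ).root δ = (Φ).root γ + (Φ).root β) : δ ≠ α₁ := by
  rintro rfl
  have hmem := hp.mem₁
  lift δ to b.support using hmem
  obtain ⟨h1, h2⟩ := SupportedIn.of_add (K := {(δ : H.root)}) hγ hβ hδ (supportedIn_simple rfl)
  have key : ∀ {γ : H.root}, b.IsPos γ → SupportedIn b {(δ : H.root)} γ → 0 < coeff b γ δ := by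
    intro γ hγ hs
    refine lt_of_le_of_ne ((isPos_iff_coeff_nonneg b).mp hγ δ) fun h0 => coeff_ne_zero b γ ?_
    ext i
    by_cases hi : i = δ
    · rw [hi, ← h0]
      rfl
    · exact hs i fun h => hi (Subtype.ext h)
  have h3 := key hγ h1
  have h4 := key hβ h2
  have h5 := congrFun (coeff_add b hδ) δ
  rw [coeff_simple_self, Pi.add_apply] at h5
  omega

lemma mem_parabolic_neg {γ : H.root} (hγ : γ = α₁ ∨ γ = α₂ ∨ γ = θ)
    (hx : x ∈ rootSubspace (-(Φ).root γ)) : x ∈ parabolic b {α₁, α₂} := by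
  have h₁ : SupportedIn b {α₁, α₂} α₁ :=
    supportedIn_simple (i := (⟨α₁, hp.mem₁⟩ : b.support)) (by simp)
  have h₂ : SupportedIn b {α₁, α₂} α₂ :=
    supportedIn_simple (i := (⟨α₂, hp.mem₂⟩ : b.support)) (by simp)
  rcases hγ with rfl | rfl | rfl
  · exact mem_parabolic_of_supportedIn hp.isPos₁ h₁ hx
  · exact mem_parabolic_of_supportedIn hp.isPos₂ h₂ hx
  · exact mem_parabolic_of_supportedIn hp.isPos_sum (h₁.add h₂ hp.root_sum) hx

include hw

/-- The crucial computation: an element of the stabilizer which has no component in `L_{-θ}`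
belongs to `H` and is annihilated by the cascade. -/
theorem mem_cascadeAnnihilator (hx : x ∈ parabolic b {α₁, α₂})
    (hstab : ∀ y ∈ parabolic b {α₁, α₂}, killingForm ℂ L x ⁅y, cascadeSum b w v⁆ = 0)
    (hv : killingForm ℂ L x v = 0) : x ∈ cascadeAnnihilator (b.support : Set H.root) := by
  classical
  set E := (Finset.univ.filter fun ε : H.root => ε ∈ cascadeRoots (b.support : Set H.root)) with hE
  have hmemE : ∀ {ε}, ε ∈ E ↔ ε ∈ cascadeRoots (b.support : Set H.root) := by simp [hE]
  have hposE : ∀ {ε}, ε ∈ E → b.IsPos ε := fun h =>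
    isPos_of_mem_cascadeRoots subset_rfl (hmemE.mp h)
  have hstab' : ∀ y ∈ parabolic b {α₁, α₂},
      ∑ ε ∈ E, killingForm ℂ L x ⁅y, w ε⁆ + killingForm ℂ L x ⁅y, v⁆ = 0 := fun y hy => by
    have := hstab y hy
    rwa [lie_cascadeSum, map_add, map_sum] at this
  have extend : ∀ {f : Module.Dual ℂ H} {z : L}, f ∈ range (Φ).root → z ∈ rootSubspace f → z ≠ 0 →
      killingForm ℂ L x z = 0 → ∀ z' ∈ rootSubspace f, killingForm ℂ L x z' = 0 := by
    intro f z hf hz hz0 h z' hz'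
    obtain ⟨c, rfl⟩ := exists_eq_smul_of_mem_rootSubspace hf hz hz0 hz'
    rw [map_smul, h, smul_zero]
  have hZθ := extend ⟨θ, rfl⟩ hw.mem_theta hw.theta_ne_zero hv
  -- the components in `L_ε`, for `ε` in the cascade, vanish
  have hZcascade : ∀ ε ∈ E, ∀ z ∈ rootSubspace (-(Φ).root ε), killingForm ℂ L x z = 0 := by
    intro ε hε
    refine extend (neg_mem_range_root ⟨ε, rfl⟩) (hw.mem ε (hmemE.mp hε))
      (hw.ne_zero ε (hmemE.mp hε)) ?_
    have h1 := hstab' ((Φ).coroot ε : H) (mem_parabolic_of_mem_cartan ((Φ).coroot ε).2)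
    rw [lie_eq_smul_of_mem_rootSubspace _ hw.mem_theta, map_smul, hv, smul_zero, add_zero,
      Finset.sum_eq_single_of_mem ε hε fun ε' hε' hne => ?_] at h1
    · rw [lie_eq_smul_of_mem_rootSubspace _ (hw.mem ε (hmemE.mp hε)), map_smul, smul_eq_mul,
        LinearMap.neg_apply] at h1
      refine (mul_eq_zero.mp h1).resolve_left (neg_ne_zero.mpr ?_)
      rw [root_apply_coroot_eq_pairing, RootPairing.pairing_same]
      exact two_ne_zero
    · rw [lie_eq_smul_of_mem_rootSubspace _ (hw.mem ε' (hmemE.mp hε')), map_smul, smul_eq_mul,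
        LinearMap.neg_apply, root_apply_coroot_eq_pairing]
      have h2 := (cascadeRoots_strongly_orthogonal subset_rfl (hmemE.mp hε') (hmemE.mp hε) hne).1
      rw [← pairing_eq_zero_iff_pairingIn] at h2
      rw [h2, neg_zero, zero_mul]
  -- the component in `L_{-α₂}` vanishes
  have hZ₂ : ∀ z ∈ rootSubspace ((Φ).root α₂), killingForm ℂ L x z = 0 := by
    obtain ⟨y, hy, hy0⟩ := exists_mem_rootSubspace_ne_zero (neg_mem_range_root (H := H) ⟨α₁, rfl⟩)
    have hsum : -(Φ).root α₁ + (Φ).root θ = (Φ).root α₂ := by rw [hp.root_sum]; abel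
    have hyv := lie_mem_rootSubspace hy hw.mem_theta
    have hyv0 := lie_ne_zero_of_mem_rootSubspace (neg_mem_range_root ⟨α₁, rfl⟩) ⟨θ, rfl⟩
      (hsum ▸ ⟨α₂, rfl⟩) hy hy0 hw.mem_theta hw.theta_ne_zero
    rw [hsum] at hyv
    refine extend ⟨α₂, rfl⟩ hyv hyv0 ?_
    have h1 := hstab' y (hp.mem_parabolic_neg (Or.inl rfl) hy)
    rwa [Finset.sum_eq_zero fun ε hε => ?_, zero_add] at h1
    rw [lie_eq_zero_of_notMem_range hy (hw.mem ε (hmemE.mp hε)), map_zero]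
    · rw [← neg_add, neg_ne_zero]
      exact root_add_root_ne_zero hp.isPos₁ (hposE hε)
    · intro h
      have := neg_mem_range_root h
      rw [← neg_add, neg_neg] at this
      exact add_notMem_range_of_mem_cascadeRoots subset_rfl hp.mem_cascade (hmemE.mp hε) this
  have hZpos : ∀ γ, b.IsPos γ → γ ≠ α₁ → ∀ z ∈ rootSubspace ((Φ).root γ),
      killingForm ℂ L x z = 0 := by
    intro γ hγ hne z hz
    rcases isNilradicalRoot_or_supportedIn (S := {α₁, α₂}) hγ with h | h
    · exact killingForm_eq_zero_of_mem_parabolic hp.subset hx h hz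
    · rcases hp.eq_of_supportedIn γ hγ h with rfl | rfl | rfl
      exacts [absurd rfl hne, hZ₂ z hz, hZθ z hz]
  -- the components in `L_ρ`, for `ρ` positive, vanish
  have hZneg : ∀ ρ, b.IsPos ρ → ∀ z ∈ rootSubspace (-(Φ).root ρ), killingForm ℂ L x z = 0 := by
    intro ρ hρ
    by_cases hρE : ρ ∈ E
    · exact hZcascade ρ hρE
    obtain ⟨ε, hε, β, hβ, hβε⟩ := mem_cascadeRoots_or_exists_summand hρ subset_rfl
      (fun i hi => absurd i.2 hi) (fun h => hρE (hmemE.mpr h))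
    obtain ⟨y, hy, hy0⟩ := exists_mem_rootSubspace_ne_zero (H := H) ⟨β, rfl⟩
    have hsum : (Φ).root β + -(Φ).root ε = -(Φ).root ρ := by rw [hβε]; abel
    have hyw := lie_mem_rootSubspace hy (hw.mem ε hε)
    have hyw0 := lie_ne_zero_of_mem_rootSubspace ⟨β, rfl⟩ (neg_mem_range_root ⟨ε, rfl⟩)
      (hsum ▸ neg_mem_range_root ⟨ρ, rfl⟩) hy hy0 (hw.mem ε hε) (hw.ne_zero ε hε)
    rw [hsum] at hyw
    refine extend (neg_mem_range_root ⟨ρ, rfl⟩) hyw hyw0 ?_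
    have h1 := hstab' y (mem_parabolic_of_isPos hβ hy)
    have h2 : killingForm ℂ L x ⁅y, v⁆ = 0 := by
      have hyv := lie_mem_rootSubspace hy hw.mem_theta
      by_cases hmem : (Φ).root β + (Φ).root θ ∈ range (Φ).root
      · obtain ⟨δ, hδ⟩ := hmem
        rw [← hδ] at hyv
        exact hZpos δ (isPos_add hβ hp.isPos_sum hδ) (hp.ne_of_root_eq_add hβ hp.isPos_sum hδ) _ hyv
      · rw [lie_eq_zero_of_notMem_range hy hw.mem_theta
          (root_add_root_ne_zero hβ hp.isPos_sum) hmem, map_zero]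
    rw [h2, add_zero, Finset.sum_eq_single_of_mem ε (hmemE.mpr hε) fun ε' hε' hne => ?_] at h1
    · exact h1
    have hε'' := hmemE.mp hε'
    by_cases hmem : (Φ).root β + -(Φ).root ε' ∈ range (Φ).root
    · obtain ⟨δ, hδ⟩ := hmem
      by_cases hδpos : b.IsPos δ
      · have hβδ : (Φ).root β = (Φ).root δ + (Φ).root ε' := by rw [hδ]; abel
        have hyw' := lie_mem_rootSubspace hy (hw.mem ε' hε'')
        rw [← hδ] at hyw'
        refine hZpos δ hδpos ?_ _ hyw'
        rintro rfl
        exact add_notMem_range_of_mem_cascadeRoots subset_rfl hp.mem_cascade hε'' ⟨β, hβδ⟩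
      · obtain ⟨δ', hδ'⟩ := neg_mem_range_root (H := H) ⟨δ, rfl⟩
        have hδ'pos : b.IsPos δ' := by
          rw [isPos_iff_coeff_nonneg, coeff_neg b hδ']
          simpa using (not_isPos_iff_coeff_nonpos b).mp hδpos
        exact absurd (cascadeRoots_summand_unique subset_rfl hε hε'' hβ hρ hδ'pos
          (by rw [hβε]; abel) (by rw [hδ', hδ]; abel)) hne.symm
    · rw [lie_eq_zero_of_notMem_range hy (hw.mem ε' hε'') (fun h0 => ?_) hmem, map_zero]
      have hβε' : (Φ).root β = (Φ).root ε' := by rwa [← sub_eq_add_neg, sub_eq_zero] at h0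
      refine (cascadeRoots_strongly_orthogonal subset_rfl hε hε'' hne.symm).2.1 ⟨ρ, ?_⟩
      rw [← hβε', hβε]; abel
  -- the component in `L_{-α₁}` vanishes
  have hZ₁ : ∀ z ∈ rootSubspace ((Φ).root α₁), killingForm ℂ L x z = 0 := by
    obtain ⟨y, hy, hy0⟩ := exists_mem_rootSubspace_ne_zero (neg_mem_range_root (H := H) ⟨α₂, rfl⟩)
    have hsum : -(Φ).root α₂ + (Φ).root θ = (Φ).root α₁ := by rw [hp.root_sum]; abel
    have hyv := lie_mem_rootSubspace hy hw.mem_theta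
    have hyv0 := lie_ne_zero_of_mem_rootSubspace (neg_mem_range_root ⟨α₂, rfl⟩) ⟨θ, rfl⟩
      (hsum ▸ ⟨α₁, rfl⟩) hy hy0 hw.mem_theta hw.theta_ne_zero
    rw [hsum] at hyv
    refine extend ⟨α₁, rfl⟩ hyv hyv0 ?_
    have h1 := hstab' y (hp.mem_parabolic_neg (Or.inr (Or.inl rfl)) hy)
    rwa [Finset.sum_eq_zero fun ε hε => ?_, zero_add] at h1
    have hyw := lie_mem_rootSubspace hy (hw.mem ε (hmemE.mp hε))
    rw [← neg_add] at hyw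
    by_cases hmem : (Φ).root α₂ + (Φ).root ε ∈ range (Φ).root
    · obtain ⟨δ, hδ⟩ := hmem
      rw [← hδ] at hyw
      exact hZneg δ (isPos_add hp.isPos₂ (hposE hε) hδ) _ hyw
    · rw [eq_zero_of_mem_rootSubspace (neg_ne_zero.mpr (root_add_root_ne_zero hp.isPos₂ (hposE hε)))
        (fun h => hmem (by simpa only [neg_neg] using neg_mem_range_root h)) hyw, map_zero]
  have hxH : x ∈ H.toSubmodule := by
    refine mem_of_forall_killingForm (H := H) le_rfl ?_
    rintro _ ⟨γ, rfl⟩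
    right
    by_cases hγ : b.IsPos γ
    · exact hZneg γ hγ
    · obtain ⟨γ', hγ'⟩ := neg_mem_range_root (H := H) ⟨γ, rfl⟩
      have hγ'pos : b.IsPos γ' := by
        rw [isPos_iff_coeff_nonneg, coeff_neg b hγ']
        simpa using (not_isPos_iff_coeff_nonpos b).mp hγ
      rw [← hγ']
      by_cases h1 : γ' = α₁
      · rw [h1]; exact hZ₁
      · exact hZpos γ' hγ'pos h1
  refine mem_cascadeAnnihilator_iff.mpr ⟨⟨x, hxH⟩, rfl, fun ε hε => ?_⟩
  have hxH0 : x ∈ rootSubspace (0 : Module.Dual ℂ H) := mem_rootSubspace_zero.mpr hxH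
  obtain ⟨y, hy, hy0⟩ := exists_mem_rootSubspace_ne_zero (H := H) ⟨ε, rfl⟩
  have h1 := hstab' y (mem_parabolic_of_isPos (hposE (hmemE.mpr hε)) hy)
  have h2 : killingForm ℂ L x ⁅y, v⁆ = 0 := by
    refine killingForm_eq_zero_of_mem_rootSubspace hxH0 (lie_mem_rootSubspace hy hw.mem_theta) ?_
    rw [zero_add]
    exact root_add_root_ne_zero (hposE (hmemE.mpr hε)) hp.isPos_sum
  rw [h2, add_zero, Finset.sum_eq_single_of_mem ε (hmemE.mpr hε) fun ε' hε' hne => ?_] at h1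
  · rw [← LieModule.traceForm_apply_lie_apply] at h1
    have h3 : ⁅x, y⁆ = (Φ).root ε ⟨x, hxH⟩ • y := lie_eq_smul_of_mem_rootSubspace ⟨x, hxH⟩ hy
    rw [h3, map_smul, LinearMap.smul_apply, smul_eq_mul] at h1
    exact (mul_eq_zero.mp h1).resolve_right (killingForm_ne_zero_of_mem_rootSubspace ⟨ε, rfl⟩ hy hy0
      (hw.mem ε hε) (hw.ne_zero ε hε))
  · refine killingForm_eq_zero_of_mem_rootSubspace hxH0
      (lie_mem_rootSubspace hy (hw.mem ε' (hmemE.mp hε'))) ?_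
    rw [zero_add, ← sub_eq_add_neg, sub_ne_zero]
    exact fun h => hne ((Φ).root.injective h).symm

end IsCascadePair

end Stabilizer

/-! ### An element of the stabilizer outside of the Cartan subalgebra -/

section Transversal

set_option linter.unusedSectionVars false

open Set

variable {L : Type*} [LieRing L] [LieAlgebra ℂ L] [FiniteDimensional ℂ L] [IsKilling ℂ L]
  {H : LieSubalgebra ℂ L} [H.IsCartanSubalgebra]

local notation "Φ" => IsKilling.rootSystem H

variable {b : (IsKilling.rootSystem H).Base} {α₁ α₂ θ β₂ β₃ : H.root} {ε : Fin 4 → H.root}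
  {w : H.root → L} {v x y : L}

lemma lie_eq_killingForm_smul {α : H.root} (hx : x ∈ rootSubspace ((Φ).root α))
    (hy : y ∈ rootSubspace (-(Φ).root α)) :
    ⁅x, y⁆ = killingForm ℂ L x y • ((IsKilling.cartanEquivDual H).symm ((Φ).root α) : L) :=
  IsKilling.lie_eq_killingForm_smul_of_mem_rootSpace_of_mem_rootSpace_neg hx hy

lemma exists_killingForm_eq {f : Module.Dual ℂ H} (hf : f ∈ range (Φ).root)
    (hx : x ∈ rootSubspace (-f)) (hx0 : x ≠ 0) {c : ℂ} (hc : c ≠ 0) :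
    ∃ y ∈ rootSubspace f, y ≠ 0 ∧ killingForm ℂ L y x = c := by
  obtain ⟨y, hy, hy0⟩ := exists_mem_rootSubspace_ne_zero hf
  have h := killingForm_ne_zero_of_mem_rootSubspace hf hy hy0 hx hx0
  refine ⟨(c / killingForm ℂ L y x) • y, Submodule.smul_mem _ _ hy,
    smul_ne_zero (div_ne_zero hc h) hy0, ?_⟩
  rw [map_smul, LinearMap.smul_apply, smul_eq_mul, div_mul_cancel₀ _ h]

/-- The element `x` is a sum of nonzero vectors of weights `-θ`, `β₂`, `β₃`, `ε₀`, `ε₁`, `ε₂`,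
`ε₃`, `-ε₁`. -/
def IsTransversal (θ β₂ β₃ : H.root) (ε : Fin 4 → H.root) (x : L) : Prop :=
  ∃ (t y₂ y₃ : L) (z : Fin 4 → L) (n : L),
    (t ∈ rootSubspace (-(Φ).root θ) ∧ t ≠ 0) ∧ (y₂ ∈ rootSubspace ((Φ).root β₂) ∧ y₂ ≠ 0) ∧
    (y₃ ∈ rootSubspace ((Φ).root β₃) ∧ y₃ ≠ 0) ∧
    (∀ k, z k ∈ rootSubspace ((Φ).root (ε k)) ∧ z k ≠ 0) ∧
    (n ∈ rootSubspace (-(Φ).root (ε 1)) ∧ n ≠ 0) ∧ x = t + y₂ + y₃ + ∑ k, z k + n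

/-- All the roots attached to the simple roots `α₁`, `α₂`: the cascade roots `ε₀`, `ε₁ = α₁`, `ε₂`,
`ε₃`, the sum `θ = α₁ + α₂`, and `β₂ = ε₀ - θ - ε₂`, `β₃ = ε₀ - θ - ε₃`, which are positive and
long. -/
structure IsCascadeConfiguration (b : (IsKilling.rootSystem H).Base) (α₁ α₂ θ β₂ β₃ : H.root)
    (ε : Fin 4 → H.root) : Prop where
  quadruple : IsCascadeQuadruple b α₁ α₂ ε
  pair : IsCascadePair b α₁ α₂ θ
  isPos₂ : b.IsPos β₂
  isPos₃ : b.IsPos β₃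
  isLong₂ : IsLong (Φ) β₂
  isLong₃ : IsLong (Φ) β₃
  root₂ : (Φ).root β₂ = (Φ).root (ε 0) - (Φ).root θ - (Φ).root (ε 2)
  root₃ : (Φ).root β₃ = (Φ).root (ε 0) - (Φ).root θ - (Φ).root (ε 3)

namespace IsCascadeConfiguration

variable (hc : IsCascadeConfiguration b α₁ α₂ θ β₂ β₃ ε) (hw : IsCascadeFamily b θ w v)

include hc

lemma root_one : (Φ).root (ε 1) = (Φ).root α₁ := by rw [← hc.quadruple.eq_one]

lemma two_smul_root : (Φ).root α₂ + (Φ).root α₂ = (Φ).root (ε 0) - (Φ).root α₁ - (Φ).root (ε 2) -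
    (Φ).root (ε 3) := by
  rw [← two_zsmul, hc.quadruple.relation, hc.root_one]

lemma root₂_sub : (Φ).root β₂ + -(Φ).root (ε 3) = (Φ).root α₂ := by
  have h : (Φ).root (ε 0) = (Φ).root α₂ + (Φ).root α₂ + (Φ).root α₁ + (Φ).root (ε 2) +
      (Φ).root (ε 3) := by rw [hc.two_smul_root]; abel
  rw [hc.root₂, hc.pair.root_sum, h]; abel

lemma root₃_sub : (Φ).root β₃ + -(Φ).root (ε 2) = (Φ).root α₂ := by
  have h : (Φ).root (ε 0) = (Φ).root α₂ + (Φ).root α₂ + (Φ).root α₁ + (Φ).root (ε 2) +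
      (Φ).root (ε 3) := by rw [hc.two_smul_root]; abel
  rw [hc.root₃, hc.pair.root_sum, h]; abel

lemma isTransversal_mem_parabolic (hx : IsTransversal θ β₂ β₃ ε x) :
    x ∈ parabolic b {α₁, α₂} := by
  obtain ⟨t, y₂, y₃, z, n, ⟨ht, -⟩, ⟨hy₂, -⟩, ⟨hy₃, -⟩, hz, ⟨hn, -⟩, rfl⟩ := hx
  have h1 := hc.pair.mem_parabolic_neg (Or.inr (Or.inr rfl)) ht
  have h2 := mem_parabolic_of_isPos (S := {α₁, α₂}) hc.isPos₂ hy₂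
  have h3 := mem_parabolic_of_isPos (S := {α₁, α₂}) hc.isPos₃ hy₃
  have h4 : ∀ k, z k ∈ parabolic b {α₁, α₂} := fun k =>
    mem_parabolic_of_isPos (hc.quadruple.isPos k) (hz k).1
  have h5 := hc.pair.mem_parabolic_neg (Or.inl rfl) (hc.root_one ▸ hn)
  exact add_mem (add_mem (add_mem (add_mem h1 h2) h3) (sum_mem fun k _ => h4 k)) h5

lemma killingForm_theta_ne_zero (hx : IsTransversal θ β₂ β₃ ε x)
    (hv : v ∈ rootSubspace ((Φ).root θ)) (hv0 : v ≠ 0) : killingForm ℂ L x v ≠ 0 := by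
  obtain ⟨t, y₂, y₃, z, n, ⟨ht, ht0⟩, ⟨hy₂, -⟩, ⟨hy₃, -⟩, hz, ⟨hn, -⟩, rfl⟩ := hx
  have hθ := hc.pair.isPos_sum
  simp only [map_add, map_sum, LinearMap.add_apply, LinearMap.sum_apply]
  rw [killingForm_eq_zero_of_mem_rootSubspace hy₂ hv (root_add_root_ne_zero hc.isPos₂ hθ),
    killingForm_eq_zero_of_mem_rootSubspace hy₃ hv (root_add_root_ne_zero hc.isPos₃ hθ),
    Finset.sum_eq_zero fun k _ => killingForm_eq_zero_of_mem_rootSubspace (hz k).1 hv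
      (root_add_root_ne_zero (hc.quadruple.isPos k) hθ),
    killingForm_eq_zero_of_mem_rootSubspace hn hv (fun h0 => ?_), add_zero, add_zero, add_zero,
    add_zero, LieModule.traceForm_comm]
  · exact killingForm_ne_zero_of_mem_rootSubspace ⟨θ, rfl⟩ hv hv0 ht ht0
  · rw [hc.root_one, hc.pair.root_sum] at h0
    simp only [neg_add_cancel_left] at h0
    exact (Φ).ne_zero α₂ h0

lemma killingForm_cartan_eq_zero (hx : IsTransversal θ β₂ β₃ ε x) (hy : y ∈ H) :
    killingForm ℂ L y x = 0 := by
  obtain ⟨t, y₂, y₃, z, n, ⟨ht, ht0⟩, ⟨hy₂, -⟩, ⟨hy₃, -⟩, hz, ⟨hn, -⟩, rfl⟩ := hx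
  have key : ∀ {f : Module.Dual ℂ H} {x : L}, f ∈ range (Φ).root → x ∈ rootSubspace f →
      killingForm ℂ L y x = 0 := fun hf hx =>
    killingForm_eq_zero_of_mem_rootSubspace (mem_rootSubspace_zero.mpr hy) hx
      (by rw [zero_add]; exact root_ne_zero_of_mem_range hf)
  simp only [map_add, map_sum]
  rw [key (neg_mem_range_root ⟨θ, rfl⟩) ht, key ⟨β₂, rfl⟩ hy₂, key ⟨β₃, rfl⟩ hy₃,
    key (neg_mem_range_root ⟨ε 1, rfl⟩) hn, Finset.sum_eq_zero fun k _ => key ⟨ε k, rfl⟩ (hz k).1]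
  simp

lemma lie_eq_zero_of_mem_cascadeAnnihilator (hx : IsTransversal θ β₂ β₃ ε x)
    (hy : y ∈ cascadeAnnihilator (b.support : Set H.root)) : ⁅y, x⁆ = 0 := by
  obtain ⟨h, rfl, hh⟩ := mem_cascadeAnnihilator_iff.mp hy
  obtain ⟨t, y₂, y₃, z, n, ⟨ht, ht0⟩, ⟨hy₂, -⟩, ⟨hy₃, -⟩, hz, ⟨hn, -⟩, rfl⟩ := hx
  have hε : ∀ k, (Φ).root (ε k) h = 0 := fun k => hh _ (hc.quadruple.mem k)
  have hα₂ : (Φ).root α₂ h = 0 := by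
    have := congrArg (fun f : Module.Dual ℂ H => f h) hc.two_smul_root
    simp only [LinearMap.add_apply, LinearMap.sub_apply, ← hc.root_one, hε] at this
    simpa using this
  have hθ : (Φ).root θ h = 0 := by
    rw [hc.pair.root_sum, LinearMap.add_apply, hα₂, ← hc.root_one, hε, add_zero]
  have hβ₂ : (Φ).root β₂ h = 0 := by
    rw [hc.root₂, LinearMap.sub_apply, LinearMap.sub_apply, hθ, hε, hε, sub_zero, sub_zero]
  have hβ₃ : (Φ).root β₃ h = 0 := by
    rw [hc.root₃, LinearMap.sub_apply, LinearMap.sub_apply, hθ, hε, hε, sub_zero, sub_zero]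
  simp only [lie_add, lie_sum]
  rw [lie_eq_smul_of_mem_rootSubspace h ht, lie_eq_smul_of_mem_rootSubspace h hy₂,
    lie_eq_smul_of_mem_rootSubspace h hy₃, lie_eq_smul_of_mem_rootSubspace h hn,
    Finset.sum_eq_zero fun k _ => by
      rw [lie_eq_smul_of_mem_rootSubspace h (hz k).1, hε, zero_smul]]
  rw [LinearMap.neg_apply, LinearMap.neg_apply, hθ, hβ₂, hβ₃, hε]
  simp

omit hc in
lemma killingForm_eq_zero_of_lie_eq_smul {h x y : L} {c d : ℂ} (hx : ⁅h, x⁆ = c • x)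
    (hy : ⁅h, y⁆ = d • y) (hcd : c + d ≠ 0) : killingForm ℂ L x y = 0 := by
  have h1 : killingForm ℂ L ⁅x, h⁆ y = killingForm ℂ L x ⁅h, y⁆ :=
    LieModule.traceForm_apply_lie_apply ..
  rw [← lie_skew, hx, hy, map_neg, LinearMap.neg_apply, map_smul, map_smul, LinearMap.smul_apply,
    smul_eq_mul, smul_eq_mul] at h1
  refine (mul_eq_zero.mp ?_).resolve_left hcd
  linear_combination -h1

/-- For the grading by the coroot of `ε₁`, the element `x` has its components in degrees `-1`, `0`,
`2`, `-2`. The component of degree `0` is isotropic, so `κ(x, x)` is twice the pairing of the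
components of weights `ε₁` and `-ε₁`. -/
lemma killingForm_self_ne_zero (hx : IsTransversal θ β₂ β₃ ε x) : killingForm ℂ L x x ≠ 0 := by
  obtain ⟨t, y₂, y₃, z, n, ⟨ht, ht0⟩, ⟨hy₂, -⟩, ⟨hy₃, -⟩, hz, ⟨hn, hn0⟩, rfl⟩ := hx
  -- grade by the coroot of `ε₁`
  set h : H := (Φ).coroot (ε 1)
  have hpair : ∀ γ m, (Φ).pairingIn ℤ γ (ε 1) = m → (Φ).root γ h = (m : ℂ) := fun γ m hm => by
    rw [root_apply_coroot_eq_pairing, ← (Φ).algebraMap_pairingIn ℤ, hm]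
    rfl
  obtain ⟨-, h1, -, -⟩ := hc.quadruple.pairingIn_sum hc.pair.root_sum
  have hθ := hpair _ _ h1
  have hε : ∀ k ≠ 1, (Φ).root (ε k) h = 0 := fun k hk => by
    rw [hpair _ _ (hc.quadruple.pairingIn_ne hk), Int.cast_zero]
  have hε1 := hpair _ _ (hc.quadruple.pairingIn_self 1)
  have hβ₂ : (Φ).root β₂ h = -1 := by
    rw [hc.root₂, LinearMap.sub_apply, LinearMap.sub_apply, hθ, hε _ (by decide),
      hε _ (by decide)]; norm_num
  have hβ₃ : (Φ).root β₃ h = -1 := by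
    rw [hc.root₃, LinearMap.sub_apply, LinearMap.sub_apply, hθ, hε _ (by decide),
      hε _ (by decide)]; norm_num
  have e₁ : ⁅(h : L), t + y₂ + y₃⁆ = (-1 : ℂ) • (t + y₂ + y₃) := by
    rw [lie_add, lie_add, lie_eq_smul_of_mem_rootSubspace h ht,
      lie_eq_smul_of_mem_rootSubspace h hy₂, lie_eq_smul_of_mem_rootSubspace h hy₃,
      LinearMap.neg_apply, hθ, hβ₂, hβ₃]
    push_cast
    module
  have e₂ : ⁅(h : L), z 0 + z 2 + z 3⁆ = (0 : ℂ) • (z 0 + z 2 + z 3) := by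
    rw [lie_add, lie_add, lie_eq_smul_of_mem_rootSubspace h (hz 0).1,
      lie_eq_smul_of_mem_rootSubspace h (hz 2).1, lie_eq_smul_of_mem_rootSubspace h (hz 3).1,
      hε _ (by decide), hε _ (by decide), hε _ (by decide)]
    module
  have e₃ : ⁅(h : L), z 1⁆ = (2 : ℂ) • z 1 := by
    rw [lie_eq_smul_of_mem_rootSubspace h (hz 1).1, hε1]
    norm_num
  have e₄ : ⁅(h : L), n⁆ = (-2 : ℂ) • n := by
    rw [lie_eq_smul_of_mem_rootSubspace h hn, LinearMap.neg_apply, hε1]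
    norm_num
  have k₀ : ∀ k l, killingForm ℂ L (z k) (z l) = 0 := fun k l =>
    killingForm_eq_zero_of_mem_rootSubspace (hz k).1 (hz l).1
      (root_add_root_ne_zero (hc.quadruple.isPos k) (hc.quadruple.isPos l))
  have k₁ : killingForm ℂ L (z 0 + z 2 + z 3) (z 0 + z 2 + z 3) = 0 := by
    simp only [map_add, LinearMap.add_apply, k₀, add_zero]
  have k₂ := killingForm_ne_zero_of_mem_rootSubspace ⟨ε 1, rfl⟩ (hz 1).1 (hz 1).2 hn hn0
  have hsum : t + y₂ + y₃ + ∑ k, z k + n = (t + y₂ + y₃) + (z 0 + z 2 + z 3) + z 1 + n := by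
    rw [Fin.sum_univ_four]; abel
  rw [hsum]
  generalize t + y₂ + y₃ = p at e₁
  generalize z 0 + z 2 + z 3 = q at e₂ k₁
  have kz {x y : L} {c d : ℂ} (hx : ⁅(h : L), x⁆ = c • x) (hy : ⁅(h : L), y⁆ = d • y)
    (hcd : c + d ≠ 0) : killingForm ℂ L x y = 0 := killingForm_eq_zero_of_lie_eq_smul hx hy hcd
  simp only [map_add, LinearMap.add_apply, k₁, kz e₁ e₁ (by norm_num), kz e₁ e₂ (by norm_num),
    kz e₁ e₃ (by norm_num), kz e₁ e₄ (by norm_num), kz e₂ e₁ (by norm_num),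
    kz e₂ e₃ (by norm_num), kz e₂ e₄ (by norm_num), kz e₃ e₁ (by norm_num),
    kz e₃ e₂ (by norm_num), kz e₃ e₃ (by norm_num), kz e₄ e₁ (by norm_num),
    kz e₄ e₂ (by norm_num), kz e₄ e₄ (by norm_num), zero_add, add_zero]
  rw [LieModule.traceForm_comm ℂ L L n, ← two_mul]
  exact mul_ne_zero two_ne_zero k₂

include hw

open Classical in
/-- Every nonzero `t ∈ L_{-θ}` is the component of weight `-θ` of a transversal element of the
stabilizer. With `u = ∑ w ε + v`, the bracket `[t, u]` has components of weights `-θ - ε₂`,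
`-θ - ε₃` and `0`. The first two are cancelled by `[y₂, w ε₀]` and `[y₃, w ε₀]`; this creates a
term of weight `α₂`, which `[n, v]` cancels; and the component in `H` is cancelled by the brackets
`[zₖ, w εₖ]`, since `2 θ = ε₀ + ε₁ - ε₂ - ε₃`. What is left are the brackets `[z₂, v]` and
`[z₃, v]`, which lie in the nilradical. -/
theorem exists_isTransversal {t : L} (ht : t ∈ rootSubspace (-(Φ).root θ)) (ht0 : t ≠ 0) :
    ∃ (y₂ y₃ : L) (z : Fin 4 → L) (n : L),
      (y₂ ∈ rootSubspace ((Φ).root β₂) ∧ y₂ ≠ 0) ∧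
      (y₃ ∈ rootSubspace ((Φ).root β₃) ∧ y₃ ≠ 0) ∧
      (∀ k, z k ∈ rootSubspace ((Φ).root (ε k)) ∧ z k ≠ 0) ∧
      (n ∈ rootSubspace (-(Φ).root (ε 1)) ∧ n ≠ 0) ∧
      ∀ y ∈ parabolic b {α₁, α₂},
        killingForm ℂ L (t + y₂ + y₃ + ∑ k, z k + n) ⁅y, cascadeSum b w v⁆ = 0 := by
  have hm : ∀ k, w (ε k) ∈ rootSubspace (-(Φ).root (ε k)) := fun k =>
    hw.mem _ (hc.quadruple.mem k)
  have hm0 : ∀ k, w (ε k) ≠ 0 := fun k => hw.ne_zero _ (hc.quadruple.mem k)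
  have hεr : ∀ k, (Φ).root (ε k) ∈ range (Φ).root := fun k => ⟨ε k, rfl⟩
  have hεn : ∀ k, -(Φ).root (ε k) ∈ range (Φ).root := fun k => neg_mem_range_root (hεr k)
  have hθn : -(Φ).root θ ∈ range (Φ).root := neg_mem_range_root ⟨θ, rfl⟩
  have hsum := hc.pair.root_sum
  have hθpos := hc.pair.isPos_sum
  obtain ⟨-, γ₂, -, hγ₂pos, -, hγ₂, -⟩ := hc.quadruple.exists_beta hsum hθpos
  obtain ⟨-, γ₃, -, hγ₃pos, -, hγ₃, -⟩ := hc.quadruple.swap.exists_beta hsum hθpos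
  replace hγ₃ : (Φ).root γ₃ = (Φ).root θ + (Φ).root (ε 3) := hγ₃
  -- the brackets `[t, w ε₂]` and `[t, w ε₃]`
  have r₂ : -(Φ).root θ + -(Φ).root (ε 2) = -(Φ).root (ε 0) + (Φ).root β₂ := by
    rw [hc.root₂]; abel
  have r₃ : -(Φ).root θ + -(Φ).root (ε 3) = -(Φ).root (ε 0) + (Φ).root β₃ := by
    rw [hc.root₃]; abel
  have r₂' : -(Φ).root θ + -(Φ).root (ε 2) ∈ range (Φ).root := by
    rw [← neg_add, ← hγ₂]
    exact neg_mem_range_root ⟨γ₂, rfl⟩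
  have r₃' : -(Φ).root θ + -(Φ).root (ε 3) ∈ range (Φ).root := by
    rw [← neg_add, ← hγ₃]
    exact neg_mem_range_root ⟨γ₃, rfl⟩
  have htw₂ := lie_mem_rootSubspace ht (hm 2)
  have htw₃ := lie_mem_rootSubspace ht (hm 3)
  have htw₂0 := lie_ne_zero_of_mem_rootSubspace hθn (hεn 2) r₂' ht ht0 (hm 2) (hm0 2)
  have htw₃0 := lie_ne_zero_of_mem_rootSubspace hθn (hεn 3) r₃' ht ht0 (hm 3) (hm0 3)
  -- `y₂` and `y₃` compensate for them
  obtain ⟨y₂, hy₂, hy₂e⟩ := exists_lie_eq_of_mem_rootSubspace (hεn 0) ⟨β₂, rfl⟩ (r₂ ▸ r₂') (hm 0)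
    (hm0 0) (r₂ ▸ htw₂)
  obtain ⟨y₃, hy₃, hy₃e⟩ := exists_lie_eq_of_mem_rootSubspace (hεn 0) ⟨β₃, rfl⟩ (r₃ ▸ r₃') (hm 0)
    (hm0 0) (r₃ ▸ htw₃)
  have hy₂0 : y₂ ≠ 0 := by
    rintro rfl
    exact htw₂0 (by rw [← hy₂e, lie_zero])
  have hy₃0 : y₃ ≠ 0 := by
    rintro rfl
    exact htw₃0 (by rw [← hy₃e, lie_zero])
  -- the component of weight `α₂`
  have hyw₂ := lie_mem_rootSubspace hy₂ (hm 3)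
  have hyw₃ := lie_mem_rootSubspace hy₃ (hm 2)
  rw [hc.root₂_sub] at hyw₂
  rw [hc.root₃_sub] at hyw₃
  have hww : ∀ k l, ⁅w (ε k), w (ε l)⁆ = 0 := fun k l => by
    refine lie_eq_zero_of_notMem_range (hm k) (hm l) ?_ fun h => ?_
    · rw [← neg_add, neg_ne_zero]
      exact root_add_root_ne_zero (hc.quadruple.isPos k) (hc.quadruple.isPos l)
    · refine add_notMem_range_of_mem_cascadeRoots subset_rfl (hc.quadruple.mem k)
        (hc.quadruple.mem l) ?_
      simpa only [← neg_add, neg_neg] using neg_mem_range_root h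
  -- it does not vanish: its bracket with `w ε₀` is `2 [[t, w ε₂], w ε₃]`
  have hne : ⁅y₂, w (ε 3)⁆ + ⁅y₃, w (ε 2)⁆ ≠ 0 := by
    intro h0
    have h1 : ⁅w (ε 0), ⁅y₂, w (ε 3)⁆ + ⁅y₃, w (ε 2)⁆⁆ = (2 : ℂ) • ⁅⁅t, w (ε 2)⁆, w (ε 3)⁆ := by
      rw [lie_add, leibniz_lie (w (ε 0)) y₂, leibniz_lie (w (ε 0)) y₃, hy₂e, hy₃e, hww, hww,
        lie_zero, lie_zero, add_zero, add_zero, lie_lie t (w (ε 3)), hww, lie_zero, zero_sub,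
        lie_skew, two_smul]
    have r₄ : -(Φ).root θ + -(Φ).root (ε 2) + -(Φ).root (ε 3) ∈ range (Φ).root := by
      have : -(Φ).root θ + -(Φ).root (ε 2) + -(Φ).root (ε 3) = (Φ).root α₂ - (Φ).root (ε 0) := by
        rw [← hc.root₂_sub, hc.root₂]; abel
      rw [this]
      have h2 := hc.quadruple.two_mul_pairingIn (ε 0)
      have h3 := hc.quadruple.two_mul_pairingIn (ε 1)
      rw [hc.quadruple.pairingIn_self, hc.quadruple.pairingIn_ne (by decide),
        hc.quadruple.pairingIn_ne (by decide), hc.quadruple.pairingIn_ne (by decide)] at h2 h3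
      refine (Φ).root_sub_root_mem_of_pairingIn_pos (by omega) ?_
      rintro rfl
      rw [hc.quadruple.pairingIn_ne (by decide)] at h3
      omega
    rw [h0, lie_zero] at h1
    refine (smul_ne_zero (two_ne_zero (α := ℂ)) ?_) h1.symm
    exact lie_ne_zero_of_mem_rootSubspace r₂' (hεn 3) r₄ htw₂ htw₂0 (hm 3) (hm0 3)
  have r₅ : (Φ).root θ + -(Φ).root (ε 1) = (Φ).root α₂ := by rw [hsum, hc.root_one]; abel
  obtain ⟨n, hn, hne'⟩ := exists_lie_eq_of_mem_rootSubspace ⟨θ, rfl⟩ (hεn 1) (r₅ ▸ ⟨α₂, rfl⟩)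
    hw.mem_theta hw.theta_ne_zero (r₅ ▸ add_mem hyw₂ hyw₃)
  have hn0 : n ≠ 0 := by
    rintro rfl
    exact hne (by rw [← hne', lie_zero])
  -- the component in `H`
  have hκ := killingForm_ne_zero_of_mem_rootSubspace ⟨θ, rfl⟩ hw.mem_theta hw.theta_ne_zero ht ht0
  set κ := killingForm ℂ L v t
  have hs0 : ∀ k, ![κ / 2, κ / 2, -(κ / 2), -(κ / 2)] k ≠ 0 := by
    intro k
    fin_cases k <;> simpa using hκ
  choose z hz hz0 hzκ using fun k => exists_killingForm_eq (hεr k) (hm k) (hm0 k) (hs0 k)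
  have hHcomp : ⁅t, v⁆ + ∑ k, ⁅z k, w (ε k)⁆ = 0 := by
    have h1 : ⁅t, v⁆ = -(κ • ((IsKilling.cartanEquivDual H).symm ((Φ).root θ) : L)) := by
      rw [← lie_skew, lie_eq_killingForm_smul hw.mem_theta ht]
    have h2 : (Φ).root θ + (Φ).root θ =
        (Φ).root (ε 0) + (Φ).root (ε 1) - (Φ).root (ε 2) - (Φ).root (ε 3) := by
      have : (Φ).root θ + (Φ).root θ = (Φ).root α₁ + (Φ).root α₁ + ((Φ).root α₂ + (Φ).root α₂) := by
        rw [hsum]; abel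
      rw [this, hc.two_smul_root, hc.root_one]; abel
    have h3 := congrArg (fun f => ((IsKilling.cartanEquivDual H).symm f : L)) h2
    simp only [map_add, map_sub] at h3
    push_cast at h3
    rw [h1, Fin.sum_univ_four]
    simp only [lie_eq_killingForm_smul (hz _) (hm _), hzκ]
    simp only [Matrix.cons_val_zero, Matrix.cons_val_one, Matrix.cons_val]
    linear_combination (norm := module) (-(κ / 2)) • h3
  refine ⟨y₂, y₃, z, n, ⟨hy₂, hy₂0⟩, ⟨hy₃, hy₃0⟩, fun k => ⟨hz k, hz0 k⟩, ⟨hn, hn0⟩, ?_⟩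
  have hzero : ∀ {f : Module.Dual ℂ H} {y : L} {δ : H.root}, y ∈ rootSubspace f →
      δ ∈ cascadeRoots (b.support : Set H.root) → f - (Φ).root δ ≠ 0 →
      f - (Φ).root δ ∉ range (Φ).root → ⁅y, w δ⁆ = 0 := fun hy hδ h0 h =>
    lie_eq_zero_of_notMem_range hy (hw.mem _ hδ) (by rwa [← sub_eq_add_neg])
      (by rwa [← sub_eq_add_neg])
  have hsum₂ : ∀ (y : L) (k l : Fin 4), k ≠ l →
      (∀ δ ∈ cascadeRoots (b.support : Set H.root), δ ≠ ε k → δ ≠ ε l → ⁅y, w δ⁆ = 0) →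
      ∑ δ : H.root with δ ∈ cascadeRoots (b.support : Set H.root), ⁅y, w δ⁆ =
        ⁅y, w (ε k)⁆ + ⁅y, w (ε l)⁆ := fun y k l hkl h =>
    Finset.sum_eq_add_of_mem _ _ (by simpa using hc.quadruple.mem k)
      (by simpa using hc.quadruple.mem l) (hc.quadruple.injective.ne hkl)
      fun δ hδ hne => h δ (by simpa using hδ) hne.1 hne.2
  have ht' : ⁅t, cascadeSum b w v⁆ = ⁅t, w (ε 2)⁆ + ⁅t, w (ε 3)⁆ + ⁅t, v⁆ := by
    rw [lie_cascadeSum, hsum₂ t 2 3 (by decide) fun δ hδ h2 h3 => ?_]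
    refine hzero ht hδ ?_ fun h => hc.quadruple.sum_add_notMem hsum hδ h2 h3 ?_
    · rw [← neg_add', neg_ne_zero]
      exact root_add_root_ne_zero hθpos (isPos_of_mem_cascadeRoots subset_rfl hδ)
    · simpa only [← neg_add', neg_neg] using neg_mem_range_root h
  have hyv : ∀ {β : H.root} {y : L} (k l : Fin 4), k ≠ l → b.IsPos β →
      (Φ).root β = (Φ).root (ε k) - (Φ).root θ - (Φ).root (ε l) →
      y ∈ rootSubspace ((Φ).root β) → ⁅y, v⁆ = 0 := by
    intro β y k l hkl hβ hroot hy
    refine lie_eq_zero_of_notMem_range hy hw.mem_theta (root_add_root_ne_zero hβ hθpos) ?_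
    have : (Φ).root β + (Φ).root θ = (Φ).root (ε k) - (Φ).root (ε l) := by rw [hroot]; abel
    rw [this]
    exact (cascadeRoots_strongly_orthogonal subset_rfl (hc.quadruple.mem k) (hc.quadruple.mem l)
      (hc.quadruple.injective.ne hkl)).2.1
  have hy₂' : ⁅y₂, cascadeSum b w v⁆ = ⁅y₂, w (ε 0)⁆ + ⁅y₂, w (ε 3)⁆ := by
    rw [lie_cascadeSum, hyv 0 2 (by decide) hc.isPos₂ hc.root₂ hy₂, add_zero,
      hsum₂ y₂ 0 3 (by decide) fun δ hδ h0 h3 => ?_]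
    obtain ⟨h4, h5⟩ := hc.quadruple.beta_sub_notMem hsum hc.isLong₂ hc.root₂ hδ h0 h3
    exact hzero hy₂ hδ h4 h5
  have hy₃' : ⁅y₃, cascadeSum b w v⁆ = ⁅y₃, w (ε 0)⁆ + ⁅y₃, w (ε 2)⁆ := by
    rw [lie_cascadeSum, hyv 0 3 (by decide) hc.isPos₃ hc.root₃ hy₃, add_zero,
      hsum₂ y₃ 0 2 (by decide) fun δ hδ h0 h2 => ?_]
    obtain ⟨h4, h5⟩ := hc.quadruple.swap.beta_sub_notMem hsum hc.isLong₃ hc.root₃ hδ h0 h2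
    exact hzero hy₃ hδ h4 h5
  have hz' : ∀ k, ⁅z k, cascadeSum b w v⁆ = ⁅z k, w (ε k)⁆ + ⁅z k, v⁆ := fun k => by
    rw [lie_cascadeSum, Finset.sum_eq_single_of_mem (ε k) (by simpa using hc.quadruple.mem k)
      fun δ hδ hne => ?_]
    have hδ : δ ∈ cascadeRoots (b.support : Set H.root) := by simpa using hδ
    refine hzero (hz k) hδ (fun h => hne ((Φ).root.injective (sub_eq_zero.mp h)).symm) ?_
    exact (cascadeRoots_strongly_orthogonal subset_rfl (hc.quadruple.mem k) hδ hne.symm).2.1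
  have hzv : ∀ k, k ≠ 2 → k ≠ 3 → ⁅z k, v⁆ = 0 := fun k h2 h3 => by
    refine lie_eq_zero_of_notMem_range (hz k) hw.mem_theta
      (root_add_root_ne_zero (hc.quadruple.isPos k) hθpos) ?_
    rw [add_comm]
    exact hc.quadruple.sum_add_notMem hsum (hc.quadruple.mem k) (hc.quadruple.injective.ne h2)
      (hc.quadruple.injective.ne h3)
  have hn' : ⁅n, cascadeSum b w v⁆ = ⁅n, v⁆ := by
    rw [lie_cascadeSum, Finset.sum_eq_zero fun δ hδ => ?_, zero_add]
    have hδ : δ ∈ cascadeRoots (b.support : Set H.root) := by simpa using hδ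
    refine hzero hn hδ ?_ fun h => add_notMem_range_of_mem_cascadeRoots subset_rfl
      (hc.quadruple.mem 1) hδ ?_
    · rw [← neg_add', neg_ne_zero]
      exact root_add_root_ne_zero (hc.quadruple.isPos 1) (isPos_of_mem_cascadeRoots subset_rfl hδ)
    · simpa only [← neg_add', neg_neg] using neg_mem_range_root h
  -- everything cancels, up to two terms in the nilradical
  have hX : ⁅t + y₂ + y₃ + ∑ k, z k + n, cascadeSum b w v⁆ = ⁅z 2, v⁆ + ⁅z 3, v⁆ := by
    refine Eq.trans ?_ (zero_add _)
    rw [← hHcomp, Fin.sum_univ_four, Fin.sum_univ_four]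
    simp only [add_lie, ht', hy₂', hy₃', hz', hn', hzv 0 (by decide) (by decide),
      hzv 1 (by decide) (by decide), add_zero]
    rw [← lie_skew y₂ (w (ε 0)), hy₂e, ← lie_skew y₃ (w (ε 0)), hy₃e, ← lie_skew n v, hne']
    abel
  have hnil : ∀ {γ δ : H.root} {z : L}, b.IsPos δ → (Φ).root γ = (Φ).root θ + (Φ).root δ →
      z ∈ rootSubspace ((Φ).root δ) → ∀ y ∈ parabolic b {α₁, α₂}, killingForm ℂ L y ⁅z, v⁆ = 0 := by
    intro γ δ z hδ hγ hz y hy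
    have hmem := lie_mem_rootSubspace hz hw.mem_theta
    rw [add_comm, ← hγ] at hmem
    refine killingForm_eq_zero_of_mem_parabolic hc.pair.subset hy
      ((isNilradicalRoot_or_supportedIn (isPos_add hθpos hδ hγ)).resolve_right fun hs => ?_) hmem
    rcases hc.pair.eq_of_supportedIn γ (isPos_add hθpos hδ hγ) hs with rfl | rfl | rfl
    · refine root_add_root_ne_zero hc.pair.isPos₂ hδ ?_
      rwa [hsum, add_assoc, left_eq_add] at hγ
    · refine root_add_root_ne_zero hc.pair.isPos₁ hδ ?_
      rwa [hsum, add_assoc, add_left_comm, left_eq_add] at hγ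
    · exact (Φ).ne_zero δ (by rwa [left_eq_add] at hγ)
  intro y hy
  rw [← lie_skew, map_neg, ← LieModule.traceForm_apply_lie_apply, hX, LieModule.traceForm_comm,
    map_add, hnil (hc.quadruple.isPos 2) hγ₂ (hz 2) y hy,
    hnil (hc.quadruple.isPos 3) hγ₃ (hz 3) y hy, add_zero, neg_zero]

end IsCascadeConfiguration

end Transversal

/-! ### Semisimplicity of the transversal elements of the stabilizer -/

section Jordan

set_option linter.unusedSectionVars false

open Set

variable {L : Type*} [LieRing L] [LieAlgebra ℂ L] [FiniteDimensional ℂ L] [IsKilling ℂ L]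

/-- The Jordan decomposition of an element `x`: the nilpotent part of `ad x` is inner. -/
lemma exists_ad_mem_adjoin (x : L) : ∃ y : L,
    ad ℂ L y ∈ Algebra.adjoin ℂ {ad ℂ L x} ∧ IsNilpotent (ad ℂ L y) ∧
      (ad ℂ L (x - y)).IsSemisimple := by
  obtain ⟨N, hN₀, S, hS₀, hN, hS, hSN⟩ := (ad ℂ L x).exists_isNilpotent_isSemisimple
  replace hS₀ : Commute (ad ℂ L x) S := Algebra.commute_of_mem_adjoin_self hS₀
  have hN' := hN
  rw [eq_sub_of_add_eq hSN.symm] at hN'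
  have aux {μ : ℂ} {y : L} (hy : y ∈ (ad ℂ L x).maxGenEigenspace μ) : S y = μ • y := by
    rw [Module.End.maxGenEigenspace_eq] at hy
    exact Module.End.apply_eq_of_mem_of_comm_of_isFinitelySemisimple_of_isNil hy hS₀
      hS.isFinitelySemisimple hN'
  have hder₀ {y z : L} {μ ν : ℂ} (hy : y ∈ (ad ℂ L x).maxGenEigenspace μ)
      (hz : z ∈ (ad ℂ L x).maxGenEigenspace ν) : S ⁅y, z⁆ = ⁅S y, z⁆ + ⁅y, S z⁆ := by
    have hyz : ⁅y, z⁆ ∈ (ad ℂ L x).maxGenEigenspace (μ + ν) := lie_mem_maxGenEigenspace_toEnd hy hz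
    rw [aux hy, aux hz, aux hyz, smul_lie, lie_smul, ← add_smul]
  have hder (y z : L) : S ⁅y, z⁆ = ⁅S y, z⁆ + ⁅y, S z⁆ := by
    have htop (y : L) : y ∈ ⨆ μ, (ad ℂ L x).maxGenEigenspace μ := by
      rw [Module.End.iSup_maxGenEigenspace_eq_top]
      trivial
    refine Submodule.iSup_induction _ (motive := fun y => S ⁅y, z⁆ = ⁅S y, z⁆ + ⁅y, S z⁆) (htop y)
      (fun μ y hy => ?_) (by simp) fun y y' h h' => by
        simp only [add_lie, map_add, h, h']; abel
    exact Submodule.iSup_induction _ (motive := fun z => S ⁅y, z⁆ = ⁅S y, z⁆ + ⁅y, S z⁆) (htop z)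
      (fun ν z hz => hder₀ hy hz) (by simp) fun z z' h h' => by
        simp only [lie_add, map_add, h, h']; abel
  let D : LieDerivation ℂ L L := ⟨S, fun y z => by
    rw [hder, ← lie_skew (S y) z]; abel⟩
  obtain ⟨s, hs⟩ := LieDerivation.IsKilling.exists_eq_ad D
  have hs' : ad ℂ L s = S := by rw [← LieDerivation.coe_ad_apply_eq_ad_apply s, hs]
  have hy : ad ℂ L (x - s) = N := by rw [map_sub, hs', hSN, add_sub_cancel_right]
  exact ⟨x - s, hy ▸ hN₀, hy ▸ hN, by rwa [sub_sub_cancel, hs']⟩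

/-- If `x` stabilizes the restriction of `κ(u, ·)` to a subalgebra `p`, then so does the nilpotent
part of `x`, provided that it belongs to `p`. -/
lemma killingForm_eq_zero_of_ad_mem_adjoin {p : LieSubalgebra ℂ L} {x y u : L}
    (hx : x ∈ stabilizerIn p u) (hy : ad ℂ L y ∈ Algebra.adjoin ℂ {ad ℂ L x})
    (hnil : IsNilpotent (ad ℂ L y)) :
    (∀ z ∈ p, ⁅y, z⁆ ∈ p) ∧ ∀ z ∈ p, killingForm ℂ L y ⁅z, u⁆ = 0 := by
  obtain ⟨hxp, hstab⟩ := mem_stabilizerIn_iff.mp hx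
  -- elements of the algebra generated by `ad x` act on the form by scalars
  have key : ∀ T ∈ Algebra.adjoin ℂ {ad ℂ L x}, (∀ z ∈ p, T z ∈ p) ∧
      ∃ c : ℂ, ∀ z ∈ p, killingForm ℂ L u (T z) = c * killingForm ℂ L u z := by
    intro T hT
    induction hT using Algebra.adjoin_induction with
    | mem T hT =>
      rw [mem_singleton_iff] at hT
      subst hT
      refine ⟨fun z hz => p.lie_mem hxp hz, 0, fun z hz => ?_⟩
      rw [zero_mul, ad_apply, LieModule.traceForm_comm, LieModule.traceForm_apply_lie_apply]
      exact hstab z hz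
    | algebraMap c =>
      refine ⟨fun z hz => ?_, c, fun z hz => ?_⟩
      · rw [Module.algebraMap_end_apply]
        exact p.smul_mem c hz
      · rw [Module.algebraMap_end_apply, map_smul, smul_eq_mul]
    | add T T' _ _ h h' =>
      obtain ⟨h1, c, hc⟩ := h
      obtain ⟨h1', c', hc'⟩ := h'
      refine ⟨fun z hz => p.add_mem (h1 z hz) (h1' z hz), c + c', fun z hz => ?_⟩
      rw [LinearMap.add_apply, map_add, hc z hz, hc' z hz, add_mul]
    | mul T T' _ _ h h' =>
      obtain ⟨h1, c, hc⟩ := h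
      obtain ⟨h1', c', hc'⟩ := h'
      refine ⟨fun z hz => h1 _ (h1' z hz), c * c', fun z hz => ?_⟩
      rw [Module.End.mul_apply, hc _ (h1' z hz), hc' z hz, mul_assoc]
  obtain ⟨h1, c, hc⟩ := key _ hy
  refine ⟨h1, fun z hz => ?_⟩
  rw [← LieModule.traceForm_apply_lie_apply, LieModule.traceForm_comm, ← ad_apply (R := ℂ), hc z hz]
  obtain ⟨k, hk⟩ := hnil
  have hpow : ∀ k, (((ad ℂ L y) ^ k) z ∈ p) ∧
      killingForm ℂ L u (((ad ℂ L y) ^ k) z) = c ^ k * killingForm ℂ L u z := by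
    intro k
    induction k with
    | zero => simpa using hz
    | succ k ih =>
      rw [pow_succ', Module.End.mul_apply, hc _ ih.1, ih.2, pow_succ', mul_assoc]
      exact ⟨h1 _ ih.1, rfl⟩
  have h2 := (hpow k).2
  rw [hk, LinearMap.zero_apply, map_zero] at h2
  rcases mul_eq_zero.mp h2.symm with h3 | h3
  · rw [eq_zero_of_pow_eq_zero h3, zero_mul]
  · rw [h3, mul_zero]

/-- The product of `ad y` and `ad x` is nilpotent, because they commute. -/
lemma killingForm_eq_zero_of_ad_mem_adjoin_self {x y : L}
    (hy : ad ℂ L y ∈ Algebra.adjoin ℂ {ad ℂ L x}) (hnil : IsNilpotent (ad ℂ L y)) :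
    killingForm ℂ L y x = 0 := by
  have hcomm : Commute (ad ℂ L y) (ad ℂ L x) := (Algebra.commute_of_mem_adjoin_self hy).symm
  exact (LinearMap.isNilpotent_trace_of_isNilpotent (hcomm.isNilpotent_mul_right hnil)).eq_zero

end Jordan

section Semisimple

set_option linter.unusedSectionVars false

open Set

variable {L : Type*} [LieRing L] [LieAlgebra ℂ L] [FiniteDimensional ℂ L] [IsKilling ℂ L]
  {H : LieSubalgebra ℂ L} [H.IsCartanSubalgebra]

local notation "Φ" => IsKilling.rootSystem H

variable {b : (IsKilling.rootSystem H).Base} {α₁ α₂ θ β₂ β₃ : H.root} {ε : Fin 4 → H.root}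
  {w : H.root → L} {v x y : L}

/-- A parabolic subalgebra is its own normalizer. -/
lemma mem_parabolic_of_forall_lie_mem {S : Set H.root} (hS : S ⊆ b.support)
    (h : ∀ z ∈ parabolic b S, ⁅y, z⁆ ∈ parabolic b S) : y ∈ parabolic b S := by
  refine mem_parabolic_of_forall_killingForm fun γ hγ z hz => ?_
  have h1 := killingForm_eq_zero_of_mem_parabolic hS
    (h ((Φ).coroot γ : H) (mem_parabolic_of_mem_cartan ((Φ).coroot γ).2)) hγ hz
  rw [LieModule.traceForm_apply_lie_apply, lie_eq_smul_of_mem_rootSubspace _ hz,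
    root_apply_coroot_eq_pairing, RootPairing.pairing_same, map_smul, smul_eq_mul] at h1
  exact (mul_eq_zero.mp h1).resolve_left two_ne_zero

namespace IsCascadeConfiguration

variable (hc : IsCascadeConfiguration b α₁ α₂ θ β₂ β₃ ε) (hw : IsCascadeFamily b θ w v)

include hc hw

/-- Modulo `x`, an element of the stabilizer has no component of weight `-θ`. -/
lemma exists_sub_smul_mem (hx : IsTransversal θ β₂ β₃ ε x)
    (hxs : x ∈ stabilizerIn (parabolic b {α₁, α₂}) (cascadeSum b w v))
    (hy : y ∈ stabilizerIn (parabolic b {α₁, α₂}) (cascadeSum b w v)) :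
    ∃ c : ℂ, y - c • x ∈ cascadeAnnihilator (b.support : Set H.root) := by
  have h0 := hc.killingForm_theta_ne_zero hx hw.mem_theta hw.theta_ne_zero
  refine ⟨killingForm ℂ L y v / killingForm ℂ L x v, ?_⟩
  have h1 := mem_stabilizerIn_iff.mp (sub_mem hy (Submodule.smul_mem _
    (killingForm ℂ L y v / killingForm ℂ L x v) hxs))
  refine hc.pair.mem_cascadeAnnihilator hw h1.1 h1.2 ?_
  rw [map_sub, map_smul, LinearMap.sub_apply, LinearMap.smul_apply, smul_eq_mul,
    div_mul_cancel₀ _ h0, sub_self]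

/-- The nilpotent part `y` of `x` belongs to the stabilizer, hence `y = h + c x` with `h` in `H`.
The relations `κ(y, x) = κ(h, x) = 0` and `κ(x, x) ≠ 0` give `c = 0`, so `y` is a nilpotent element
of `H`. -/
theorem isSemisimple_ad (hx : IsTransversal θ β₂ β₃ ε x)
    (hxs : x ∈ stabilizerIn (parabolic b {α₁, α₂}) (cascadeSum b w v)) :
    (ad ℂ L x).IsSemisimple := by
  obtain ⟨y, hy, hnil, hss⟩ := exists_ad_mem_adjoin x
  suffices y = 0 by rwa [this, sub_zero] at hss
  obtain ⟨h1, h2⟩ := killingForm_eq_zero_of_ad_mem_adjoin hxs hy hnil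
  obtain ⟨c, hc'⟩ := hc.exists_sub_smul_mem hw hx hxs (mem_stabilizerIn_iff.mpr
    ⟨mem_parabolic_of_forall_lie_mem hc.pair.subset h1, h2⟩)
  obtain ⟨h, hh, -⟩ := mem_cascadeAnnihilator_iff.mp hc'
  have h3 := hc.killingForm_cartan_eq_zero hx h.2
  rw [hh, map_sub, map_smul, LinearMap.sub_apply, LinearMap.smul_apply,
    killingForm_eq_zero_of_ad_mem_adjoin_self hy hnil, zero_sub, neg_eq_zero, smul_eq_mul] at h3
  rw [(mul_eq_zero.mp h3).resolve_right (hc.killingForm_self_ne_zero hx), zero_smul, sub_zero] at hh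
  exact IsKilling.eq_zero_of_isNilpotent_ad_of_mem_isCartanSubalgebra ℂ L H (hh ▸ h.2) hnil

/-- The annihilator of the cascade stabilizes the form. -/
lemma cascadeAnnihilator_le_stabilizerIn : cascadeAnnihilator (b.support : Set H.root) ≤
    stabilizerIn (parabolic b {α₁, α₂}) (cascadeSum b w v) := by
  classical
  intro y hy
  obtain ⟨h, rfl, hh⟩ := mem_cascadeAnnihilator_iff.mp hy
  refine mem_stabilizerIn_iff.mpr ⟨mem_parabolic_of_mem_cartan h.2, fun z _ => ?_⟩
  have hθ : (Φ).root θ h = 0 := by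
    have hα₂ : (Φ).root α₂ h = 0 := by
      have := congrArg (fun f : Module.Dual ℂ H => f h) hc.two_smul_root
      simp only [LinearMap.add_apply, LinearMap.sub_apply, ← hc.root_one,
        hh _ (hc.quadruple.mem _)] at this
      simpa using this
    rw [hc.pair.root_sum, LinearMap.add_apply, hα₂, ← hc.root_one, hh _ (hc.quadruple.mem _),
      add_zero]
  have h0 : ⁅(h : L), cascadeSum b w v⁆ = 0 := by
    rw [lie_cascadeSum, lie_eq_smul_of_mem_rootSubspace h hw.mem_theta, hθ, zero_smul, add_zero]
    refine Finset.sum_eq_zero fun δ hδ => ?_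
    have hδ : δ ∈ cascadeRoots (b.support : Set H.root) := by simpa using hδ
    rw [lie_eq_smul_of_mem_rootSubspace h (hw.mem _ hδ), LinearMap.neg_apply, hh _ hδ, neg_zero,
      zero_smul]
  rw [← lie_skew, map_neg, ← LieModule.traceForm_apply_lie_apply, h0, map_zero,
    LinearMap.zero_apply, neg_zero]

theorem stabilizerIn_eq (hx : IsTransversal θ β₂ β₃ ε x)
    (hxs : x ∈ stabilizerIn (parabolic b {α₁, α₂}) (cascadeSum b w v)) :
    stabilizerIn (parabolic b {α₁, α₂}) (cascadeSum b w v) =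
      cascadeAnnihilator (b.support : Set H.root) ⊔ Submodule.span ℂ {x} := by
  refine le_antisymm (fun y hy => ?_) (sup_le (hc.cascadeAnnihilator_le_stabilizerIn hw) ?_)
  · obtain ⟨c, hc'⟩ := hc.exists_sub_smul_mem hw hx hxs hy
    exact Submodule.mem_sup.mpr ⟨_, hc', _, Submodule.mem_span_singleton.mpr ⟨c, rfl⟩,
      sub_add_cancel _ _⟩
  · rwa [Submodule.span_le, singleton_subset_iff]

omit hw in
theorem disjoint_span (hx : IsTransversal θ β₂ β₃ ε x) :
    Disjoint (cascadeAnnihilator (b.support : Set H.root)) (Submodule.span ℂ {x}) := by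
  rw [Submodule.disjoint_def]
  intro y hy hyx
  obtain ⟨h, rfl, -⟩ := mem_cascadeAnnihilator_iff.mp hy
  obtain ⟨c, hc'⟩ := Submodule.mem_span_singleton.mp hyx
  have h1 := hc.killingForm_cartan_eq_zero hx h.2
  rw [← hc', map_smul, LinearMap.smul_apply, smul_eq_mul] at h1
  rw [← hc', (mul_eq_zero.mp h1).resolve_right (hc.killingForm_self_ne_zero hx), zero_smul]

end IsCascadeConfiguration

end Semisimple

/-! ### Regularity of a form whose stabilizer is in general position -/

section Regular

set_option linter.unusedSectionVars false

open Filter Topology NormedSpace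

variable {V : Type*} [NormedAddCommGroup V] [NormedSpace ℂ V] [FiniteDimensional ℂ V]
  {B : V →L[ℂ] V →L[ℂ] V} {f g : V →L[ℂ] ℂ}

/-- The stabilizer of a linear form `g`, for a bracket `B` on `V`. -/
def formKernel (B : V →L[ℂ] V →L[ℂ] V) (g : V →L[ℂ] ℂ) : Submodule ℂ V where
  carrier := {x | ∀ y, g (B x y) = 0}
  add_mem' hx hy z := by
    rw [map_add, add_apply, map_add, hx z, hy z, add_zero]
  zero_mem' z := by rw [map_zero, zero_apply, map_zero]
  smul_mem' c x hx z := by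
    rw [map_smul, smul_apply, map_smul, hx z, smul_zero]

lemma mem_formKernel {x : V} : x ∈ formKernel B g ↔ ∀ y, g (B x y) = 0 := Iff.rfl

lemma exp_mul_exp_neg (D : V →L[ℂ] V) : exp D * exp (-D) = 1 := by
  have := FiniteDimensional.complete ℂ V
  let := NormedAlgebra.restrictScalars ℚ ℂ (V →L[ℂ] V)
  rw [← exp_add_of_commute (Commute.refl D).neg_right, add_neg_cancel, exp_zero]

/-- The exponential of a derivation is an automorphism: both sides, as functions of `t`, satisfy the
same linear differential equation. -/
lemma exp_apply_bracket {D : V →L[ℂ] V} (hD : ∀ y z, D (B y z) = B (D y) z + B y (D z)) (y z : V) :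
    exp D (B y z) = B (exp D y) (exp D z) := by
  have := FiniteDimensional.complete ℂ V
  have hexp : ∀ t : ℂ, HasDerivAt (fun s : ℂ => exp (s • D)) (D * exp (t • D)) t := fun t =>
    hasDerivAt_exp_smul_const' D t
  have hexpn : ∀ t : ℂ, HasDerivAt (fun s : ℂ => exp (s • -D)) (exp (t • -D) * -D) t := fun t =>
    hasDerivAt_exp_smul_const (-D) t
  have happ : ∀ (x : V) (t : ℂ), HasDerivAt (fun s : ℂ => exp (s • D) x) (D (exp (t • D) x)) t :=
    fun x t => by simpa using (hexp t).clm_apply (hasDerivAt_const t x)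
  have hB : ∀ t : ℂ, HasDerivAt (fun s : ℂ => B (exp (s • D) y) (exp (s • D) z))
      (D (B (exp (t • D) y) (exp (t • D) z))) t := fun t => by
    have h1 : HasDerivAt (fun s : ℂ => B (exp (s • D) y)) (B (D (exp (t • D) y))) t :=
      B.hasFDerivAt.comp_hasDerivAt t (happ y t)
    rw [hD]
    exact h1.clm_apply (happ z t)
  have hconst : ∀ t : ℂ, HasDerivAt
      (fun s : ℂ => exp (s • -D) (B (exp (s • D) y) (exp (s • D) z))) 0 t := fun t => by
    have := (hexpn t).clm_apply (hB t)
    simpa using this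
  have h01 := is_const_of_deriv_eq_zero (fun t => (hconst t).differentiableAt)
    (fun t => (hconst t).deriv) 1 0
  simp only [one_smul, zero_smul, exp_zero, one_apply_eq_self] at h01
  rw [← h01, ← mul_apply_eq_comp, exp_mul_exp_neg, one_apply_eq_self]

lemma finrank_formKernel_le_comp_exp {D : V →L[ℂ] V}
    (hD : ∀ y z, D (B y z) = B (D y) z + B y (D z)) :
    Module.finrank ℂ (formKernel B g) ≤ Module.finrank ℂ (formKernel B (g.comp (exp D))) := by
  have h1' : ∀ x, exp D (exp (-D) x) = x := fun x => by
    rw [← mul_apply_eq_comp, exp_mul_exp_neg, one_apply_eq_self]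
  have hmem : ∀ x ∈ formKernel B g, (exp (-D) : V →L[ℂ] V).toLinearMap x ∈
      formKernel B (g.comp (exp D)) := fun x hx y => by
    change g (exp D (B (exp (-D) x) y)) = 0
    rw [exp_apply_bracket hD, h1']
    exact hx _
  refine LinearMap.finrank_le_finrank_of_injective
    (f := (exp (-D) : V →L[ℂ] V).toLinearMap.restrict hmem) fun x y hxy => ?_
  have h2 : exp (-D) (x : V) = exp (-D) (y : V) := congrArg Subtype.val hxy
  exact Subtype.ext (by rw [← h1' x, h2, h1'])

/-- The forms close to `f` whose stabilizer is not smaller than the one of `f` fill a neighbourhood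
of `f`: up to automorphisms they vanish on `[r, V]`, where `r` is the stabilizer of `f`. -/
lemma eventually_finrank_le (hskew : ∀ x y, B x y = -B y x)
    (hjac : ∀ x y z, B x (B y z) = B (B x y) z + B y (B x z))
    (hr : Disjoint (formKernel B f)
      (Submodule.span ℂ {z | ∃ x ∈ formKernel B f, ∃ y, B x y = z})) :
    ∀ᶠ g in 𝓝 f, Module.finrank ℂ (formKernel B f) ≤ Module.finrank ℂ (formKernel B g) := by
  have := FiniteDimensional.complete ℂ V
  set r := formKernel B f with hr_def
  set N := Submodule.span ℂ {z | ∃ x ∈ r, ∃ y, B x y = z} with hN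
  -- `w ↦ w ∘ E` is a projection onto the space of the forms which vanish on `[r, V]`
  obtain ⟨ρ, hρ⟩ := LinearMap.exists_leftInverse_of_injective N.subtype N.ker_subtype
  let E : V →L[ℂ] V := LinearMap.toContinuousLinearMap (LinearMap.id - N.subtype ∘ₗ ρ)
  have hE : ∀ z, E z = z - (ρ z : V) := fun z => rfl
  let P : (V →L[ℂ] ℂ) →L[ℂ] (V →L[ℂ] ℂ) := (ContinuousLinearMap.compL ℂ V V ℂ).flip E
  have hP : ∀ w z, P w z = w (E z) := fun w z => rfl
  have hP0 : ∀ w, ∀ z ∈ N, P w z = 0 := fun w z hz => by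
    have h : ρ z = ⟨z, hz⟩ := LinearMap.congr_fun hρ ⟨z, hz⟩
    rw [hP, hE, h, sub_self, map_zero]
  have hPw : ∀ w : V →L[ℂ] ℂ, (∀ z ∈ N, w z = 0) → ∀ z, P w z = w z := fun w hw z => by
    rw [hP, hE, map_sub, hw _ (ρ z).2, sub_zero]
  -- the forms `(f + P w) ∘ exp (ad x)` have stabilizers which are not smaller than `r`
  let Ψ : V × (V →L[ℂ] ℂ) → (V →L[ℂ] ℂ) := fun p => (f + P p.2).comp (exp (B p.1))
  have hΨ0 : Ψ 0 = f := by
    simp only [Ψ, Prod.fst_zero, Prod.snd_zero, map_zero, exp_zero, add_zero]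
    rfl
  have hΨle : ∀ p, Module.finrank ℂ r ≤ Module.finrank ℂ (formKernel B (Ψ p)) := by
    rintro ⟨x, w⟩
    suffices hle : r ≤ formKernel B (f + P w) from
      (Submodule.finrank_mono hle).trans (finrank_formKernel_le_comp_exp (hjac x))
    intro y hy z
    rw [add_apply, hy z, zero_add]
    exact hP0 w _ (Submodule.subset_span ⟨y, hy, z, rfl⟩)
  have hd1 : HasStrictFDerivAt (fun p : V × (V →L[ℂ] ℂ) => exp (B p.1))
      (B.comp (.fst ℂ V _)) 0 := by
    have h1 : HasStrictFDerivAt (exp : (V →L[ℂ] V) → _) (1 : (V →L[ℂ] V) →L[ℂ] (V →L[ℂ] V))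
        (B (0 : V × (V →L[ℂ] ℂ)).1) := by
      rw [Prod.fst_zero, map_zero]
      exact hasStrictFDerivAt_exp_zero
    have h2 : HasStrictFDerivAt (fun p : V × (V →L[ℂ] ℂ) => B p.1) (B.comp (.fst ℂ V _)) 0 :=
      B.hasStrictFDerivAt.comp 0 hasStrictFDerivAt_fst
    exact HasStrictFDerivAt.comp (f := fun p : V × (V →L[ℂ] ℂ) => B p.1) 0 h1 h2
  have hd2 : HasStrictFDerivAt (fun p : V × (V →L[ℂ] ℂ) => f + P p.2) (P.comp (.snd ℂ V _)) 0 :=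
    (P.hasStrictFDerivAt.comp 0 hasStrictFDerivAt_snd).const_add f
  have hΨ := hd2.clm_comp hd1
  have hsurj := hΨ.map_nhds_eq_of_surj ?_
  · have h2 : map Ψ (𝓝 0) = 𝓝 f := by rw [← hΨ0]; exact hsurj
    rw [← h2, eventually_map]
    exact Eventually.of_forall hΨle
  -- the derivative `(x, w) ↦ f ∘ ad x + P w` at the origin is surjective: the two summands have
  -- the images `r^⊥` and `[r, V]^⊥`
  rw [eq_top_iff]
  rintro g -
  have htop : r.dualAnnihilator ⊔ N.dualAnnihilator = ⊤ := by
    rw [← Subspace.dualAnnihilator_inf_eq, hr.eq_bot, Submodule.dualAnnihilator_bot]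
  obtain ⟨g₁, hg₁, g₂, hg₂, hg⟩ := Submodule.mem_sup.mp
    (htop ▸ Submodule.mem_top (x := (g : V →ₗ[ℂ] ℂ)))
  let T : V →ₗ[ℂ] Module.Dual ℂ V :=
    { toFun x := (f.comp (B x)).toLinearMap
      map_add' x y := by ext z; simp
      map_smul' c x := by ext z; simp }
  have hker : LinearMap.ker T = r := by
    ext x
    rw [LinearMap.mem_ker, hr_def, mem_formKernel]
    exact ⟨fun h y => LinearMap.congr_fun h y, fun h => LinearMap.ext h⟩
  have hrange : LinearMap.range T = r.dualAnnihilator := by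
    refine Submodule.eq_of_le_of_finrank_eq ?_ ?_
    · rintro _ ⟨x, rfl⟩
      refine (Submodule.mem_dualAnnihilator _).mpr fun y hy => ?_
      change f (B x y) = 0
      rw [hskew, map_neg, hy x, neg_zero]
    · have h3 := T.finrank_range_add_finrank_ker
      have h4 := Subspace.finrank_add_finrank_dualAnnihilator_eq r
      rw [hker] at h3
      omega
  obtain ⟨x, hx⟩ : g₁ ∈ LinearMap.range T := hrange ▸ hg₁
  refine ⟨(x, LinearMap.toContinuousLinearMap g₂), ?_⟩
  ext z
  have h5 := LinearMap.congr_fun hg z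
  have h6 := LinearMap.congr_fun hx z
  have h7 := hPw (LinearMap.toContinuousLinearMap g₂)
    ((Submodule.mem_dualAnnihilator _).mp hg₂) z
  rw [LinearMap.add_apply, ← h6] at h5
  simp only [T, LinearMap.coe_mk, AddHom.coe_mk] at h5
  simpa [h7] using h5

/-- Kernels do not jump up along a punctured line: `dim ker (A + t C) ≤ dim ker C` for almost all
small `t`. -/
lemma eventually_finrank_ker_le {V W : Type*} [AddCommGroup V] [Module ℂ V] [FiniteDimensional ℂ V]
    [AddCommGroup W] [Module ℂ W] (A C : V →ₗ[ℂ] W) :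
    ∀ᶠ t in 𝓝[≠] (0 : ℂ),
      Module.finrank ℂ (LinearMap.ker (A + t • C)) ≤ Module.finrank ℂ (LinearMap.ker C) := by
  obtain ⟨U, hU⟩ := Submodule.exists_isCompl (LinearMap.ker C)
  have hinj : LinearMap.ker (C.comp U.subtype) = ⊥ := by
    rw [LinearMap.ker_eq_bot']
    intro x hx
    exact Subtype.ext (Submodule.disjoint_def.mp hU.disjoint _ hx x.2)
  obtain ⟨π, hπ⟩ := LinearMap.exists_leftInverse_of_injective _ hinj
  set M : Module.End ℂ U := π.comp (A.comp U.subtype) with hM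
  have hfin : Set.Finite {t : ℂ | M.HasEigenvalue (-t)} :=
    M.finite_hasEigenvalue.preimage neg_injective.injOn
  filter_upwards [nhdsNE_le_cofinite 0 hfin.eventually_cofinite_notMem] with t ht
  have hdisj : Disjoint (LinearMap.ker (A + t • C)) U := by
    rw [Submodule.disjoint_def]
    intro x hx hxU
    by_contra hx0
    refine ht (Module.End.hasEigenvalue_of_hasEigenvector (x := ⟨x, hxU⟩)
      (Module.End.hasEigenvector_iff.mpr ⟨Module.End.mem_eigenspace_iff.mpr ?_,
        fun h => hx0 (congrArg Subtype.val h)⟩))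
    have h1 : A x = -(t • C x) := eq_neg_of_add_eq_zero_left hx
    have h2 : π (C x) = ⟨x, hxU⟩ := LinearMap.congr_fun hπ ⟨x, hxU⟩
    change π (A x) = _
    rw [h1, map_neg, map_smul, h2, neg_smul]
  have h3 := Submodule.finrank_add_finrank_le_of_disjoint hdisj
  have h4 := Submodule.finrank_add_eq_of_isCompl hU
  omega

/-- On the line through `f` and `g`, almost all points close to `f` have a stabilizer not smaller
than the one of `f`, and not larger than the one of `g`. -/
lemma finrank_formKernel_le (hskew : ∀ x y, B x y = -B y x)
    (hjac : ∀ x y z, B x (B y z) = B (B x y) z + B y (B x z))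
    (hr : Disjoint (formKernel B f)
      (Submodule.span ℂ {z | ∃ x ∈ formKernel B f, ∃ y, B x y = z})) (g : V →L[ℂ] ℂ) :
    Module.finrank ℂ (formKernel B f) ≤ Module.finrank ℂ (formKernel B g) := by
  let T (g : V →L[ℂ] ℂ) : V →ₗ[ℂ] Module.Dual ℂ V :=
    { toFun x := (g.comp (B x)).toLinearMap
      map_add' x y := by ext z; simp
      map_smul' c x := by ext z; simp }
  have hker : ∀ g, LinearMap.ker (T g) = formKernel B g := fun g => by
    ext x
    exact ⟨fun h y => LinearMap.congr_fun h y, fun h => LinearMap.ext h⟩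
  have hcont : Tendsto (fun t : ℂ => f + t • g) (𝓝[≠] 0) (𝓝 f) := by
    have : Continuous fun t : ℂ => f + t • g := by fun_prop
    have h := this.tendsto 0
    have h0 : f + (0 : ℂ) • g = f := by ext; simp
    rw [h0] at h
    exact h.mono_left nhdsWithin_le_nhds
  obtain ⟨t, h1, h2⟩ := ((hcont.eventually (eventually_finrank_le hskew hjac hr)).and
    (eventually_finrank_ker_le (T f) (T g))).exists
  have h3 : T f + t • T g = T (f + t • g) := by ext x y; simp [T]
  rw [h3, hker, hker] at h2
  exact h1.trans h2

end Regular

section Lie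

variable {q : Type*} [LieRing q] [LieAlgebra ℂ q] [FiniteDimensional ℂ q]

/-- A linear form `f` whose stabilizer `r` satisfies `r ∩ [r, q] = 0` is regular. -/
theorem isRegularForm_of_disjoint {f : Module.Dual ℂ q}
    (hr : Disjoint (coadjointStabilizer f).toSubmodule
      (Submodule.span ℂ {z | ∃ x ∈ coadjointStabilizer f, ∃ y, ⁅x, y⁆ = z})) :
    IsRegularForm f := by
  -- any norm will do
  let e : q ≃ₗ[ℂ] (Fin (Module.finrank ℂ q) → ℂ) := (Module.finBasis ℂ q).equivFun
  let : NormedAddCommGroup q := NormedAddCommGroup.induced q _ e e.injective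
  let : NormedSpace ℂ q := NormedSpace.induced ℂ q _ e
  intro g
  let B : q →L[ℂ] q →L[ℂ] q := LinearMap.toContinuousLinearMap
    ((LinearMap.toContinuousLinearMap : (q →ₗ[ℂ] q) ≃ₗ[ℂ] (q →L[ℂ] q)).toLinearMap ∘ₗ
      LinearMap.mk₂ ℂ (fun x y : q => ⁅x, y⁆) add_lie smul_lie lie_add fun c x y => lie_smul c x y)
  have hB : ∀ x y, B x y = ⁅x, y⁆ := fun x y => rfl
  have key := finrank_formKernel_le (B := B) (f := LinearMap.toContinuousLinearMap f)
    (fun x y => (lie_skew x y).symm) (fun x y z => leibniz_lie x y z) hr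
    (LinearMap.toContinuousLinearMap g)
  exact key

end Lie

/-! ### Forms whose stabilizer is commutative -/

section Commutative

variable {L : Type*} [LieRing L] [LieAlgebra ℂ L] {p : LieSubalgebra ℂ L} {u : L}

lemma coe_mem_stabilizerIn {x : p} (hx : x ∈ coadjointStabilizer (killingFunctional p u)) :
    (x : L) ∈ stabilizerIn p u :=
  ⟨x, hx, rfl⟩

/-- A form whose stabilizer is a commutative algebra of semisimple elements is of reductive
type. -/
theorem isReductiveType_of_commutative [FiniteDimensional ℂ L]
    (hcomm : ∀ x ∈ stabilizerIn p u, ∀ y ∈ stabilizerIn p u, ⁅x, y⁆ = 0)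
    (hss : ∀ x ∈ stabilizerIn p u, (ad ℂ L x).IsSemisimple) :
    IsReductiveType (killingFunctional p u) := by
  have hab : IsLieAbelian (coadjointStabilizer (killingFunctional p u)) := ⟨fun x y =>
    Subtype.ext (Subtype.ext (hcomm _ (coe_mem_stabilizerIn x.2) _ (coe_mem_stabilizerIn y.2)))⟩
  have hab' : IsLieAbelian (coadjointStabilizer (killingFunctional p u) ⧸
      centerInStabilizer (killingFunctional p u)) := ⟨fun x y => by
    obtain ⟨x, rfl⟩ := LieSubmodule.Quotient.surjective_mk' _ x
    obtain ⟨y, rfl⟩ := LieSubmodule.Quotient.surjective_mk' _ y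
    exact (LieSubmodule.Quotient.mk_bracket _ x y).symm.trans (by rw [hab.trivial]; rfl)⟩
  refine ⟨⟨?_⟩, fun x _ => ?_⟩
  · rw [radical_eq_top_of_isSolvable, (isLieAbelian_iff_center_eq_top ℂ _).mp hab']
  · have hinv : p.toSubmodule ∈ (ad ℂ L ((x : p) : L)).invtSubmodule := fun y hy =>
      p.lie_mem (x : p).2 hy
    exact (hss _ (coe_mem_stabilizerIn x.2)).restrict hinv

/-- A form whose stabilizer is commutative, and nondegenerate for the Killing form, is regular. -/
theorem isRegularForm_of_nondegenerate [FiniteDimensional ℂ L]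
    (hcomm : ∀ x ∈ stabilizerIn p u, ∀ y ∈ stabilizerIn p u, ⁅x, y⁆ = 0)
    (hnondeg : ∀ x ∈ stabilizerIn p u,
      (∀ y ∈ stabilizerIn p u, killingForm ℂ L x y = 0) → x = 0) :
    IsRegularForm (killingFunctional p u) := by
  refine isRegularForm_of_disjoint (Submodule.disjoint_def.mpr fun z hz hz' => ?_)
  refine Subtype.ext (hnondeg _ (coe_mem_stabilizerIn hz) fun y hy => ?_)
  clear hz
  induction hz' using Submodule.span_induction with
  | mem z hz =>
    obtain ⟨x, hx, a, rfl⟩ := hz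
    rw [LieSubalgebra.coe_bracket, ← lie_skew, map_neg, LinearMap.neg_apply,
      LieModule.traceForm_apply_lie_apply, hcomm _ (coe_mem_stabilizerIn hx) _ hy, map_zero,
      neg_zero]
  | zero => rw [ZeroMemClass.coe_zero, map_zero, LinearMap.zero_apply]
  | add z z' _ _ h h' =>
    rw [AddMemClass.coe_add, map_add, LinearMap.add_apply, h, h', add_zero]
  | smul c z _ h =>
    rw [SetLike.val_smul, map_smul, LinearMap.smul_apply, h, smul_zero]

end Commutative

section Configuration

set_option linter.unusedSectionVars false

open Set

variable {L : Type*} [LieRing L] [LieAlgebra ℂ L] [FiniteDimensional ℂ L] [IsKilling ℂ L]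
  {H : LieSubalgebra ℂ L} [H.IsCartanSubalgebra]

local notation "Φ" => IsKilling.rootSystem H

variable {b : (IsKilling.rootSystem H).Base} {α₁ α₂ θ β₂ β₃ : H.root} {ε : Fin 4 → H.root}
  {w : H.root → L} {v x y : L} {S : Set H.root}

lemma lie_eq_zero_of_mem_cartan (hx : x ∈ H) (hy : y ∈ H) : ⁅x, y⁆ = 0 := by
  rw [lie_eq_smul_of_mem_rootSubspace ⟨x, hx⟩ (mem_rootSubspace_zero.mpr hy),
    LinearMap.zero_apply, zero_smul]

/-- The Killing form is nondegenerate on the orthogonal of the cascade in `H`. -/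
lemma eq_zero_of_mem_cascadeAnnihilator (hS : S ⊆ b.support) (hx : x ∈ cascadeAnnihilator S)
    (h : ∀ y ∈ cascadeAnnihilator S, killingForm ℂ L x y = 0) : x = 0 := by
  classical
  obtain ⟨h₁, rfl, hh₁⟩ := mem_cascadeAnnihilator_iff.mp hx
  refine eq_zero_of_forall_killingForm (H := H) (mem_rootSubspace_zero.mpr h₁.2) fun z hz => ?_
  rw [neg_zero] at hz
  lift z to H using mem_rootSubspace_zero.mp hz
  set E := Finset.univ.filter fun ε : H.root => ε ∈ cascadeRoots S with hE
  -- the projection of `z` to the annihilator of the cascade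
  set z' : H := z - ∑ ε ∈ E, ((Φ).root ε z / 2) • (Φ).coroot ε with hz'
  have h1 : killingForm ℂ L h₁ z' = 0 := by
    refine h _ (mem_cascadeAnnihilator_iff.mpr ⟨z', rfl, fun ε hε => ?_⟩)
    rw [hz', map_sub, map_sum, Finset.sum_eq_single_of_mem ε (by simpa [hE] using hε)
      fun δ hδ hne => ?_]
    · rw [map_smul, root_apply_coroot_eq_pairing, RootPairing.pairing_same, smul_eq_mul,
        div_mul_cancel₀ _ two_ne_zero, sub_self]
    · have hδ : δ ∈ cascadeRoots S := by simpa [hE] using hδ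
      have h2 := (cascadeRoots_strongly_orthogonal hS hε hδ hne.symm).1
      rw [← pairing_eq_zero_iff_pairingIn] at h2
      rw [map_smul, root_apply_coroot_eq_pairing, h2, smul_zero]
  have h3 : ∀ ε ∈ E, killingForm ℂ L h₁ ((Φ).coroot ε : H) = 0 := fun ε hε => by
    have hε : ε ∈ cascadeRoots S := by simpa [hE] using hε
    have h4 : killingForm ℂ L ((Φ).coroot ε : H) h₁ =
        2 • (ε.1 <| (IsKilling.cartanEquivDual H).symm ε.1)⁻¹ • ε.1 h₁ :=
      IsKilling.traceForm_coroot ε.1 h₁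
    have h5 : ε.1 h₁ = 0 := hh₁ ε hε
    rw [LieModule.traceForm_comm, h4, h5, smul_zero, smul_zero]
  have h6 : (z : L) = z' + ∑ ε ∈ E, ((Φ).root ε z / 2) • ((Φ).coroot ε : L) := by
    rw [hz']
    push_cast
    rw [sub_add_cancel]
  rw [h6, map_add, h1, map_sum, zero_add, Finset.sum_eq_zero fun ε hε => ?_]
  rw [map_smul, h3 ε hε, smul_zero]

namespace IsCascadeConfiguration

variable (hc : IsCascadeConfiguration b α₁ α₂ θ β₂ β₃ ε) (hw : IsCascadeFamily b θ w v)

include hc hw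

lemma mem_stabilizerIn_iff_exists (hx : IsTransversal θ β₂ β₃ ε x)
    (hxs : x ∈ stabilizerIn (parabolic b {α₁, α₂}) (cascadeSum b w v)) :
    y ∈ stabilizerIn (parabolic b {α₁, α₂}) (cascadeSum b w v) ↔
      ∃ h ∈ cascadeAnnihilator (b.support : Set H.root), ∃ c : ℂ, h + c • x = y := by
  rw [hc.stabilizerIn_eq hw hx hxs, Submodule.mem_sup]
  simp only [Submodule.mem_span_singleton, exists_exists_eq_and]

lemma lie_eq_zero_of_mem_stabilizerIn (hx : IsTransversal θ β₂ β₃ ε x)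
    (hxs : x ∈ stabilizerIn (parabolic b {α₁, α₂}) (cascadeSum b w v)) :
    ∀ y ∈ stabilizerIn (parabolic b {α₁, α₂}) (cascadeSum b w v),
      ∀ z ∈ stabilizerIn (parabolic b {α₁, α₂}) (cascadeSum b w v), ⁅y, z⁆ = 0 := by
  intro y hy z hz
  obtain ⟨h, hh, c, rfl⟩ := (hc.mem_stabilizerIn_iff_exists hw hx hxs).mp hy
  obtain ⟨h', hh', c', rfl⟩ := (hc.mem_stabilizerIn_iff_exists hw hx hxs).mp hz
  obtain ⟨a, rfl, -⟩ := mem_cascadeAnnihilator_iff.mp hh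
  obtain ⟨a', rfl, -⟩ := mem_cascadeAnnihilator_iff.mp hh'
  have h1 := hc.lie_eq_zero_of_mem_cascadeAnnihilator hx hh
  have h2 : ⁅x, (a' : L)⁆ = 0 := by
    rw [← lie_skew, hc.lie_eq_zero_of_mem_cascadeAnnihilator hx hh', neg_zero]
  simp only [add_lie, lie_add, smul_lie, lie_smul, h1, h2, lie_self,
    lie_eq_zero_of_mem_cartan a.2 a'.2, smul_zero, add_zero]

/-- The stabilizer is spanned by commuting semisimple elements. -/
theorem isReductiveType (hx : IsTransversal θ β₂ β₃ ε x)
    (hxs : x ∈ stabilizerIn (parabolic b {α₁, α₂}) (cascadeSum b w v)) :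
    IsReductiveType (killingFunctional (parabolic b {α₁, α₂}) (cascadeSum b w v)) := by
  refine isReductiveType_of_commutative (hc.lie_eq_zero_of_mem_stabilizerIn hw hx hxs)
    fun y hy => ?_
  obtain ⟨h, hh, c, rfl⟩ := (hc.mem_stabilizerIn_iff_exists hw hx hxs).mp hy
  obtain ⟨a, rfl, -⟩ := mem_cascadeAnnihilator_iff.mp hh
  have hcomm : Commute (ad ℂ L (a : L)) (ad ℂ L x) := by
    ext z
    simp only [Module.End.mul_apply, ad_apply]
    rw [leibniz_lie, hc.lie_eq_zero_of_mem_cascadeAnnihilator hx hh, zero_lie, zero_add]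
  have hss : (ad ℂ L (a : L)).IsSemisimple :=
    IsKilling.isSemisimple_ad_of_mem_isCartanSubalgebra a.2
  refine hss.of_mem_adjoin_pair hcomm (hc.isSemisimple_ad hw hx hxs) ?_
  rw [map_add, map_smul]
  exact add_mem (Algebra.subset_adjoin (by simp))
    (Subalgebra.smul_mem _ (Algebra.subset_adjoin (by simp)) c)

/-- The stabilizer is the orthogonal sum of the annihilator of the cascade, on which the Killing
form is nondegenerate, and of the line through `x`, with `κ(x, x) ≠ 0`. -/
theorem isRegularForm (hx : IsTransversal θ β₂ β₃ ε x)
    (hxs : x ∈ stabilizerIn (parabolic b {α₁, α₂}) (cascadeSum b w v)) :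
    IsRegularForm (killingFunctional (parabolic b {α₁, α₂}) (cascadeSum b w v)) := by
  refine isRegularForm_of_nondegenerate (hc.lie_eq_zero_of_mem_stabilizerIn hw hx hxs)
    fun y hy hyz => ?_
  obtain ⟨h, hh, c, rfl⟩ := (hc.mem_stabilizerIn_iff_exists hw hx hxs).mp hy
  have hH : ∀ z ∈ cascadeAnnihilator (b.support : Set H.root), z ∈ H := fun z hz => by
    obtain ⟨a, rfl, -⟩ := mem_cascadeAnnihilator_iff.mp hz
    exact a.2
  have h1 := hyz x hxs
  rw [map_add, map_smul, LinearMap.add_apply, LinearMap.smul_apply,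
    hc.killingForm_cartan_eq_zero hx (hH _ hh), zero_add, smul_eq_mul] at h1
  have h2 := (mul_eq_zero.mp h1).resolve_right (hc.killingForm_self_ne_zero hx)
  rw [h2, zero_smul, add_zero] at hyz ⊢
  exact eq_zero_of_mem_cascadeAnnihilator subset_rfl hh fun z hz =>
    hyz z (hc.cascadeAnnihilator_le_stabilizerIn hw hz)

lemma exists_mem_stabilizerIn :
    ∃ x, IsTransversal θ β₂ β₃ ε x ∧
      x ∈ stabilizerIn (parabolic b {α₁, α₂}) (cascadeSum b w v) := by
  obtain ⟨t, ht, ht0⟩ := exists_mem_rootSubspace_ne_zero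
    (neg_mem_range_root (H := H) ⟨θ, rfl⟩)
  obtain ⟨y₂, y₃, z, n, hy₂, hy₃, hz, hn, h⟩ := hc.exists_isTransversal hw ht ht0
  have hx : IsTransversal θ β₂ β₃ ε (t + y₂ + y₃ + ∑ k, z k + n) :=
    ⟨t, y₂, y₃, z, n, ⟨ht, ht0⟩, hy₂, hy₃, hz, hn, rfl⟩
  exact ⟨_, hx, mem_stabilizerIn_iff.mpr ⟨hc.isTransversal_mem_parabolic hx, h⟩⟩

omit hw in
theorem isQuasiReductive : IsQuasiReductive (parabolic b {α₁, α₂}) := by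
  choose w hw using fun δ : H.root =>
    exists_mem_rootSubspace_ne_zero (neg_mem_range_root (H := H) ⟨δ, rfl⟩)
  obtain ⟨v, hv, hv0⟩ := exists_mem_rootSubspace_ne_zero (H := H) ⟨θ, rfl⟩
  have hfam : IsCascadeFamily b θ w v := ⟨fun δ _ => (hw δ).1, fun δ _ => (hw δ).2, hv, hv0⟩
  obtain ⟨x, hx, hxs⟩ := hc.exists_mem_stabilizerIn hfam
  exact ⟨_, hc.isReductiveType hfam hx hxs⟩

end IsCascadeConfiguration

theorem IsTypeFOrE.exists_isCascadeConfiguration (hb : IsTypeFOrE b) (hα₁ : α₁ ∈ b.support)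
    (hα₂ : IsJoinedToLowestRoot b α₂) (hne : α₁ ≠ α₂)
    (hconn : IsConnectedSet ({α₁, α₂} : Set H.root)) :
    ∃ θ β₂ β₃ ε, IsHighestRoot {α₁, α₂} θ ∧ IsCascadeConfiguration b α₁ α₂ θ β₂ β₃ ε := by
  have hsub : ({α₁, α₂} : Set H.root) ⊆ b.support := by
    rintro _ (rfl | rfl)
    exacts [hα₁, hα₂.1]
  have hadj : (Φ).pairingIn ℤ α₁ α₂ ≠ 0 := by
    intro h0
    have h1 := hconn.isIndecomposable.2 {α₂} (by simp) (by simp) ?_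
    · exact hne (h1.symm ▸ mem_insert α₁ {α₂} : α₁ ∈ ({α₂} : Set H.root))
    · rintro i (rfl | rfl) hi j rfl
      exacts [h0, absurd rfl hi]
  obtain ⟨ε, hq⟩ := hb.exists_quadruple hα₁ hα₂ hne hadj
  have hθ : (Φ).root ((Φ).reflectionPerm α₂ α₁) = (Φ).root α₁ + (Φ).root α₂ := by
    rw [root_reflectionPerm_eq, hq.pairing₁₂]; module
  set θ := (Φ).reflectionPerm α₂ α₁
  have hpos : b.IsPos θ := isPos_add (isPos_simple hα₁) (isPos_simple hα₂.1) hθ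
  have hh := isHighest_pair hα₁ hα₂.1 hconn hq.isLong hq.pairing₁₂ hq.pairing₂₁ hθ
  obtain ⟨β₂, -, hβ₂, -, hlong₂, -, hroot₂⟩ := hq.exists_beta hθ hpos
  obtain ⟨β₃, -, hβ₃, -, hlong₃, -, hroot₃⟩ := hq.swap.exists_beta hθ hpos
  exact ⟨θ, β₂, β₃, ε, (isHighestRoot_iff b hsub θ).mpr hh, hq,
    ⟨hα₁, hα₂.1, hq.mem_root_one, hθ, fun γ => hh.eq_of_supportedIn_pair hα₁ hα₂.1 hne hθ⟩,
    hβ₂, hβ₃, hlong₂, hlong₃, hroot₂, hroot₃⟩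

/-- If `S` consists of all simple roots, then `p_S⁺` is the whole algebra, and the Killing form of
a regular element of `H` is of reductive type. -/
theorem isQuasiReductive_of_support_subset (hS : (b.support : Set H.root) ⊆ S) :
    IsQuasiReductive (parabolic b S) := by
  obtain ⟨h, hh⟩ := Module.Dual.exists_forall_ne_zero_of_forall_exists (K := ℂ) (Φ).root
    fun α => by
      by_contra! h0
      exact (Φ).ne_zero α (LinearMap.ext h0)
  have htop : ∀ z : L, z ∈ parabolic b S := fun z => mem_parabolic_of_forall_killingForm
    fun γ ⟨i, hi, _⟩ => absurd (hS i.2) hi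
  have hstab : ∀ x ∈ stabilizerIn (parabolic b S) (h : L), x ∈ H := by
    intro x hx
    refine mem_of_forall_killingForm (H := H) (A := H.toSubmodule) le_rfl fun f hf => Or.inr ?_
    intro z hz
    have h1 := (mem_stabilizerIn_iff.mp hx).2 z (htop z)
    obtain ⟨α, rfl⟩ := hf
    rw [← lie_skew, lie_eq_smul_of_mem_rootSubspace h hz, LinearMap.neg_apply, neg_smul, neg_neg,
      map_smul, smul_eq_mul] at h1
    exact (mul_eq_zero.mp h1).resolve_left (hh α)
  exact ⟨_, isReductiveType_of_commutative
    (fun x hx y hy => lie_eq_zero_of_mem_cartan (hstab x hx) (hstab y hy))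
    fun x hx => IsKilling.isSemisimple_ad_of_mem_isCartanSubalgebra (hstab x hx)⟩

end Configuration

/-! ### Root vectors of a Chevalley basis -/

section Chevalley

set_option linter.unusedSectionVars false

open Set

variable {L : Type*} [LieRing L] [LieAlgebra ℂ L] [FiniteDimensional ℂ L] [IsKilling ℂ L]
  {H : LieSubalgebra ℂ L} [H.IsCartanSubalgebra]

local notation "Φ" => IsKilling.rootSystem H

variable {b : (IsKilling.rootSystem H).Base} {α₁ α₂ θ β₂ β₃ : H.root} {ε : Fin 4 → H.root}
  {x : Weight ℂ H L → L} {S : Set H.root} {a c : H.root → ℂ}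

namespace IsChevalleySystem

variable (hx : IsChevalleySystem x)

include hx

lemma mem_rootSubspace (α : H.root) : x α.1 ∈ rootSubspace ((Φ).root α) :=
  hx.mem_rootSpace α.1 (LieSubalgebra.isNonZero_coe_root α)

lemma neg_mem_rootSubspace (α : H.root) : x (-α.1) ∈ rootSubspace (-(Φ).root α) := by
  have h := hx.mem_rootSpace (-α.1) (Weight.IsNonZero.neg (LieSubalgebra.isNonZero_coe_root α))
  rw [Weight.coe_neg] at h
  exact h

lemma lie_ne_zero (α : H.root) : ⁅x α.1, x (-α.1)⁆ ≠ 0 := by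
  rw [hx.lie_neg α.1 (LieSubalgebra.isNonZero_coe_root α)]
  intro h
  exact (LieSubalgebra.isNonZero_coe_root α)
    ((IsKilling.coroot_eq_zero_iff).mp (Subtype.ext h))

lemma ne_zero (α : H.root) : x α.1 ≠ 0 := fun h =>
  hx.lie_ne_zero α (by rw [h, zero_lie])

lemma neg_ne_zero (α : H.root) : x (-α.1) ≠ 0 := fun h =>
  hx.lie_ne_zero α (by rw [h, lie_zero])

end IsChevalleySystem

/-- The cascade of `{α₁, α₂}` consists of `θ = α₁ + α₂` only: `α₁` and `α₂` are not strongly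
orthogonal to `θ`. -/
lemma IsCascadePair.mem_cascadeRoots_iff (hp : IsCascadePair b α₁ α₂ θ)
    (hconn : IsConnectedSet ({α₁, α₂} : Set H.root)) (hθ : IsHighestRoot {α₁, α₂} θ) {δ : H.root} :
    δ ∈ cascadeRoots ({α₁, α₂} : Set H.root) ↔ δ = θ := by
  have hmem : θ ∈ cascadeRoots ({α₁, α₂} : Set H.root) :=
    ⟨_, .component ⟨subset_rfl, hconn, fun α h h' => absurd h h'⟩, hθ⟩
  refine ⟨fun h => ?_, fun h => h ▸ hmem⟩
  by_contra hne
  have hno := (cascadeRoots_strongly_orthogonal hp.subset hmem h (Ne.symm hne)).2.1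
  obtain ⟨K, hK, -, hh⟩ := exists_isHighest_of_mem_cascadeRoots hp.subset h
  have hsupp : SupportedIn b {α₁, α₂} δ := fun i hi =>
    hh.supportedIn i fun h' => hi (hK.subset h')
  rcases hp.eq_of_supportedIn δ hh.isPos hsupp with rfl | rfl | rfl
  · exact hno ⟨α₂, by rw [hp.root_sum]; abel⟩
  · exact hno ⟨α₁, by rw [hp.root_sum]; abel⟩
  · exact hne rfl

open Classical in
lemma IsCascadePair.cascadeVector_eq (hp : IsCascadePair b α₁ α₂ θ)
    (hconn : IsConnectedSet ({α₁, α₂} : Set H.root)) (hθ : IsHighestRoot {α₁, α₂} θ) :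
    cascadeVector x (b.support : Set H.root) {α₁, α₂} a c =
      cascadeSum b (fun ε => a ε • x (-ε.1)) (c θ • x θ.1) := by
  have hmem : ∀ {δ : H.root}, δ ∈ Finset.univ.filter (fun δ : H.root =>
      δ ∈ cascadeRoots ({α₁, α₂} : Set H.root)) ↔ δ = θ := fun {δ} => by
    rw [Finset.mem_filter_univ, hp.mem_cascadeRoots_iff hconn hθ]
  rw [cascadeVector, cascadeSum, add_right_inj]
  exact Finset.sum_eq_single_of_mem θ (hmem.mpr rfl) fun δ hδ hne => absurd (hmem.mp hδ) hne

lemma IsChevalleySystem.isCascadeFamily (hx : IsChevalleySystem x)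
    (ha : ∀ ε ∈ cascadeRoots (b.support : Set H.root), a ε ≠ 0) (hc : c θ ≠ 0) :
    IsCascadeFamily b θ (fun ε => a ε • x (-ε.1)) (c θ • x θ.1) where
  mem ε _ := Submodule.smul_mem _ _ (hx.neg_mem_rootSubspace ε)
  ne_zero ε hε := smul_ne_zero (ha ε hε) (hx.neg_ne_zero ε)
  mem_theta := Submodule.smul_mem _ _ (hx.mem_rootSubspace θ)
  theta_ne_zero := smul_ne_zero hc (hx.ne_zero θ)

lemma IsChevalleySystem.isTransversal (hx : IsChevalleySystem x) {l₂ l₃ n : ℂ} {m : Fin 4 → ℂ}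
    (h₂ : l₂ ≠ 0) (h₃ : l₃ ≠ 0) (hm : ∀ k, m k ≠ 0) (hn : n ≠ 0) :
    IsTransversal θ β₂ β₃ ε (stabilizerVector x θ β₂ β₃ ε l₂ l₃ m n) :=
  ⟨_, _, _, fun k => m k • x (ε k).1, _, ⟨hx.neg_mem_rootSubspace θ, hx.neg_ne_zero θ⟩,
    ⟨Submodule.smul_mem _ _ (hx.mem_rootSubspace β₂), smul_ne_zero h₂ (hx.ne_zero β₂)⟩,
    ⟨Submodule.smul_mem _ _ (hx.mem_rootSubspace β₃), smul_ne_zero h₃ (hx.ne_zero β₃)⟩,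
    fun k => ⟨Submodule.smul_mem _ _ (hx.mem_rootSubspace (ε k)),
      smul_ne_zero (hm k) (hx.ne_zero (ε k))⟩,
    ⟨Submodule.smul_mem _ _ (hx.neg_mem_rootSubspace (ε 1)),
      smul_ne_zero hn (hx.neg_ne_zero (ε 1))⟩, rfl⟩

lemma IsCascadeConfiguration.exists_stabilizerVector_mem
    (hc : IsCascadeConfiguration b α₁ α₂ θ β₂ β₃ ε) (hx : IsChevalleySystem x)
    {w : H.root → L} {v : L} (hw : IsCascadeFamily b θ w v) :
    ∃ (l₂ l₃ : ℂ) (m : Fin 4 → ℂ) (n : ℂ), l₂ ≠ 0 ∧ l₃ ≠ 0 ∧ (∀ k, m k ≠ 0) ∧ n ≠ 0 ∧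
      stabilizerVector x θ β₂ β₃ ε l₂ l₃ m n ∈
        stabilizerIn (parabolic b {α₁, α₂}) (cascadeSum b w v) := by
  obtain ⟨y₂, y₃, z, n, hy₂, hy₃, hz, hn, h⟩ :=
    hc.exists_isTransversal hw (hx.neg_mem_rootSubspace θ) (hx.neg_ne_zero θ)
  have key : ∀ {f : Module.Dual ℂ H} {y z : L}, f ∈ range (Φ).root → y ∈ rootSubspace f → y ≠ 0 →
      (z ∈ rootSubspace f ∧ z ≠ 0) → ∃ l : ℂ, l ≠ 0 ∧ z = l • y := by
    rintro f y z hf hy hy0 ⟨hz, hz0⟩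
    obtain ⟨l, rfl⟩ := exists_eq_smul_of_mem_rootSubspace hf hy hy0 hz
    exact ⟨l, left_ne_zero_of_smul hz0, rfl⟩
  obtain ⟨l₂, h₂, rfl⟩ := key ⟨β₂, rfl⟩ (hx.mem_rootSubspace β₂) (hx.ne_zero β₂) hy₂
  obtain ⟨l₃, h₃, rfl⟩ := key ⟨β₃, rfl⟩ (hx.mem_rootSubspace β₃) (hx.ne_zero β₃) hy₃
  choose m hm hmz using fun k =>
    key ⟨ε k, rfl⟩ (hx.mem_rootSubspace (ε k)) (hx.ne_zero (ε k)) (hz k)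
  obtain ⟨n, hn', rfl⟩ := key (neg_mem_range_root ⟨ε 1, rfl⟩) (hx.neg_mem_rootSubspace (ε 1))
    (hx.neg_ne_zero (ε 1)) hn
  refine ⟨l₂, l₃, m, n, h₂, h₃, hm, hn', mem_stabilizerIn_iff.mpr
    ⟨hc.isTransversal_mem_parabolic (hx.isTransversal h₂ h₃ hm hn'), ?_⟩⟩
  simpa only [stabilizerVector, hmz] using h

end Chevalley

end QuasiReductive

theorem theorem5p6 {L : Type*} [LieRing L] [LieAlgebra ℂ L] [FiniteDimensional ℂ L]
    [LieAlgebra.IsSimple ℂ L] {H : LieSubalgebra ℂ L} [H.IsCartanSubalgebra]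
    (b : (IsKilling.rootSystem H).Base) (hb : QuasiReductive.IsExceptionalType b)
    (S : Set H.root) (hS : S ⊆ b.support) (hcard : S.ncard = 2)
    (hconn : QuasiReductive.IsConnectedSet S)
    (α₂ : H.root) (hα₂S : α₂ ∈ S) (hα₂ : QuasiReductive.IsJoinedToLowestRoot b α₂) :
    QuasiReductive.IsQuasiReductive (QuasiReductive.parabolic b S) ∧
    (QuasiReductive.IsTypeFOrE b → ∀ α₁ ∈ S, α₁ ≠ α₂ →
      ∃ (θ β₂ β₃ : H.root) (ε : Fin 4 → H.root),
        QuasiReductive.IsHighestRoot S θ ∧ b.IsPos β₂ ∧ b.IsPos β₃ ∧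
        (∀ k, ε k ∈ QuasiReductive.cascadeRoots (↑b.support : Set H.root)) ∧
        α₁ = ε 1 ∧
        (IsKilling.rootSystem H).root α₂ = (1 / 2 : ℂ) •
          ((IsKilling.rootSystem H).root (ε 0) - (IsKilling.rootSystem H).root (ε 1) -
            (IsKilling.rootSystem H).root (ε 2) - (IsKilling.rootSystem H).root (ε 3)) ∧
        (IsKilling.rootSystem H).root β₂ = (IsKilling.rootSystem H).root (ε 0) -
          (IsKilling.rootSystem H).root θ - (IsKilling.rootSystem H).root (ε 2) ∧
        (IsKilling.rootSystem H).root β₃ = (IsKilling.rootSystem H).root (ε 0) -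
          (IsKilling.rootSystem H).root θ - (IsKilling.rootSystem H).root (ε 3) ∧
        ∀ x : Weight ℂ H L → L, QuasiReductive.IsChevalleySystem x →
          (∃ a c : H.root → ℂ,
            (∀ ε ∈ QuasiReductive.cascadeRoots (↑b.support : Set H.root), a ε ≠ 0) ∧
            (∀ ε ∈ QuasiReductive.cascadeRoots S, c ε ≠ 0) ∧
            QuasiReductive.IsRegularForm (QuasiReductive.killingFunctional
              (QuasiReductive.parabolic b S)
              (QuasiReductive.cascadeVector x (↑b.support : Set H.root) S a c))) ∧
          ∀ a c : H.root → ℂ,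
            (∀ ε ∈ QuasiReductive.cascadeRoots (↑b.support : Set H.root), a ε ≠ 0) →
            (∀ ε ∈ QuasiReductive.cascadeRoots S, c ε ≠ 0) →
            QuasiReductive.IsRegularForm (QuasiReductive.killingFunctional
              (QuasiReductive.parabolic b S)
              (QuasiReductive.cascadeVector x (↑b.support : Set H.root) S a c)) →
            QuasiReductive.IsReductiveType (QuasiReductive.killingFunctional
              (QuasiReductive.parabolic b S)
              (QuasiReductive.cascadeVector x (↑b.support : Set H.root) S a c)) ∧
            (∃ (l₂ l₃ : ℂ) (m : Fin 4 → ℂ) (n : ℂ),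
              l₂ ≠ 0 ∧ l₃ ≠ 0 ∧ (∀ k, m k ≠ 0) ∧ n ≠ 0 ∧
              QuasiReductive.stabilizerVector x θ β₂ β₃ ε l₂ l₃ m n ∈
                QuasiReductive.stabilizerIn (QuasiReductive.parabolic b S)
                  (QuasiReductive.cascadeVector x (↑b.support : Set H.root) S a c)) ∧
            ∀ (l₂ l₃ : ℂ) (m : Fin 4 → ℂ) (n : ℂ),
              l₂ ≠ 0 → l₃ ≠ 0 → (∀ k, m k ≠ 0) → n ≠ 0 →
              QuasiReductive.stabilizerVector x θ β₂ β₃ ε l₂ l₃ m n ∈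
                QuasiReductive.stabilizerIn (QuasiReductive.parabolic b S)
                  (QuasiReductive.cascadeVector x (↑b.support : Set H.root) S a c) →
              (LieAlgebra.ad ℂ L
                (QuasiReductive.stabilizerVector x θ β₂ β₃ ε l₂ l₃ m n)).IsSemisimple ∧
              Disjoint (QuasiReductive.cascadeAnnihilator (↑b.support : Set H.root))
                (Submodule.span ℂ {QuasiReductive.stabilizerVector x θ β₂ β₃ ε l₂ l₃ m n}) ∧
              QuasiReductive.stabilizerIn (QuasiReductive.parabolic b S)
                  (QuasiReductive.cascadeVector x (↑b.support : Set H.root) S a c) =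
                QuasiReductive.cascadeAnnihilator (↑b.support : Set H.root) ⊔
                Submodule.span ℂ {QuasiReductive.stabilizerVector x θ β₂ β₃ ε l₂ l₃ m n}) := by
  have hpair : ∀ α₁ ∈ S, α₁ ≠ α₂ → S = {α₁, α₂} := fun α₁ hα₁ hne => by
    refine (Set.eq_of_subset_of_ncard_le ?_ ?_ ((Set.finite_coe_iff).mp inferInstance)).symm
    · rintro _ (rfl | rfl)
      exacts [hα₁, hα₂S]
    · rw [hcard, Set.ncard_pair hne]
  constructor
  · rcases hb with ⟨e, -⟩ | hb
    -- in type `G₂`, `S` consists of all simple roots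
    · refine QuasiReductive.isQuasiReductive_of_support_subset (Set.eq_of_subset_of_ncard_le hS ?_
        ((Set.finite_coe_iff).mp inferInstance)).symm.subset
      rw [hcard, Set.ncard_coe_finset, ← Fintype.card_coe, Fintype.card_congr e, Fintype.card_fin]
    · obtain ⟨α₁, hα₁, hne⟩ := Set.exists_ne_of_one_lt_ncard (by omega : 1 < S.ncard) α₂
      obtain rfl := hpair α₁ hα₁ hne
      obtain ⟨θ, β₂, β₃, ε, -, hc⟩ :=
        hb.exists_isCascadeConfiguration (hS hα₁) hα₂ hne hconn
      exact hc.isQuasiReductive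
  · intro hb α₁ hα₁ hne
    obtain rfl := hpair α₁ hα₁ hne
    obtain ⟨θ, β₂, β₃, ε, hθ, hc⟩ := hb.exists_isCascadeConfiguration (hS hα₁) hα₂ hne hconn
    have hθmem := (hc.pair.mem_cascadeRoots_iff hconn hθ).mpr rfl
    refine ⟨θ, β₂, β₃, ε, hθ, hc.isPos₂, hc.isPos₃, hc.quadruple.mem, hc.quadruple.eq_one, ?_,
      hc.root₂, hc.root₃, fun x hx => ⟨⟨1, 1, fun _ _ => one_ne_zero, fun _ _ => one_ne_zero, ?_⟩,
        fun a c ha hc' _ => ?_⟩⟩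
    · rw [hc.root_one, ← hc.two_smul_root, ← two_smul ℂ, smul_smul]
      norm_num
    -- every choice of nonzero coefficients gives a regular form
    · have hw := hx.isCascadeFamily (b := b) (θ := θ) (a := 1) (c := 1)
        (fun _ _ => one_ne_zero) one_ne_zero
      obtain ⟨y, hy, hys⟩ := hc.exists_mem_stabilizerIn hw
      rw [hc.pair.cascadeVector_eq hconn hθ]
      exact hc.isRegularForm hw hy hys
    · have hw := hx.isCascadeFamily ha (hc' θ hθmem)
      rw [hc.pair.cascadeVector_eq hconn hθ]
      obtain ⟨y, hy, hys⟩ := hc.exists_mem_stabilizerIn hw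
      refine ⟨hc.isReductiveType hw hy hys, hc.exists_stabilizerVector_mem hx hw, ?_⟩
      intro l₂ l₃ m n h₂ h₃ hm hn hmem
      have ht := hx.isTransversal (θ := θ) (β₂ := β₂) (β₃ := β₃) (ε := ε) h₂ h₃ hm hn
      exact ⟨hc.isSemisimple_ad hw ht hmem, hc.disjoint_span ht, hc.stabilizerIn_eq hw ht hmem⟩
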